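/- \textbf{Definitions.} A \emph{rectilinear angle sequence} of length $n$ is a sequence $S=(s_1,\dots,s_n)\in\{L,R\}^n$ of left ($+90^\circ$) and right ($-90^\circ$) turns. All polygons are simple rectilinear polygons with vertices in $\mathbb{Z}^2$ and an actual turn of $\pm 90^\circ$ at every vertex. A polygon \emph{realizes} $S$ if the turns at its vertices, encountered in this order during a counterclockwise walk along its boundary that starts at a suitable vertex, form the sequence $S$. A polygon is \emph{$x$-monotone} if its boundary consists of two (weakly) $x$-monotone chains, and an angle sequence is \emph{$x$-monotone} if it is realized by some $x$-monotone polygon. The \emph{bounding box} of a polygon is its smallest axis-parallel enclosing rectangle. \textbf{Theorem.} There is an algorithm that, given an $x$-monotone angle sequence $S$ of length $n$, computes in $O(n^3)$ time a polygon $P$ that realizes $S$ and whose bounding box has minimum area among all polygons that realize $S$. Precisely: there are a program for the unit-cost word RAM and constants $c, C$ such that for every $n$ and every $x$-monotone angle sequence $S$ of length $n$ the program, given $n$ and $S$, halts after at most $C n^3$ steps, never uses a number larger than $n^c$ (that is, words of $O(\log n)$ bits suffice), and outputs the coordinates of the vertices of such a polygon $P$, listed along the counterclockwise walk whose turns form $S$.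 -/

import Mathlib

/-! ### Rectilinear angle sequences and grid polygons -/

/-- A turn of a rectilinear walk: `left` is a turn by `+90°`, `right` a turn by `-90°`. -/
inductive Turn : Type
  | left : Turn
  | right : Turn

/-- A rectilinear angle sequence of length `n`. -/
abbrev AngleSequence (n : ℕ) : Type := Fin n → Turn

/-- A (closed, cyclic) polygon with `n` vertices on the integer grid. Its `i`-th edge goes from
vertex `i` to the cyclically next vertex `finRotate n i`. -/
abbrev GridPolygon (n : ℕ) : Type := Polygon (ℤ × ℤ) n

namespace GridPolygon

variable {n : ℕ}

/-- The determinant of two planar vectors. -/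
def cross (u v : ℤ × ℤ) : ℤ := u.1 * v.2 - u.2 * v.1

/-- The vector along the `i`-th edge. -/
def edgeVec (P : GridPolygon n) (i : Fin n) : ℤ × ℤ := P (finRotate n i) - P i

/-- The polygon as a polygon in the real plane. -/
def toReal (P : GridPolygon n) : Polygon (ℝ × ℝ) n :=
  ⟨fun i => (((P i).1 : ℝ), ((P i).2 : ℝ))⟩

/-- Every edge is horizontal or vertical. -/
def IsRectilinear (P : GridPolygon n) : Prop :=
  ∀ i, (P.edgeVec i).1 = 0 ∨ (P.edgeVec i).2 = 0

/-- The polygon is simple: its edges are nondegenerate segments of the real plane, consecutive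
edges meet exactly in their common vertex, and all other pairs of edges are disjoint. -/
def IsSimple (P : GridPolygon n) : Prop :=
  P.HasNondegenerateEdges ∧
  (∀ i, P.toReal.edgeSet ℝ i ∩ P.toReal.edgeSet ℝ (finRotate n i)
      = {P.toReal (finRotate n i)}) ∧
  (∀ i j, i ≠ j → j ≠ finRotate n i → i ≠ finRotate n j →
      Disjoint (P.toReal.edgeSet ℝ i) (P.toReal.edgeSet ℝ j))

/-- Twice the signed area (shoelace formula). -/
def doubleSignedArea (P : GridPolygon n) : ℤ := ∑ i, cross (P i) (P (finRotate n i))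

/-- The vertices are listed in counterclockwise order (for simple polygons). -/
def IsCounterclockwise (P : GridPolygon n) : Prop := 0 < P.doubleSignedArea

/-- The walk `0, 1, …, n - 1` turns at vertex `i` in the way described by the given turn.
For a simple counterclockwise rectilinear polygon, a left turn is the same as an interior angle
of `90°` and a right turn is the same as an interior angle of `270°`. -/
def HasTurn (P : GridPolygon n) (i : Fin n) : Turn → Prop
  | Turn.left => 0 < cross (P.edgeVec ((finRotate n).symm i)) (P.edgeVec i)
  | Turn.right => cross (P.edgeVec ((finRotate n).symm i)) (P.edgeVec i) < 0

/-- `P` is a simple rectilinear polygon on the integer grid, listed as a counterclockwise walk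
along its boundary, and the turns at the vertices encountered form the sequence `S`. -/
def Realizes (P : GridPolygon n) (S : AngleSequence n) : Prop :=
  P.IsRectilinear ∧ P.IsSimple ∧ P.IsCounterclockwise ∧ ∀ i, P.HasTurn i (S i)

/-- The boundary of `P` consists of two (weakly) `x`-monotone chains: from some vertex `a` on, the
first `m` edges never go to the left and the remaining `n - m` edges never go to the right. -/
def IsXMonotone (P : GridPolygon n) : Prop :=
  ∃ a : Fin n, ∃ m ≤ n, ∀ j < n,
    (j < m → 0 ≤ (P.edgeVec ((finRotate n)^[j] a)).1) ∧
    (m ≤ j → (P.edgeVec ((finRotate n)^[j] a)).1 ≤ 0)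

/-- The width of the bounding box. -/
noncomputable def width (P : GridPolygon n) : ℤ := (⨆ i, (P i).1) - ⨅ i, (P i).1

/-- The height of the bounding box. -/
noncomputable def height (P : GridPolygon n) : ℤ := (⨆ i, (P i).2) - ⨅ i, (P i).2

/-- The area of the bounding box. -/
noncomputable def boundingBoxArea (P : GridPolygon n) : ℤ := P.width * P.height

/-- `P` realizes `S`, and no polygon realizing `S` has a bounding box of smaller area. -/
def RealizesWithMinBoundingBox (P : GridPolygon n) (S : AngleSequence n) : Prop :=
  P.Realizes S ∧ ∀ Q : GridPolygon n, Q.Realizes S → P.boundingBoxArea ≤ Q.boundingBoxArea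

end GridPolygon

/-- An angle sequence is `x`-monotone if it is realized by some `x`-monotone polygon. -/
def AngleSequence.IsXMonotone {n : ℕ} (S : AngleSequence n) : Prop :=
  ∃ P : GridPolygon n, P.Realizes S ∧ P.IsXMonotone

/-! ### A unit-cost word RAM

The machine has registers and finitely many randomly accessible arrays (a program names the
registers and arrays it uses by fixed numbers; array cells are addressed indirectly through
computed indices). All cells hold natural numbers. A program is a finite piece of structured code;
every arithmetic operation, comparison, register access, array access, assignment and control
step costs one unit of time. The word bound `B` is the largest number that a word can hold:
an execution exists only if no number occurring in it exceeds `B`. -/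

namespace RAM

/-- A memory state: the contents of the registers and of the arrays. -/
structure State : Type where
  reg : ℕ → ℕ
  arr : ℕ → ℕ → ℕ

/-- Store a value in a register. -/
def State.setReg (s : State) (r v : ℕ) : State :=
  ⟨Function.update s.reg r v, s.arr⟩

/-- Store a value in a cell of an array. -/
def State.setArr (s : State) (a k v : ℕ) : State :=
  ⟨s.reg, Function.update s.arr a (Function.update (s.arr a) k v)⟩

/-- Arithmetic expressions. -/
inductive Expr : Type
  | const : ℕ → Expr
  | reg : ℕ → Expr
  | arr : ℕ → Expr → Expr
  | add : Expr → Expr → Expr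
  | sub : Expr → Expr → Expr
  | mul : Expr → Expr → Expr

/-- The value of an expression; subtraction is truncated at `0`. -/
def Expr.eval (s : State) : Expr → ℕ
  | const k => k
  | reg r => s.reg r
  | arr a e => s.arr a (e.eval s)
  | add e f => e.eval s + f.eval s
  | sub e f => e.eval s - f.eval s
  | mul e f => e.eval s * f.eval s

/-- The time to evaluate an expression: one unit for every operation and every access. -/
def Expr.cost : Expr → ℕ
  | const _ => 1
  | reg _ => 1
  | arr _ e => e.cost + 1
  | add e f => e.cost + f.cost + 1
  | sub e f => e.cost + f.cost + 1
  | mul e f => e.cost + f.cost + 1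

/-- All values that occur in the evaluation of an expression are at most `B`. -/
def Expr.Fits (B : ℕ) (s : State) : Expr → Prop
  | const k => k ≤ B
  | reg r => s.reg r ≤ B
  | arr a e => e.Fits B s ∧ s.arr a (e.eval s) ≤ B
  | add e f => e.Fits B s ∧ f.Fits B s ∧ e.eval s + f.eval s ≤ B
  | sub e f => e.Fits B s ∧ f.Fits B s
  | mul e f => e.Fits B s ∧ f.Fits B s ∧ e.eval s * f.eval s ≤ B

/-- Tests. -/
inductive Test : Type
  | le : Expr → Expr → Test
  | eq : Expr → Expr → Test
  | not : Test → Test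
  | and : Test → Test → Test

/-- The truth of a test. -/
def Test.Holds (s : State) : Test → Prop
  | le e f => e.eval s ≤ f.eval s
  | eq e f => e.eval s = f.eval s
  | not b => ¬ b.Holds s
  | and b c => b.Holds s ∧ c.Holds s

/-- The time to evaluate a test. -/
def Test.cost : Test → ℕ
  | le e f => e.cost + f.cost + 1
  | eq e f => e.cost + f.cost + 1
  | not b => b.cost + 1
  | and b c => b.cost + c.cost + 1

/-- All values that occur in the evaluation of a test are at most `B`. -/
def Test.Fits (B : ℕ) (s : State) : Test → Prop
  | le e f => e.Fits B s ∧ f.Fits B s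
  | eq e f => e.Fits B s ∧ f.Fits B s
  | not b => b.Fits B s
  | and b c => b.Fits B s ∧ c.Fits B s

/-- Programs. -/
inductive Program : Type
  | skip : Program
  | setReg : ℕ → Expr → Program
  | setArr : ℕ → Expr → Expr → Program
  | seq : Program → Program → Program
  | ite : Test → Program → Program → Program
  | loop : Test → Program → Program

/-- `Exec B p s s' t`: with word bound `B`, the program `p`, started in state `s`, halts in state
`s'` after exactly `t` units of time, and no number that occurs exceeds `B`.
Here `loop b p` is the loop "while `b` holds, do `p`". -/
inductive Exec (B : ℕ) : Program → State → State → ℕ → Prop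
  | skip (s : State) : Exec B Program.skip s s 1
  | setReg (s : State) (r : ℕ) (e : Expr) (he : e.Fits B s) :
      Exec B (Program.setReg r e) s (s.setReg r (e.eval s)) (e.cost + 1)
  | setArr (s : State) (a : ℕ) (k e : Expr) (hk : k.Fits B s) (he : e.Fits B s) :
      Exec B (Program.setArr a k e) s (s.setArr a (k.eval s) (e.eval s)) (k.cost + e.cost + 1)
  | seq {p q : Program} {s₁ s₂ s₃ : State} {t u : ℕ}
      (hp : Exec B p s₁ s₂ t) (hq : Exec B q s₂ s₃ u) :
      Exec B (Program.seq p q) s₁ s₃ (t + u)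
  | iteTrue {b : Test} {p q : Program} {s s' : State} {t : ℕ}
      (hf : b.Fits B s) (hb : b.Holds s) (hp : Exec B p s s' t) :
      Exec B (Program.ite b p q) s s' (b.cost + 1 + t)
  | iteFalse {b : Test} {p q : Program} {s s' : State} {t : ℕ}
      (hf : b.Fits B s) (hb : ¬ b.Holds s) (hq : Exec B q s s' t) :
      Exec B (Program.ite b p q) s s' (b.cost + 1 + t)
  | loopTrue {b : Test} {p : Program} {s₁ s₂ s₃ : State} {t u : ℕ}
      (hf : b.Fits B s₁) (hb : b.Holds s₁) (hp : Exec B p s₁ s₂ t)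
      (hl : Exec B (Program.loop b p) s₂ s₃ u) :
      Exec B (Program.loop b p) s₁ s₃ (b.cost + 1 + t + u)
  | loopFalse {b : Test} {p : Program} {s : State}
      (hf : b.Fits B s) (hb : ¬ b.Holds s) :
      Exec B (Program.loop b p) s s (b.cost + 1)

/-- The encoding of a turn by a number. -/
def encodeTurn : Turn → ℕ
  | Turn.left => 0
  | Turn.right => 1

/-- The input state for an angle sequence: register `0` holds the length `n`, the first `n` cells
of array `0` hold the turns, and everything else is `0`. -/
def input {n : ℕ} (S : AngleSequence n) : State where
  reg := fun r => if r = 0 then n else 0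
  arr := fun a k => if a = 0 then (if h : k < n then encodeTurn (S ⟨k, h⟩) else 0) else 0

/-- The polygon that a final state describes: vertex `i` has its `x`-coordinate in cell `i` of
array `1` and its `y`-coordinate in cell `i` of array `2`. -/
def output (n : ℕ) (s : State) : GridPolygon n :=
  ⟨fun i => ((s.arr 1 i : ℤ), (s.arr 2 i : ℤ))⟩

end RAM

/-! ### Cheapest column sequences -/

/-! Cut the boundary walk into pairs, a vertical edge followed by a horizontal one, with `N = n / 2`
pairs. Opposite turns at the two ends of a vertical edge keep the horizontal direction, equal turns
reverse it. In an x-monotone polygon only the leftmost and the rightmost vertical edge reverse the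
direction, and both have two left turns: this is `Pattern`. It concerns the sequence alone, so every
realization, after a rotation by a multiple of 90°, runs to the right along a lower chain of `p`
horizontal edges and back along an upper chain of `N - p` edges (`Frame`). Rotation preserves the
bounding box area, hence only frames matter. A frame whose vertical steps obey the turns is a simple
counterclockwise polygon as soon as each lower edge is strictly below each upper edge that touches a
common vertical line (`Separated`, `GridPolygon.realizes_of_frame`). Conversely, disjointness of the
edges forces this order, because a chain could only pass the other one by crossing it
(`Frame.separated_of_edgesDisjoint`).

For a fixed height `h` the two coordinates decouple. Push the lower chain down and the upper chain
up as far as the turns allow; the distances `H` from the bottom and from the top are the least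
labels (`leastLabelling_leastLabel`). In every drawing of height `h` the distances are at least `H`,
so touching pairs satisfy `Below`: their labels add up to less than `h`. Conversely, if all touching
pairs satisfy `Below`, the extreme heights give a valid drawing (`Draw.exists_frame`).

What remains is to minimize the width when only pairs in a given relation may touch. From left to
right, the unit columns of a drawing show pairs (lower edge, upper edge). A column change advances
one chain, or both on the same vertical line; in the latter case the two mixed pairs touch as well
and must be allowed. The least width is therefore one plus a shortest path length in a grid of `p *
(N - p)` pairs, `colDist`: no drawing is narrower (`colDist_le_of_drawing`), and giving each column
of a shortest path width one attains it (`Draw.succ_left`, `Draw.succ_right`, `Draw.succ_both`).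

Labels are at most `2 * N`, so beyond a linear height `Below` always holds and more height is of no
use. Linearly many heights with a quadratic table each give cubic time. The second half of the file
implements this; `Runs` is a Hoare-style judgement that also tracks time and word size. -/

open Classical in
/-- The least number of column changes on the way from the pair `(0, 0)` to the pair `(i, j)`
along pairs related by `c`, where a change advances one index (or both, if the two mixed pairs
are related as well); the value `K` stands for infinity. -/
noncomputable def colDist (c : ℕ → ℕ → Prop) (K : ℕ) : ℕ → ℕ → ℕ
  | 0, 0 => if c 0 0 then 0 else K
  | i + 1, 0 => if c (i + 1) 0 then min K (colDist c K i 0 + 1) else K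
  | 0, j + 1 => if c 0 (j + 1) then min K (colDist c K 0 j + 1) else K
  | i + 1, j + 1 =>
    if c (i + 1) (j + 1) then
      if c i (j + 1) ∧ c (i + 1) j then
        min K (min (min (colDist c K (i + 1) j) (colDist c K i (j + 1))) (colDist c K i j) + 1)
      else min K (min (colDist c K (i + 1) j) (colDist c K i (j + 1)) + 1)
    else K
termination_by i j => i + j

theorem colDist_le_bound (c : ℕ → ℕ → Prop) (K i j : ℕ) : colDist c K i j ≤ K := by
  rcases i with _ | i <;> rcases j with _ | j <;> rw [colDist] <;> split_ifs <;> simp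

/-- Two chains of intervals with the same left end: in every drawing, the column distance of a
pair of overlapping intervals is at most the length of the part to the left of the overlap. -/
theorem colDist_le_of_drawing {c : ℕ → ℕ → Prop} (K : ℕ) {p q : ℕ} {a b : ℕ → ℤ}
    (ha : ∀ i < p, a i < a (i + 1)) (hb : ∀ j < q, b j < b (j + 1)) (h0 : a 0 = b 0)
    (hc : ∀ i < p, ∀ j < q, a i ≤ b (j + 1) → b j ≤ a (i + 1) → c i j) :
    ∀ m i j, i + j = m → i < p → j < q → a i < b (j + 1) → b j < a (i + 1) →
      colDist c K i j ≤ i + j ∧ (colDist c K i j : ℤ) ≤ max (a i) (b j) - a 0 := by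
  have ma : ∀ i ≤ p, a 0 + i ≤ a i := by
    intro i
    induction i with
    | zero => simp
    | succ i ih => intro h; have := ih (by omega); have := ha i (by omega); push_cast; omega
  have mb : ∀ i ≤ q, b 0 + i ≤ b i := by
    intro i
    induction i with
    | zero => simp
    | succ i ih => intro h; have := ih (by omega); have := hb i (by omega); push_cast; omega
  intro m
  induction m using Nat.strong_induction_on with
  | _ m ih =>
    intro i j hm hi hj h1 h2
    have hcij := hc i hi j hj h1.le h2.le
    rcases i with _ | i
    · rcases j.eq_zero_or_pos with rfl | hj0
      · rw [colDist, if_pos hcij]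
        simp [h0]
      obtain ⟨j, rfl⟩ : ∃ l, j = l + 1 := ⟨j - 1, by omega⟩
      have hbj := hb j (by omega)
      have := mb j (by omega)
      have := ih _ (by omega) 0 j rfl hi (by omega) (by omega) (by omega)
      rw [colDist, if_pos hcij]
      omega
    rcases j with _ | j
    · have haj := ha i (by omega)
      have := ma i (by omega)
      have := ih _ (by omega) i 0 rfl (by omega) hj (by omega) (by omega)
      rw [colDist, if_pos hcij]
      omega
    have hai := ha i (by omega)
    have hbj := hb j (by omega)
    rw [colDist, if_pos hcij]
    -- The overlap begins at the larger left end. The column just before it shows the predecessor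
    -- pair: the chain whose interval starts later steps back, and both do if the starts coincide.
    -- In that case the mixed pairs touch on the common line, so `hc` applies to them.
    rcases lt_trichotomy (a (i + 1)) (b (j + 1)) with h | h | h
    · have := ih _ (by omega) (i + 1) j rfl hi (by omega) (by omega) (by omega)
      split_ifs <;> omega
    · have := ih _ (by omega) i j rfl (by omega) (by omega) (by omega) (by omega)
      rw [if_pos ⟨hc i (by omega) (j + 1) hj (by have := hb (j+1) hj; omega) (by omega),
        hc (i + 1) hi j (by omega) (by omega) (by have := ha (i+1) hi; omega)⟩]
      omega
    · have := ih _ (by omega) i (j + 1) rfl (by omega) hj (by omega) (by omega)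
      split_ifs <;> omega

/-- The last overlap has width at least one itself, which accounts for the extra column. The bound
in terms of `p + q` later shows that the distance is not the value that stands for infinity. -/
theorem colDist_lt_of_drawing {c : ℕ → ℕ → Prop} (K : ℕ) {p q : ℕ} {a b : ℕ → ℤ}
    (hp : 0 < p) (hq : 0 < q)
    (ha : ∀ i < p, a i < a (i + 1)) (hb : ∀ j < q, b j < b (j + 1)) (h0 : a 0 = b 0)
    (h1 : a p = b q)
    (hc : ∀ i < p, ∀ j < q, a i ≤ b (j + 1) → b j ≤ a (i + 1) → c i j) :
    colDist c K (p - 1) (q - 1) + 2 ≤ p + q ∧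
      (colDist c K (p - 1) (q - 1) : ℤ) + 1 ≤ a p - a 0 := by
  obtain ⟨p, rfl⟩ : ∃ k, p = k + 1 := ⟨p - 1, by omega⟩
  obtain ⟨q, rfl⟩ : ∃ k, q = k + 1 := ⟨q - 1, by omega⟩
  have hp' := ha p (by omega)
  have hq' := hb q (by omega)
  have := colDist_le_of_drawing K ha hb h0 hc (p + q) p q rfl (by omega) (by omega) (by omega)
    (by omega)
  simp only [Nat.add_sub_cancel]
  omega

/-! ### Assembling a drawing column by column -/

/-- A partial drawing of the intervals `0, …, i` and `0, …, j` of two chains, given by the left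
ends of the intervals, whose last column starts at `X`: pairs of touching intervals are
related by `c`. -/
structure Draw (c : ℕ → ℕ → Prop) (i j X : ℕ) (a b : ℕ → ℕ) : Prop where
  a_zero : a 0 = 0
  b_zero : b 0 = 0
  a_lt : ∀ k < i, a k < a (k + 1)
  b_lt : ∀ k < j, b k < b (k + 1)
  a_le : a i ≤ X
  b_le : b j ≤ X
  rel : ∀ k ≤ i, ∀ l ≤ j, (k < i → b l ≤ a (k + 1)) → (l < j → a k ≤ b (l + 1)) → c k l

namespace Draw

variable {c : ℕ → ℕ → Prop} {i j X : ℕ} {a b a' b' : ℕ → ℕ}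

theorem a_mono (h : Draw c i j X a b) : ∀ m k, k + m ≤ i → a k ≤ a (k + m) := by
  intro m
  induction m with
  | zero => simp
  | succ m ih => intro k hk; have := ih k (by omega); have := h.a_lt (k + m) (by omega); grind

theorem b_mono (h : Draw c i j X a b) : ∀ m k, k + m ≤ j → b k ≤ b (k + m) := by
  intro m
  induction m with
  | zero => simp
  | succ m ih => intro k hk; have := ih k (by omega); have := h.b_lt (k + m) (by omega); grind

theorem a_le' (h : Draw c i j X a b) (k : ℕ) (hk : k ≤ i) : a k ≤ X := by
  have := h.a_mono (i - k) k (by omega)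
  have := h.a_le
  rw [Nat.add_sub_cancel' hk] at *
  omega

theorem b_le' (h : Draw c i j X a b) (k : ℕ) (hk : k ≤ j) : b k ≤ X := by
  have := h.b_mono (j - k) k (by omega)
  have := h.b_le
  rw [Nat.add_sub_cancel' hk] at *
  omega

theorem zero (hc : c 0 0) (ha : a 0 = 0) (hb : b 0 = 0) : Draw c 0 0 0 a b := by
  refine ⟨ha, hb, by simp, by simp, by omega, by omega, ?_⟩
  intro k hk l hl _ _
  obtain rfl : k = 0 := by omega
  obtain rfl : l = 0 := by omega
  exact hc

/-- All earlier starts are at most `X`, so every upper interval before the `j`-th ends before the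
new lower interval begins at `X + 1`. The current pair is the only new touching pair. -/
theorem succ_left (h : Draw c i j X a b) (hX : a (i + 1) = X + 1) (hc : c (i + 1) j) :
    Draw c (i + 1) j (X + 1) a b := by
  refine ⟨h.a_zero, h.b_zero, ?_, h.b_lt, by omega, h.b_le.trans (by omega), ?_⟩
  · intro k hk
    rcases Nat.lt_add_one_iff_lt_or_eq.1 hk with hk | rfl
    · exact h.a_lt k hk
    · have := h.a_le; omega
  · intro k hk l hl h1 h2
    rcases Nat.le_add_one_iff.1 hk with hk | rfl
    · exact h.rel k hk l hl (fun h3 => h1 (by omega)) h2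
    · rcases hl.lt_or_eq with hl | rfl
      · have := h2 hl; have := h.b_le' (l + 1) (by omega); omega
      · exact hc

theorem succ_right (h : Draw c i j X a b) (hX : b (j + 1) = X + 1) (hc : c i (j + 1)) :
    Draw c i (j + 1) (X + 1) a b := by
  refine ⟨h.a_zero, h.b_zero, h.a_lt, ?_, h.a_le.trans (by omega), by omega, ?_⟩
  · intro k hk
    rcases Nat.lt_add_one_iff_lt_or_eq.1 hk with hk | rfl
    · exact h.b_lt k hk
    · have := h.b_le; omega
  · intro k hk l hl h1 h2
    rcases Nat.le_add_one_iff.1 hl with hl | rfl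
    · exact h.rel k hk l hl h1 (fun h3 => h2 (by omega))
    · rcases hk.lt_or_eq with hk | rfl
      · have := h1 hk; have := h.a_le' (k + 1) (by omega); omega
      · exact hc

/-- Two intervals that start on the same line each touch the interval of the other chain that ends
there; this is why the mixed pairs enter here and in `colDist`. -/
theorem succ_both (h : Draw c i j X a b) (hX : a (i + 1) = X + 1) (hX' : b (j + 1) = X + 1)
    (hc : c (i + 1) (j + 1)) (hc1 : c (i + 1) j) (hc2 : c i (j + 1)) :
    Draw c (i + 1) (j + 1) (X + 1) a b := by
  refine ⟨h.a_zero, h.b_zero, ?_, ?_, by omega, by omega, ?_⟩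
  · intro k hk
    rcases Nat.lt_add_one_iff_lt_or_eq.1 hk with hk | rfl
    · exact h.a_lt k hk
    · have := h.a_le; omega
  · intro k hk
    rcases Nat.lt_add_one_iff_lt_or_eq.1 hk with hk | rfl
    · exact h.b_lt k hk
    · have := h.b_le; omega
  · intro k hk l hl h1 h2
    rcases Nat.le_add_one_iff.1 hl with hl | rfl
    · rcases Nat.le_add_one_iff.1 hk with hk | rfl
      · exact h.rel k hk l hl (fun h3 => h1 (by omega)) (fun h3 => h2 (by omega))
      · rcases hl.lt_or_eq with hl | rfl
        · have := h2 (by omega); have := h.b_le' (l + 1) (by omega); omega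
        · exact hc1
    · rcases Nat.le_add_one_iff.1 hk with hk | rfl
      · rcases hk.lt_or_eq with hk | rfl
        · have := h1 (by omega); have := h.a_le' (k + 1) (by omega); omega
        · exact hc2
      · exact hc

end Draw

/-! ### Two chains of horizontal edges -/

/-- If the chain `b` starts to the left of `x` and ends to the right of it, then one of its
intervals contains `x`. -/
theorem exists_mem_interval {q : ℕ} {b : ℕ → ℤ} {x : ℤ} (hq : 0 < q) (h0 : b 0 ≤ x)
    (h1 : x ≤ b q) : ∃ j < q, b j ≤ x ∧ x ≤ b (j + 1) := by
  induction q with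
  | zero => omega
  | succ q ih =>
    by_cases h : b q ≤ x
    · exact ⟨q, by omega, h, h1⟩
    · rcases Nat.eq_zero_or_pos q with rfl | h'
      · exact absurd h0 h
      · obtain ⟨j, hj, h2⟩ := ih h' (by omega)
        exact ⟨j, by omega, h2⟩

/-- Edges of a lower and an upper chain that start in the right order and do not cross are in the
right order wherever they touch. -/
theorem lower_lt_upper_of_noCross {p q : ℕ} {a b y z : ℕ → ℤ}
    (ha : ∀ i < p, a i < a (i + 1)) (hb : ∀ j < q, b j < b (j + 1)) (h0 : a 0 = b 0)
    (hyz : y 0 < z 0)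
    (hv : ∀ i j, i + 1 < p → j < q → b j ≤ a (i + 1) → a (i + 1) ≤ b (j + 1) →
      z j ∉ Set.uIcc (y i) (y (i + 1)))
    (hv' : ∀ i j, i < p → j + 1 < q → a i ≤ b (j + 1) → b (j + 1) ≤ a (i + 1) →
      y i ∉ Set.uIcc (z j) (z (j + 1))) :
    ∀ m i j, i + j = m → i < p → j < q → a i ≤ b (j + 1) → b j ≤ a (i + 1) → y i < z j := by
  have ma : ∀ i ≤ p, a 0 + i ≤ a i := by
    intro i
    induction i with
    | zero => simp
    | succ i ih => intro h; have := ih (by omega); have := ha i (by omega); push_cast; omega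
  have mb : ∀ i ≤ q, b 0 + i ≤ b i := by
    intro i
    induction i with
    | zero => simp
    | succ i ih => intro h; have := ih (by omega); have := hb i (by omega); push_cast; omega
  intro m
  induction m with
  | zero =>
    intro i j hm _ _ _ _
    obtain ⟨rfl, rfl⟩ : i = 0 ∧ j = 0 := by omega
    exact hyz
  | succ m ih =>
    intro i j hm hi hj h1 h2
    -- Retract the chain whose edge starts later. A single vertical edge of that chain separates the
    -- two pairs, and since it misses the horizontal edge of the other chain, the order cannot flip.
    by_cases h : b j ≤ a i
    · obtain ⟨i, rfl⟩ : ∃ k, i = k + 1 := by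
        rcases i with _ | i
        · have := mb j hj.le; omega
        · exact ⟨i, rfl⟩
      have := ha i (by omega)
      have := ih i j (by omega) (by omega) hj (by omega) h
      have := hv i j hi hj h h1
      rw [Set.mem_uIcc] at this
      omega
    · obtain ⟨j, rfl⟩ : ∃ k, j = k + 1 := by
        rcases j with _ | j
        · have := ma i hi.le; omega
        · exact ⟨j, rfl⟩
      have := hb j (by omega)
      have := ih i j (by omega) hi (by omega) (by omega) (by omega)
      have := hv' i j hi hj (by omega) h2
      rw [Set.mem_uIcc] at this
      omega

/-- A weighted sum over a chain of intervals is a sum over unit columns. -/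
theorem exists_stepFunction {p : ℕ} {a : ℕ → ℤ} (y : ℕ → ℤ) (ha : ∀ i < p, a i < a (i + 1)) :
    a 0 ≤ a p ∧ ∃ f : ℤ → ℤ, (∑ x ∈ Finset.Ico (a 0) (a p), f x
        = ∑ i ∈ Finset.range p, y i * (a (i + 1) - a i)) ∧
      ∀ x ∈ Finset.Ico (a 0) (a p), ∃ i < p, a i ≤ x ∧ x < a (i + 1) ∧ f x = y i := by
  induction p with
  | zero => exact ⟨le_rfl, 0, by simp, by simp⟩
  | succ p ih =>
    obtain ⟨h0, f, hf, hf'⟩ := ih (fun i hi => ha i (by omega))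
    have hp := ha p (by omega)
    refine ⟨by omega, fun x => if x < a p then f x else y p, ?_, ?_⟩
    · rw [Finset.sum_range_succ, ← hf, ← Finset.Ico_union_Ico_eq_Ico h0 hp.le,
        Finset.sum_union (Finset.Ico_disjoint_Ico_consecutive _ _ _)]
      congr 1
      · refine Finset.sum_congr rfl fun x hx => ?_
        rw [Finset.mem_Ico] at hx
        rw [if_pos hx.2]
      · rw [Finset.sum_congr rfl (g := fun _ => y p)]
        · simp only [Finset.sum_const, Int.card_Ico, nsmul_eq_mul]
          rw [Int.toNat_of_nonneg (by omega)]
          ring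
        · intro x hx
          rw [Finset.mem_Ico] at hx
          rw [if_neg (by omega)]
    · intro x hx
      rw [Finset.mem_Ico] at hx
      by_cases h : x < a p
      · obtain ⟨i, hi, h1, h2, h3⟩ := hf' x (by rw [Finset.mem_Ico]; omega)
        exact ⟨i, by omega, h1, h2, by simp [h, h3]⟩
      · exact ⟨p, by omega, by omega, by omega, by simp [h]⟩

/-- The region between a lower and an upper chain has positive area. -/
theorem lower_area_lt_upper_area {p q : ℕ} {a b y z : ℕ → ℤ} (hp : 0 < p)
    (ha : ∀ i < p, a i < a (i + 1)) (hb : ∀ j < q, b j < b (j + 1)) (h0 : a 0 = b 0)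
    (h1 : a p = b q)
    (hyz : ∀ i < p, ∀ j < q, a i ≤ b (j + 1) → b j ≤ a (i + 1) → y i < z j) :
    ∑ i ∈ Finset.range p, y i * (a (i + 1) - a i)
      < ∑ j ∈ Finset.range q, z j * (b (j + 1) - b j) := by
  obtain ⟨_, f, hf, hf'⟩ := exists_stepFunction y ha
  obtain ⟨_, g, hg, hg'⟩ := exists_stepFunction z hb
  rw [← h0, ← h1] at hg hg'
  rw [← hf, ← hg]
  have : a 0 < a p := by
    have := (exists_stepFunction y (p := p - 1) (fun i hi => ha i (by omega))).1
    have := ha (p - 1) (by omega)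
    rw [Nat.sub_add_cancel hp] at this
    omega
  apply Finset.sum_lt_sum_of_nonempty
  · simpa using this
  · intro x hx
    obtain ⟨i, hi, h3, h4, h5⟩ := hf' x hx
    obtain ⟨j, hj, h6, h7, h8⟩ := hg' x hx
    rw [h5, h8]
    exact hyz i hi j hj (by omega) (by omega)

/-! ### Walking along a polygon -/

/-- The cyclic index `r + k`. -/
def cycIdx {n : ℕ} (hn : 0 < n) (r k : ℕ) : Fin n := ⟨(r + k) % n, Nat.mod_lt _ hn⟩

theorem finRotate_cycIdx {n : ℕ} (hn : 0 < n) (r k : ℕ) :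
    finRotate n (cycIdx hn r k) = cycIdx hn r (k + 1) := by
  obtain ⟨n, rfl⟩ : ∃ m, n = m + 1 := ⟨n - 1, by omega⟩
  ext
  rw [finRotate_apply, Fin.val_add, Fin.val_one']
  exact (Nat.add_mod (r + k) 1 (n + 1)).symm

theorem cycIdx_add_self {n : ℕ} (hn : 0 < n) (r k : ℕ) :
    cycIdx hn r (k + n) = cycIdx hn r k := by
  ext
  simp [cycIdx, ← Nat.add_assoc]

theorem exists_cycIdx {n : ℕ} (hn : 0 < n) (r : ℕ) (i : Fin n) :
    ∃ k < n, i = cycIdx hn r k := by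
  refine ⟨(i + (n - r % n)) % n, Nat.mod_lt _ hn, ?_⟩
  ext
  have h1 := Nat.mod_lt r hn
  have h2 := Nat.div_add_mod r n
  simp only [cycIdx, Nat.add_mod_mod]
  have : r + (i + (n - r % n)) = i + n * (r / n + 1) := by
    rw [Nat.mul_add]; omega
  rw [this, Nat.add_mul_mod_self_left, Nat.mod_eq_of_lt i.2]

theorem exists_cycIdx_succ {n : ℕ} (hn : 0 < n) (r : ℕ) (i : Fin n) :
    ∃ k < n, i = cycIdx hn r (k + 1) := by
  obtain ⟨k, hk, h⟩ := exists_cycIdx hn (r + 1) i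
  exact ⟨k, hk, by rw [h]; ext; simp only [cycIdx]; congr 1; omega⟩

theorem cycIdx_inj {n : ℕ} (hn : 0 < n) (r : ℕ) {k l : ℕ} (hk : k < n) (hl : l < n)
    (h : cycIdx hn r k = cycIdx hn r l) : k = l := by
  have h : r + k ≡ r + l [MOD n] := by simpa [cycIdx, Nat.ModEq] using h
  exact Nat.ModEq.eq_of_lt_of_lt (Nat.ModEq.add_left_cancel' r h) hk hl

namespace GridPolygon

variable {n : ℕ}

/-- The vertices of a polygon along the walk that starts at vertex `r`. -/
def walk (P : GridPolygon n) (hn : 0 < n) (r k : ℕ) : ℤ × ℤ := P (cycIdx hn r k)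

theorem walk_add_self (P : GridPolygon n) (hn : 0 < n) (r k : ℕ) :
    P.walk hn r (k + n) = P.walk hn r k := by
  rw [walk, cycIdx_add_self, walk]

theorem edgeVec_cycIdx (P : GridPolygon n) (hn : 0 < n) (r k : ℕ) :
    P.edgeVec (cycIdx hn r k) = P.walk hn r (k + 1) - P.walk hn r k := by
  rw [edgeVec, finRotate_cycIdx]; rfl

theorem doubleSignedArea_eq_sum_walk (P : GridPolygon n) (hn : 0 < n) (r : ℕ) :
    P.doubleSignedArea
      = ∑ k ∈ Finset.range n, cross (P.walk hn r k) (P.walk hn r (k + 1)) := by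
  have h : Function.Bijective (fun k : Fin n => cycIdx hn r k) := by
    rw [Fintype.bijective_iff_surjective_and_card]
    refine ⟨fun i => ?_, rfl⟩
    obtain ⟨k, hk, h⟩ := exists_cycIdx hn r i
    exact ⟨⟨k, hk⟩, h.symm⟩
  rw [doubleSignedArea, ← (Equiv.ofBijective _ h).sum_comp, Finset.sum_range]
  refine Finset.sum_congr rfl fun k _ => ?_
  simp only [Equiv.ofBijective_apply, finRotate_cycIdx]
  rfl

/-- Membership in an axis-parallel box spanned by two grid points. -/
def InBox (z : ℝ × ℝ) (u v : ℤ × ℤ) : Prop :=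
  z.1 ∈ Set.uIcc (u.1 : ℝ) v.1 ∧ z.2 ∈ Set.uIcc (u.2 : ℝ) v.2

theorem mem_affineSegment_iff_inBox (z : ℝ × ℝ) (u v : ℤ × ℤ) (h : u.1 = v.1 ∨ u.2 = v.2) :
    z ∈ affineSegment ℝ ((u.1 : ℝ), (u.2 : ℝ)) ((v.1 : ℝ), (v.2 : ℝ)) ↔ InBox z u v := by
  rw [affineSegment_eq_segment]
  rcases h with h | h
  · rw [h, ← Prod.image_mk_segment_right, segment_eq_uIcc]
    simp only [Set.mem_image, InBox, h, Set.uIcc_self, Set.mem_singleton_iff, Prod.ext_iff]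
    grind
  · rw [h, ← Prod.image_mk_segment_left, segment_eq_uIcc]
    simp only [Set.mem_image, InBox, h, Set.uIcc_self, Set.mem_singleton_iff, Prod.ext_iff]
    grind

theorem mem_edgeSet_cycIdx (P : GridPolygon n) (hn : 0 < n) (r k : ℕ) (z : ℝ × ℝ)
    (h : (P.walk hn r k).1 = (P.walk hn r (k + 1)).1 ∨
      (P.walk hn r k).2 = (P.walk hn r (k + 1)).2) :
    z ∈ P.toReal.edgeSet ℝ (cycIdx hn r k) ↔ InBox z (P.walk hn r k) (P.walk hn r (k + 1)) := by
  rw [← mem_affineSegment_iff_inBox z _ _ h, Polygon.edgeSet, finRotate_cycIdx]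
  rfl

end GridPolygon

/-! ### Frames -/

/-- The vertices of a walk that starts with a vertical edge and alternates between vertical edges
(at `ξ 0, ξ 1, …`) and horizontal edges (at heights `ζ 1, ζ 2, …`). -/
def frameVertex (ξ ζ : ℕ → ℤ) (k : ℕ) : ℤ × ℤ := (ξ (k / 2), ζ ((k + 1) / 2))

/-- The coordinates of a closed walk that goes to the right along `p` horizontal edges and then
to the left along `N - p` horizontal edges. -/
structure Frame (N p : ℕ) (ξ ζ : ℕ → ℤ) : Prop where
  p_pos : 0 < p
  p_lt : p < N
  inc : ∀ t < p, ξ t < ξ (t + 1)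
  dec : ∀ t, p ≤ t → t < N → ξ (t + 1) < ξ t
  ξ_per : ξ N = ξ 0
  ζ_per : ζ N = ζ 0
  ζ_per' : ζ (N + 1) = ζ 1

/-- Wherever a lower and an upper edge touch the same vertical line, the lower edge is below the
upper edge. -/
def Separated (N p : ℕ) (ξ ζ : ℕ → ℤ) : Prop :=
  ∀ i < p, ∀ t, p ≤ t → t < N → ξ i ≤ ξ t → ξ (t + 1) ≤ ξ (i + 1) → ζ (i + 1) < ζ (t + 1)

/-- Consecutive horizontal edges of the same chain have different heights. -/
def Jagged (N p : ℕ) (ζ : ℕ → ℤ) : Prop := ∀ t, 0 < t → t < N → t ≠ p → ζ t ≠ ζ (t + 1)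

/-- Brings the upper chain into left-to-right order, the order in which the two chains are compared.
-/
theorem sum_range_split_reverse {M : Type*} [AddCommMonoid M] (g : ℕ → M) {N p : ℕ} (h : p ≤ N) :
    ∑ t ∈ Finset.range N, g t
      = ∑ t ∈ Finset.range p, g t + ∑ j ∈ Finset.range (N - p), g (N - 1 - j) := by
  obtain ⟨q, rfl⟩ := Nat.exists_eq_add_of_le h
  rw [Finset.sum_range_add, Nat.add_sub_cancel_left,
    ← Finset.sum_range_reflect (fun j => g (p + j)) q]
  congr 1
  refine Finset.sum_congr rfl fun j hj => ?_
  rw [Finset.mem_range] at hj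
  rw [show p + (q - 1 - j) = p + q - 1 - j by omega]

/-- Up to the first `2 * m` edges, the shoelace sum differs from the weighted sum over horizontal
edges only by the boundary terms `ξ m * ζ m - ξ 0 * ζ 0`, which cancel when the walk closes. -/
theorem sum_cross_frameVertex {N : ℕ} {ξ ζ : ℕ → ℤ} (hξ : ξ N = ξ 0) (hζ : ζ N = ζ 0) :
    ∑ k ∈ Finset.range (2 * N), GridPolygon.cross (frameVertex ξ ζ k) (frameVertex ξ ζ (k + 1))
      = -2 * ∑ t ∈ Finset.range N, ζ (t + 1) * (ξ (t + 1) - ξ t) := by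
  have key : ∀ m, ∑ k ∈ Finset.range (2 * m),
      GridPolygon.cross (frameVertex ξ ζ k) (frameVertex ξ ζ (k + 1))
      = -2 * ∑ t ∈ Finset.range m, ζ (t + 1) * (ξ (t + 1) - ξ t) + ξ m * ζ m - ξ 0 * ζ 0 := by
    intro m
    induction m with
    | zero => simp
    | succ m ih =>
      rw [Nat.mul_add, Finset.sum_range_succ, Finset.sum_range_succ, ih, Finset.sum_range_succ]
      simp only [frameVertex, GridPolygon.cross]
      rw [show 2 * m / 2 = m by omega, show (2 * m + 1) / 2 = m by omega,
        show (2 * m + 1 + 1) / 2 = m + 1 by omega, show (2 * m + 1 + 1 + 1) / 2 = m + 1 by omega]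
      ring
  rw [key, hξ, hζ]
  ring

namespace Frame

variable {N p : ℕ} {ξ ζ : ℕ → ℤ}

theorem lt_of_lt_of_le (F : Frame N p ξ ζ) : ∀ {s t}, s < t → t ≤ p → ξ s < ξ t := by
  intro s t hst
  induction t with
  | zero => omega
  | succ t ih =>
    intro ht
    have := F.inc t (by omega)
    rcases Nat.lt_add_one_iff_lt_or_eq.1 hst with h | rfl
    · have := ih h (by omega); omega
    · exact this

theorem lt_of_le_of_lt (F : Frame N p ξ ζ) :
    ∀ {s t}, s < t → p ≤ s → t ≤ N → ξ t < ξ s := by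
  intro s t hst
  induction t with
  | zero => omega
  | succ t ih =>
    intro hs ht
    have := F.dec t (by omega) (by omega)
    rcases Nat.lt_add_one_iff_lt_or_eq.1 hst with h | rfl
    · have := ih h hs (by omega); omega
    · exact this

/-- A separated frame is a counterclockwise walk. -/
theorem sum_cross_pos (F : Frame N p ξ ζ) (hs : Separated N p ξ ζ) :
    0 < ∑ k ∈ Finset.range (2 * N),
      GridPolygon.cross (frameVertex ξ ζ k) (frameVertex ξ ζ (k + 1)) := by
  have hp := F.p_lt
  -- From left to right, the `j`-th upper edge starts at `ξ (N - j)` and has height `ζ (N - j)`.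
  have key := lower_area_lt_upper_area (p := p) (q := N - p) (a := ξ) (b := fun j => ξ (N - j))
    (y := fun i => ζ (i + 1)) (z := fun j => ζ (N - j)) F.p_pos F.inc ?_ ?_ ?_ ?_
  · rw [sum_cross_frameVertex F.ξ_per F.ζ_per, sum_range_split_reverse _ F.p_lt.le]
    have : ∑ j ∈ Finset.range (N - p), ζ (N - 1 - j + 1) * (ξ (N - 1 - j + 1) - ξ (N - 1 - j))
        = - ∑ j ∈ Finset.range (N - p), ζ (N - j) * (ξ (N - (j + 1)) - ξ (N - j)) := by
      rw [← Finset.sum_neg_distrib]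
      refine Finset.sum_congr rfl fun j hj => ?_
      rw [Finset.mem_range] at hj
      rw [show N - 1 - j + 1 = N - j by omega, show N - 1 - j = N - (j + 1) by omega]
      ring
    rw [this]
    linarith
  · intro j hj
    have := F.dec (N - (j + 1)) (by omega) (by omega)
    rwa [show N - (j + 1) + 1 = N - j by omega] at this
  · simp [F.ξ_per]
  · simp [Nat.sub_sub_self hp.le]
  · intro i hi j hj h1 h2
    have := hs i hi (N - (j + 1)) (by omega) (by omega) h1
    rw [show N - (j + 1) + 1 = N - j by omega] at this
    exact this h2

open GridPolygon (InBox)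

theorem inBox_frameVertex {ξ ζ : ℕ → ℤ} {k : ℕ} {z : ℝ × ℝ} :
    InBox z (frameVertex ξ ζ k) (frameVertex ξ ζ (k + 1)) ↔
      z.1 ∈ Set.uIcc (ξ (k / 2) : ℝ) (ξ ((k + 1) / 2)) ∧
      z.2 ∈ Set.uIcc (ζ ((k + 1) / 2) : ℝ) (ζ (k / 2 + 1)) := by
  rw [InBox, frameVertex, frameVertex, show (k + 1 + 1) / 2 = k / 2 + 1 by omega]

/-- The abscissas increase along the chain, so two non-adjacent edges have disjoint horizontal
extents, except for two consecutive horizontal edges: these meet the same vertical edge, and differ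
in height by `Jagged`. Both extreme vertical edges, `0` and `2 * p`, are included. -/
theorem disjoint_lower (F : Frame N p ξ ζ) (hj : Jagged N p ζ) {k l : ℕ} {z : ℝ × ℝ}
    (hkl : k + 2 ≤ l) (hl : l ≤ 2 * p) (hz : InBox z (frameVertex ξ ζ k) (frameVertex ξ ζ (k + 1)))
    (hz' : InBox z (frameVertex ξ ζ l) (frameVertex ξ ζ (l + 1))) : False := by
  have hp := F.p_lt
  rw [inBox_frameVertex] at hz hz'
  have mono : ∀ s t, s ≤ t → t ≤ p → (ξ s : ℝ) ≤ ξ t := by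
    intro s t hst ht
    rcases hst.lt_or_eq with h | rfl
    · exact_mod_cast (F.lt_of_lt_of_le h ht).le
    · exact le_rfl
  by_cases h : (k + 1) / 2 < l / 2
  · have h1 : (ξ ((k + 1) / 2) : ℝ) < ξ (l / 2) := by
      exact_mod_cast F.lt_of_lt_of_le h (by omega)
    have h2 := mono (k / 2) ((k + 1) / 2) (by omega) (by omega)
    by_cases hl' : (l + 1) / 2 ≤ p
    · have h3 := mono (l / 2) ((l + 1) / 2) (by omega) hl'
      rw [Set.uIcc_of_le h2] at hz
      rw [Set.uIcc_of_le h3] at hz'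
      have := hz.1.2; have := hz'.1.1
      linarith
    · omega
  · obtain ⟨t, rfl⟩ : ∃ t, k = 2 * t + 1 := ⟨k / 2, by omega⟩
    obtain rfl : l = 2 * t + 3 := by omega
    have h1 := hz.2
    have h2 := hz'.2
    rw [show (2 * t + 1 + 1) / 2 = t + 1 by omega, show (2 * t + 1) / 2 = t by omega,
      Set.uIcc_self, Set.mem_singleton_iff] at h1
    rw [show (2 * t + 3 + 1) / 2 = t + 2 by omega, show (2 * t + 3) / 2 = t + 1 by omega,
      Set.uIcc_self, Set.mem_singleton_iff, h1] at h2
    exact hj (t + 1) (by omega) (by omega) (by omega) (by exact_mod_cast h2)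

/-- The mirror image of the lower chain. Index `2 * N` is admitted because it is a second copy of
edge `0`, so the left vertical edge can also be treated as the end of the upper chain. -/
theorem disjoint_upper (F : Frame N p ξ ζ) (hj : Jagged N p ζ) {k l : ℕ} {z : ℝ × ℝ}
    (hkl : k + 2 ≤ l) (hk : 2 * p ≤ k) (hl : l ≤ 2 * N)
    (hz : InBox z (frameVertex ξ ζ k) (frameVertex ξ ζ (k + 1)))
    (hz' : InBox z (frameVertex ξ ζ l) (frameVertex ξ ζ (l + 1))) : False := by
  have hp := F.p_lt
  rw [inBox_frameVertex] at hz hz'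
  have mono : ∀ s t, s ≤ t → p ≤ s → t ≤ N → (ξ t : ℝ) ≤ ξ s := by
    intro s t hst hs ht
    rcases hst.lt_or_eq with h | rfl
    · exact_mod_cast (F.lt_of_le_of_lt h hs ht).le
    · exact le_rfl
  by_cases h : (k + 1) / 2 < l / 2
  · have h1 : (ξ (l / 2) : ℝ) < ξ ((k + 1) / 2) := by
      exact_mod_cast F.lt_of_le_of_lt h (by omega) (by omega)
    have h2 := mono (k / 2) ((k + 1) / 2) (by omega) (by omega) (by omega)
    have h3 := mono (l / 2) ((l + 1) / 2) (by omega) (by omega) (by omega)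
    rw [Set.uIcc_of_ge h2] at hz
    rw [Set.uIcc_of_ge h3] at hz'
    have := hz.1.1; have := hz'.1.2
    linarith
  · obtain ⟨t, rfl⟩ : ∃ t, k = 2 * t + 1 := ⟨k / 2, by omega⟩
    obtain rfl : l = 2 * t + 3 := by omega
    have h1 := hz.2
    have h2 := hz'.2
    rw [show (2 * t + 1 + 1) / 2 = t + 1 by omega, show (2 * t + 1) / 2 = t by omega,
      Set.uIcc_self, Set.mem_singleton_iff] at h1
    rw [show (2 * t + 3 + 1) / 2 = t + 2 by omega, show (2 * t + 3) / 2 = t + 1 by omega,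
      Set.uIcc_self, Set.mem_singleton_iff, h1] at h2
    exact hj (t + 1) (by omega) (by omega) (by omega) (by exact_mod_cast h2)

/-- Each point of a lower edge is at most as high as some lower horizontal edge over the same
abscissa; for a vertical edge, take its upper end. Dually for upper edges. A common point would thus
violate `Separated`. -/
theorem disjoint_lower_upper (F : Frame N p ξ ζ) (hs : Separated N p ξ ζ) {k l : ℕ} {z : ℝ × ℝ}
    (hk : 0 < k) (hk' : k < 2 * p) (hl : 2 * p < l) (hl' : l < 2 * N)
    (hz : InBox z (frameVertex ξ ζ k) (frameVertex ξ ζ (k + 1)))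
    (hz' : InBox z (frameVertex ξ ζ l) (frameVertex ξ ζ (l + 1))) : False := by
  have hp := F.p_lt
  rw [inBox_frameVertex] at hz hz'
  have inc : ∀ t < p, (ξ t : ℝ) ≤ ξ (t + 1) := fun t ht => by exact_mod_cast (F.inc t ht).le
  have dec : ∀ t, p ≤ t → t < N → (ξ (t + 1) : ℝ) ≤ ξ t :=
    fun t h1 h2 => by exact_mod_cast (F.dec t h1 h2).le
  have h1 : ∃ i < p, (ξ i : ℝ) ≤ z.1 ∧ z.1 ≤ ξ (i + 1) ∧ z.2 ≤ ζ (i + 1) := by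
    obtain ⟨t, rfl | rfl⟩ : ∃ t, k = 2 * t + 1 ∨ k = 2 * t + 2 := ⟨(k - 1) / 2, by omega⟩
    · rw [show (2 * t + 1 + 1) / 2 = t + 1 by omega, show (2 * t + 1) / 2 = t by omega,
        Set.uIcc_self, Set.mem_singleton_iff, Set.uIcc_of_le (inc t (by omega))] at hz
      exact ⟨t, by omega, hz.1.1, hz.1.2, hz.2.le⟩
    · rw [show (2 * t + 2 + 1) / 2 = t + 1 by omega, show (2 * t + 2) / 2 = t + 1 by omega,
        Set.uIcc_self, Set.mem_singleton_iff, Set.mem_uIcc] at hz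
      have := inc t (by omega)
      have := inc (t + 1) (by omega)
      rcases hz.2 with h | h
      · exact ⟨t + 1, by omega, hz.1.ge, hz.1.le.trans (by assumption), h.2⟩
      · exact ⟨t, by omega, by rw [hz.1]; assumption, hz.1.le, h.2⟩
  have h2 : ∃ t, p ≤ t ∧ t < N ∧ (ξ (t + 1) : ℝ) ≤ z.1 ∧ z.1 ≤ ξ t ∧ ζ (t + 1) ≤ z.2 := by
    obtain ⟨t, rfl | rfl⟩ : ∃ t, l = 2 * t + 1 ∨ l = 2 * t + 2 := ⟨(l - 1) / 2, by omega⟩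
    · rw [show (2 * t + 1 + 1) / 2 = t + 1 by omega, show (2 * t + 1) / 2 = t by omega,
        Set.uIcc_self, Set.mem_singleton_iff, Set.uIcc_of_ge (dec t (by omega) (by omega))] at hz'
      exact ⟨t, by omega, by omega, hz'.1.1, hz'.1.2, hz'.2.ge⟩
    · rw [show (2 * t + 2 + 1) / 2 = t + 1 by omega, show (2 * t + 2) / 2 = t + 1 by omega,
        Set.uIcc_self, Set.mem_singleton_iff, Set.mem_uIcc] at hz'
      have := dec t (by omega) (by omega)
      have := dec (t + 1) (by omega) (by omega)
      rcases hz'.2 with h | h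
      · exact ⟨t, by omega, by omega, hz'.1.ge, by rw [hz'.1]; assumption, h.1⟩
      · exact ⟨t + 1, by omega, by omega, by rw [hz'.1]; assumption, hz'.1.le, h.1⟩
  obtain ⟨i, hi, h3, h4, h5⟩ := h1
  obtain ⟨t, ht, ht', h6, h7, h8⟩ := h2
  have : ζ (i + 1) < ζ (t + 1) :=
    hs i hi t ht ht' (by exact_mod_cast h3.trans h7) (by exact_mod_cast h6.trans h4)
  have : (ζ (i + 1) : ℝ) < ζ (t + 1) := by exact_mod_cast this
  linarith

end Frame

/-! ### Frames realize their angle sequence -/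

/-- Cut into pairs, the sequence `T` of turns starts with two left turns, and so does its part from
the `p`-th pair on; all other pairs consist of a left turn and a right turn. -/
structure Pattern (N p : ℕ) (T : ℕ → Turn) : Prop where
  p_pos : 0 < p
  p_lt : p < N
  zero : T 0 = Turn.left
  one : T 1 = Turn.left
  two_p : T (2 * p) = Turn.left
  two_p_succ : T (2 * p + 1) = Turn.left
  mixed : ∀ t, 0 < t → t < N → t ≠ p → T (2 * t) ≠ T (2 * t + 1)

/-- The vertical edges of both chains go up and down as the turns `T` demand. -/
structure Steps (N p : ℕ) (T : ℕ → Turn) (ζ : ℕ → ℤ) : Prop where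
  lower_left : ∀ t, 0 < t → t < p → T (2 * t) = Turn.left → ζ t < ζ (t + 1)
  lower_right : ∀ t, 0 < t → t < p → T (2 * t) = Turn.right → ζ (t + 1) < ζ t
  upper_left : ∀ t, p < t → t < N → T (2 * t) = Turn.left → ζ (t + 1) < ζ t
  upper_right : ∀ t, p < t → t < N → T (2 * t) = Turn.right → ζ t < ζ (t + 1)

theorem Turn.eq_left_or_right (s : Turn) : s = Turn.left ∨ s = Turn.right := by
  cases s <;> simp

theorem Steps.jagged {N p : ℕ} {T : ℕ → Turn} {ζ : ℕ → ℤ} (h : Steps N p T ζ) :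
    Jagged N p ζ := by
  intro t h1 h2 h3
  rcases Nat.lt_or_gt_of_ne h3 with h4 | h4 <;> rcases (T (2 * t)).eq_left_or_right with h5 | h5
  · exact (h.lower_left t h1 h4 h5).ne
  · exact (h.lower_right t h1 h4 h5).ne'
  · exact (h.upper_left t h4 h2 h5).ne'
  · exact (h.upper_right t h4 h2 h5).ne

namespace GridPolygon

variable {n : ℕ}

theorem hasTurn_iff (P : GridPolygon n) (i : Fin n) (s : Turn) :
    P.HasTurn i s ↔
      (s = Turn.left → 0 < cross (P.edgeVec ((finRotate n).symm i)) (P.edgeVec i)) ∧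
      (s = Turn.right → cross (P.edgeVec ((finRotate n).symm i)) (P.edgeVec i) < 0) := by
  cases s <;> simp [HasTurn]

/-- Two indices past `n - 1` are needed: the last edge ends at index `n`, and the turn there
involves vertex `n + 1`. -/
theorem walk_eq_frameVertex {N p : ℕ} {ξ ζ : ℕ → ℤ} (P : GridPolygon n) (hn : 0 < n)
    (hN : n = 2 * N) (r : ℕ) (F : Frame N p ξ ζ)
    (h : ∀ k < n, P.walk hn r k = frameVertex ξ ζ k) :
    ∀ k ≤ n + 1, P.walk hn r k = frameVertex ξ ζ k := by
  intro k hk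
  rcases lt_or_ge k n with h1 | h1
  · exact h k h1
  · obtain ⟨l, rfl⟩ := Nat.exists_eq_add_of_le' h1
    rw [walk_add_self, h l (by omega)]
    obtain rfl | rfl : l = 0 ∨ l = 1 := by omega
    · simp only [frameVertex]
      rw [show (0 + n) / 2 = N by omega, show (0 + n + 1) / 2 = N by omega, F.ξ_per, F.ζ_per]
    · simp only [frameVertex]
      rw [show (1 + n) / 2 = N by omega, show (1 + n + 1) / 2 = N + 1 by omega, F.ξ_per,
        F.ζ_per']

/-- Two non-adjacent edges lie both in the lower chain, both in the upper chain, or one in each,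
with edge `0` assigned to whichever chain the other edge belongs to. The area between the chains
gives the orientation. Each turn is the sign of a product of one horizontal and one vertical step,
both of known sign. -/
theorem realizes_of_frame {N p : ℕ} {ξ ζ : ℕ → ℤ} (P : GridPolygon n) (S : AngleSequence n)
    (hn : 0 < n) (hN : n = 2 * N) (r : ℕ) (F : Frame N p ξ ζ) (hs : Separated N p ξ ζ)
    (hT : Pattern N p (fun k => S (cycIdx hn r k))) (hS : Steps N p (fun k => S (cycIdx hn r k)) ζ)
    (hP : ∀ k < n, P.walk hn r k = frameVertex ξ ζ k) : P.Realizes S := by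
  have hp := F.p_lt
  have hp0 := F.p_pos
  replace hP := P.walk_eq_frameVertex hn hN r F hP
  have hrect : ∀ k, (frameVertex ξ ζ k).1 = (frameVertex ξ ζ (k + 1)).1 ∨
      (frameVertex ξ ζ k).2 = (frameVertex ξ ζ (k + 1)).2 := by
    intro k
    simp only [frameVertex]
    rcases Nat.even_or_odd' k with ⟨t, rfl | rfl⟩
    · left; congr 1; omega
    · right; congr 1; omega
  have hedge : ∀ k ≤ n, ∀ z, z ∈ P.toReal.edgeSet ℝ (cycIdx hn r k) ↔
      InBox z (frameVertex ξ ζ k) (frameVertex ξ ζ (k + 1)) := by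
    intro k hk z
    rw [mem_edgeSet_cycIdx, hP k (by omega), hP (k + 1) (by omega)]
    rw [hP k (by omega), hP (k + 1) (by omega)]
    exact hrect k
  have hζp : ζ p < ζ (p + 1) := by
    have h1 := hs (p - 1) (by omega) p le_rfl hp
    have h2 := F.inc (p - 1) (by omega)
    have h3 := F.dec p le_rfl hp
    rw [Nat.sub_add_cancel hp0] at h1 h2
    exact h1 h2.le h3.le
  have hζN : ζ 1 < ζ N := by
    have h1 := hs 0 hp0 (N - 1) (by omega) (by omega)
    have h2 := F.inc 0 hp0
    have h3 := F.dec (N - 1) (by omega) (by omega)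
    rw [Nat.sub_add_cancel (by omega), F.ξ_per] at h1 h3
    exact h1 h3.le h2.le
  have hjag := hS.jagged
  have hζne : ∀ t ≤ N, ζ t ≠ ζ (t + 1) := by
    intro t ht
    by_cases h0 : t = 0
    · subst h0; rw [← F.ζ_per]; exact hζN.ne'
    by_cases hN : t = N
    · subst hN; rw [F.ζ_per']; exact hζN.ne'
    by_cases h1 : t = p
    · subst h1; exact hζp.ne
    · exact hjag t (by omega) (by omega) h1
  have hξne : ∀ t < N, ξ t ≠ ξ (t + 1) := by
    intro t ht
    by_cases h1 : t < p
    · exact (F.inc t h1).ne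
    · exact (F.dec t (by omega) ht).ne'
  have hdisj : ∀ k l z, k < l → l < n → l ≠ k + 1 → ¬ (k = 0 ∧ l + 1 = n) →
      InBox z (frameVertex ξ ζ k) (frameVertex ξ ζ (k + 1)) →
      InBox z (frameVertex ξ ζ l) (frameVertex ξ ζ (l + 1)) → False := by
    intro k l z hkl hl h1 h2 hz hz'
    by_cases h3 : l ≤ 2 * p
    · exact F.disjoint_lower hjag (by omega) h3 hz hz'
    by_cases h4 : 2 * p ≤ k
    · exact F.disjoint_upper hjag (by omega) h4 (by omega) hz hz'
    by_cases h5 : k = 0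
    · subst h5
      have hV0 : frameVertex ξ ζ 0 = frameVertex ξ ζ (2 * N) := by
        simp only [frameVertex]
        rw [show 2 * N / 2 = N by omega, show (2 * N + 1) / 2 = N by omega, F.ξ_per, F.ζ_per]
      have hV1 : frameVertex ξ ζ (0 + 1) = frameVertex ξ ζ (2 * N + 1) := by
        simp only [frameVertex]
        rw [show (2 * N + 1) / 2 = N by omega, show (2 * N + 1 + 1) / 2 = N + 1 by omega, F.ξ_per,
          F.ζ_per']
      rw [hV0, hV1] at hz
      exact F.disjoint_upper hjag (k := l) (l := 2 * N) (by omega) (by omega) le_rfl hz' hz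
    · exact F.disjoint_lower_upper hs (by omega) (by omega) (by omega) (by omega) hz hz'
  refine ⟨?_, ⟨?_, ?_, ?_⟩, ?_, ?_⟩
  · intro i
    obtain ⟨k, hk, rfl⟩ := exists_cycIdx hn r i
    rw [edgeVec_cycIdx, hP k (by omega), hP (k + 1) (by omega)]
    rcases hrect k with h | h
    · left; rw [Prod.fst_sub, h, sub_self]
    · right; rw [Prod.snd_sub, h, sub_self]
  · intro i
    obtain ⟨k, hk, rfl⟩ := exists_cycIdx hn r i
    rw [finRotate_cycIdx]
    change P.walk hn r k ≠ P.walk hn r (k + 1)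
    rw [hP k (by omega), hP (k + 1) (by omega)]
    simp only [frameVertex, ne_eq, Prod.mk.injEq, not_and_or]
    rcases Nat.even_or_odd' k with ⟨t, rfl | rfl⟩
    · right
      rw [show (2 * t + 1) / 2 = t by omega, show (2 * t + 1 + 1) / 2 = t + 1 by omega]
      exact hζne t (by omega)
    · left
      rw [show (2 * t + 1) / 2 = t by omega, show (2 * t + 1 + 1) / 2 = t + 1 by omega]
      exact hξne t (by omega)
  · intro i
    obtain ⟨k, hk, rfl⟩ := exists_cycIdx hn r i
    ext z
    have hv : P.toReal (cycIdx hn r (k + 1))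
        = (((frameVertex ξ ζ (k + 1)).1 : ℝ), ((frameVertex ξ ζ (k + 1)).2 : ℝ)) := by
      rw [← hP (k + 1) (by omega)]; rfl
    rw [finRotate_cycIdx, Set.mem_inter_iff, hedge k (by omega), hedge (k + 1) (by omega),
      Set.mem_singleton_iff, hv, Frame.inBox_frameVertex, Frame.inBox_frameVertex, Prod.ext_iff]
    simp only [frameVertex]
    rcases Nat.even_or_odd' k with ⟨t, rfl | rfl⟩
    · rw [show (2 * t + 1) / 2 = t by omega, show (2 * t + 1 + 1) / 2 = t + 1 by omega,
        show 2 * t / 2 = t by omega]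
      simp only [Set.uIcc_self, Set.mem_singleton_iff]
      exact ⟨fun h => ⟨h.1.1, h.2.2⟩, fun h => by rw [h.1, h.2]; simp⟩
    · rw [show (2 * t + 1) / 2 = t by omega, show (2 * t + 1 + 1) / 2 = t + 1 by omega,
        show (2 * t + 1 + 1 + 1) / 2 = t + 1 by omega]
      simp only [Set.uIcc_self, Set.mem_singleton_iff]
      exact ⟨fun h => ⟨h.2.1, h.1.2⟩, fun h => by rw [h.1, h.2]; simp⟩
  · intro i j hij h1 h2
    obtain ⟨k, hk, rfl⟩ := exists_cycIdx hn r i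
    obtain ⟨l, hl, rfl⟩ := exists_cycIdx hn r j
    rw [finRotate_cycIdx] at h1 h2
    have hne : k ≠ l := fun h => hij (by rw [h])
    have h1' : l ≠ k + 1 := fun h => h1 (by rw [h])
    have h2' : k ≠ l + 1 := fun h => h2 (by rw [h])
    have h3 : ¬ (k = 0 ∧ l + 1 = n) := by
      rintro ⟨rfl, h⟩
      exact h2 (by rw [h]; exact (by simpa using (cycIdx_add_self hn r 0).symm))
    have h4 : ¬ (l = 0 ∧ k + 1 = n) := by
      rintro ⟨rfl, h⟩
      exact h1 (by rw [h]; exact (by simpa using (cycIdx_add_self hn r 0).symm))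
    rw [Set.disjoint_left]
    intro z hz hz'
    rw [hedge k hk.le] at hz
    rw [hedge l hl.le] at hz'
    rcases Nat.lt_or_gt_of_ne hne with h | h
    · exact hdisj k l z h hl h1' h3 hz hz'
    · exact hdisj l k z h hk h2' h4 hz' hz
  · rw [IsCounterclockwise, doubleSignedArea_eq_sum_walk P hn r]
    have := F.sum_cross_pos hs
    rw [← hN] at this
    refine this.trans_eq (Finset.sum_congr rfl fun k hk => ?_)
    rw [Finset.mem_range] at hk
    rw [hP k (by omega), hP (k + 1) (by omega)]
  · intro i
    obtain ⟨k, hk, rfl⟩ := exists_cycIdx_succ hn r i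
    rw [hasTurn_iff, ← finRotate_cycIdx, Equiv.symm_apply_apply, finRotate_cycIdx,
      edgeVec_cycIdx, hP k (by omega), hP (k + 1) (by omega), edgeVec_cycIdx, hP (k + 1) (by omega)]
    have hVk : P.walk hn r (k + 1 + 1) = frameVertex ξ ζ (k + 1 + 1) := hP _ (by omega)
    rw [hVk]
    set T : ℕ → Turn := fun k => S (cycIdx hn r k) with hTdef
    change (T (k + 1) = _ → _) ∧ (T (k + 1) = _ → _)
    have hTn : T n = T 0 := by
      simp only [hTdef]
      rw [← cycIdx_add_self hn r 0, Nat.zero_add]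
    rcases Nat.even_or_odd' k with ⟨t, rfl | rfl⟩
    · simp only [frameVertex, cross, Prod.fst_sub, Prod.snd_sub]
      rw [show (2 * t + 1) / 2 = t by omega, show (2 * t + 1 + 1) / 2 = t + 1 by omega,
        show 2 * t / 2 = t by omega, show (2 * t + 1 + 1 + 1) / 2 = t + 1 by omega]
      have ht : t < N := by omega
      simp only [sub_self, zero_mul, zero_sub, Left.neg_pos_iff, Left.neg_neg_iff]
      by_cases h0 : t = 0
      · subst h0
        rw [show (2 * 0 + 1) = 1 by rfl, hT.one, ← F.ζ_per]
        have h1 := F.inc 0 hp0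
        exact ⟨fun _ => mul_neg_of_neg_of_pos (sub_neg.2 hζN) (sub_pos.2 h1), by simp⟩
      by_cases h1 : t = p
      · subst h1
        rw [hT.two_p_succ]
        have h1 := F.dec t le_rfl hp
        exact ⟨fun _ => mul_neg_of_pos_of_neg (sub_pos.2 hζp) (sub_neg.2 h1), by simp⟩
      -- `Steps` refers to the turn before a vertical edge, whereas the turn after it is at stake
      -- here; `mixed` says that it is the opposite one.
      have hm := hT.mixed t (by omega) ht h1
      change T (2 * t) ≠ T (2 * t + 1) at hm
      have hmL : T (2 * t + 1) = Turn.left → T (2 * t) = Turn.right := by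
        intro h; rcases (T (2 * t)).eq_left_or_right with h' | h' <;> simp_all
      have hmR : T (2 * t + 1) = Turn.right → T (2 * t) = Turn.left := by
        intro h; rcases (T (2 * t)).eq_left_or_right with h' | h' <;> simp_all
      rcases Nat.lt_or_gt_of_ne h1 with h2 | h2
      · have h3 := F.inc t h2
        exact ⟨fun h => mul_neg_of_neg_of_pos
            (sub_neg.2 (hS.lower_right t (by omega) h2 (hmL h))) (sub_pos.2 h3),
          fun h => mul_pos (sub_pos.2 (hS.lower_left t (by omega) h2 (hmR h))) (sub_pos.2 h3)⟩
      · have h3 := F.dec t h2.le ht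
        exact ⟨fun h => mul_neg_of_pos_of_neg
            (sub_pos.2 (hS.upper_right t h2 ht (hmL h))) (sub_neg.2 h3),
          fun h => mul_pos_of_neg_of_neg
            (sub_neg.2 (hS.upper_left t h2 ht (hmR h))) (sub_neg.2 h3)⟩
    · simp only [frameVertex, cross, Prod.fst_sub, Prod.snd_sub]
      rw [show (2 * t + 1) / 2 = t by omega, show (2 * t + 1 + 1) / 2 = t + 1 by omega,
        show (2 * t + 1 + 1 + 1) / 2 = t + 1 by omega,
        show (2 * t + 1 + 1 + 1 + 1) / 2 = t + 2 by omega]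
      have ht : t < N := by omega
      simp only [sub_self, zero_mul, sub_zero]
      rw [show 2 * t + 1 + 1 = 2 * (t + 1) by omega]
      by_cases h0 : t + 1 = N
      · have h1 := F.dec t (by omega) ht
        rw [show t + 2 = N + 1 by omega, h0, ← hN, hTn, F.ζ_per']
        rw [h0] at h1
        have hT0 : T 0 = Turn.left := hT.zero
        rw [hT0]
        exact ⟨fun _ => mul_pos_of_neg_of_neg (sub_neg.2 h1) (sub_neg.2 hζN), by simp⟩
      by_cases h1 : t + 1 = p
      · have h2 := F.inc t (by omega)
        have hTp : T (2 * p) = Turn.left := hT.two_p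
        rw [show t + 2 = p + 1 by omega, h1, hTp]
        rw [h1] at h2
        exact ⟨fun _ => mul_pos (sub_pos.2 h2) (sub_pos.2 hζp), by simp⟩
      rcases Nat.lt_or_gt_of_ne h1 with h2 | h2
      · have h3 := F.inc t (by omega)
        exact ⟨fun h => mul_pos (sub_pos.2 h3) (sub_pos.2 (hS.lower_left _ (by omega) h2 h)),
          fun h => mul_neg_of_pos_of_neg (sub_pos.2 h3)
            (sub_neg.2 (hS.lower_right _ (by omega) h2 h))⟩
      · have h3 := F.dec t (by omega) ht
        exact ⟨fun h => mul_pos_of_neg_of_neg (sub_neg.2 h3)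
            (sub_neg.2 (hS.upper_left _ h2 (by omega) h)),
          fun h => mul_neg_of_neg_of_pos (sub_neg.2 h3)
            (sub_pos.2 (hS.upper_right _ h2 (by omega) h))⟩

end GridPolygon

/-! ### Polygons with a given pattern of turns come from frames -/

open GridPolygon (cross)

/-- The integer points of an axis-parallel box. -/
def InGridBox (z u v : ℤ × ℤ) : Prop := z.1 ∈ Set.uIcc u.1 v.1 ∧ z.2 ∈ Set.uIcc u.2 v.2

/-- Non-adjacent edges of a closed rectilinear walk of length `n` have no grid point in common. -/
def EdgesDisjoint (n : ℕ) (V : ℕ → ℤ × ℤ) : Prop :=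
  ∀ k l z, k + 2 ≤ l → l < n → ¬ (k = 0 ∧ l + 1 = n) → InGridBox z (V k) (V (k + 1)) →
    ¬ InGridBox z (V l) (V (l + 1))

/-- A closed rectilinear walk with the turns `T`, non-adjacent edges of which are disjoint. -/
structure TurnWalk (n : ℕ) (T : ℕ → Turn) (V : ℕ → ℤ × ℤ) : Prop where
  per : ∀ k, V (k + n) = V k
  rect : ∀ k, (V (k + 1) - V k).1 = 0 ∨ (V (k + 1) - V k).2 = 0
  left : ∀ k, T (k + 1) = Turn.left → 0 < cross (V (k + 1) - V k) (V (k + 2) - V (k + 1))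
  right : ∀ k, T (k + 1) = Turn.right → cross (V (k + 1) - V k) (V (k + 2) - V (k + 1)) < 0
  disj : EdgesDisjoint n V

/-- From here on only grid points matter: disjointness of real segments is needed solely at integer
points, where order comparisons decide everything. -/
theorem GridPolygon.Realizes.turnWalk {n : ℕ} {P : GridPolygon n} {S : AngleSequence n}
    (h : P.Realizes S) (hn : 0 < n) (r : ℕ) :
    TurnWalk n (fun k => S (cycIdx hn r k)) (P.walk hn r) := by
  obtain ⟨hrect, ⟨_, _, hdisj⟩, _, hturn⟩ := h
  have rect : ∀ k, (P.walk hn r (k + 1) - P.walk hn r k).1 = 0 ∨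
      (P.walk hn r (k + 1) - P.walk hn r k).2 = 0 := by
    intro k
    rw [← P.edgeVec_cycIdx]
    exact hrect _
  have turn : ∀ k, _ := fun k => (P.hasTurn_iff _ _).1 (hturn (cycIdx hn r (k + 1)))
  refine ⟨P.walk_add_self hn r, rect, ?_, ?_, ?_⟩
  · intro k hk
    have := (turn k).1 hk
    rwa [← finRotate_cycIdx, Equiv.symm_apply_apply, finRotate_cycIdx, P.edgeVec_cycIdx,
      P.edgeVec_cycIdx] at this
  · intro k hk
    have := (turn k).2 hk
    rwa [← finRotate_cycIdx, Equiv.symm_apply_apply, finRotate_cycIdx, P.edgeVec_cycIdx,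
      P.edgeVec_cycIdx] at this
  · intro k l z hkl hl hw hz hz'
    have hsub : ∀ k, (P.walk hn r k).1 = (P.walk hn r (k + 1)).1 ∨
        (P.walk hn r k).2 = (P.walk hn r (k + 1)).2 := by
      intro k
      rcases rect k with h | h
      · left; rw [Prod.fst_sub] at h; omega
      · right; rw [Prod.snd_sub] at h; omega
    have hbox : ∀ k, InGridBox z (P.walk hn r k) (P.walk hn r (k + 1)) →
        (((z.1 : ℝ), (z.2 : ℝ)) : ℝ × ℝ) ∈ P.toReal.edgeSet ℝ (cycIdx hn r k) := by
      intro k hk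
      rw [P.mem_edgeSet_cycIdx hn r k _ (hsub k)]
      simpa only [InGridBox, GridPolygon.InBox, Set.mem_uIcc, Int.cast_le] using hk
    refine Set.disjoint_left.1 (hdisj (cycIdx hn r k) (cycIdx hn r l) ?_ ?_ ?_) (hbox k hz)
      (hbox l hz')
    · intro h
      have := cycIdx_inj hn r (by omega) hl h
      omega
    · intro h
      rw [finRotate_cycIdx] at h
      have := cycIdx_inj hn r hl (by omega) h
      omega
    · intro h
      rw [finRotate_cycIdx] at h
      by_cases hl' : l + 1 = n
      · rw [hl'] at h
        have h0 := cycIdx_add_self hn r 0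
        rw [Nat.zero_add] at h0
        have := cycIdx_inj hn r (by omega) hn (h.trans h0)
        omega
      · have := cycIdx_inj hn r (by omega) (by omega) h
        omega

namespace TurnWalk

variable {n : ℕ} {T : ℕ → Turn} {V : ℕ → ℤ × ℤ}

/-- A walk can be rotated by `90°`. -/
theorem rotate (h : TurnWalk n T V) : TurnWalk n T (fun k => (-(V k).2, (V k).1)) := by
  refine ⟨fun k => by simp only [h.per], fun k => ?_, fun k hk => ?_, fun k hk => ?_, ?_⟩
  · have := h.rect k
    simp only [Prod.fst_sub, Prod.snd_sub] at this ⊢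
    omega
  · refine (h.left k hk).trans_eq ?_
    simp only [cross, Prod.fst_sub, Prod.snd_sub]
    ring
  · refine Eq.trans_lt ?_ (h.right k hk)
    simp only [cross, Prod.fst_sub, Prod.snd_sub]
    ring
  · intro k l z h1 h2 h3 hz hz'
    refine h.disj k l (z.2, -z.1) h1 h2 h3 ?_ ?_
    · simp only [InGridBox, Set.mem_uIcc] at hz ⊢
      omega
    · simp only [InGridBox, Set.mem_uIcc] at hz' ⊢
      omega

theorem cross_ne_zero (h : TurnWalk n T V) (k : ℕ) :
    cross (V (k + 1) - V k) (V (k + 2) - V (k + 1)) ≠ 0 := by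
  rcases (T (k + 1)).eq_left_or_right with h' | h'
  · exact (h.left k h').ne'
  · exact (h.right k h').ne

/-- If the first edge is vertical, then vertical and horizontal edges alternate. -/
theorem alternate (h : TurnWalk n T V) (h0 : (V 0).1 = (V 1).1) (t : ℕ) :
    (V (2 * t)).1 = (V (2 * t + 1)).1 ∧ (V (2 * t)).2 ≠ (V (2 * t + 1)).2 ∧
      (V (2 * t + 1)).2 = (V (2 * t + 2)).2 ∧ (V (2 * t + 1)).1 ≠ (V (2 * t + 2)).1 := by
  have step : ∀ k, (V k).1 = (V (k + 1)).1 → (V k).2 ≠ (V (k + 1)).2 ∧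
      (V (k + 1)).2 = (V (k + 2)).2 ∧ (V (k + 1)).1 ≠ (V (k + 2)).1 := by
    intro k hk
    have h1 := h.cross_ne_zero k
    have h2 := h.rect (k + 1)
    simp only [cross, Prod.fst_sub, Prod.snd_sub] at h1 h2
    rw [hk, sub_self, zero_mul, zero_sub, neg_ne_zero, mul_ne_zero_iff] at h1
    have : k + 1 + 1 = k + 2 := rfl
    rw [this] at h2
    omega
  have step' : ∀ k, (V k).2 = (V (k + 1)).2 → (V (k + 1)).1 = (V (k + 2)).1 := by
    intro k hk
    have h1 := h.cross_ne_zero k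
    have h2 := h.rect (k + 1)
    simp only [cross, Prod.fst_sub, Prod.snd_sub] at h1 h2
    rw [hk, sub_self, zero_mul, sub_zero, mul_ne_zero_iff] at h1
    have : k + 1 + 1 = k + 2 := rfl
    rw [this] at h2
    omega
  have hx : (V (2 * t)).1 = (V (2 * t + 1)).1 := by
    induction t with
    | zero => exact h0
    | succ t ih => exact step' _ (step _ ih).2.1
  exact ⟨hx, step _ hx⟩

theorem eq_frameVertex (h : TurnWalk n T V) (h0 : (V 0).1 = (V 1).1) (k : ℕ) :
    V k = frameVertex (fun t => (V (2 * t)).1) (fun t => (V (2 * t)).2) k := by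
  rcases Nat.even_or_odd' k with ⟨t, rfl | rfl⟩
  · rw [frameVertex, show (2 * t + 1) / 2 = t by omega, show 2 * t / 2 = t by omega]
  · rw [frameVertex, show (2 * t + 1) / 2 = t by omega, show (2 * t + 1 + 1) / 2 = t + 1 by omega]
    obtain ⟨h1, _, h2, _⟩ := h.alternate h0 t
    exact Prod.ext h1.symm h2

end TurnWalk

/-- The turns of a framed walk in terms of its coordinates. -/
structure FrameTurns (T : ℕ → Turn) (ξ ζ : ℕ → ℤ) : Prop where
  odd_left : ∀ t, T (2 * t + 1) = Turn.left → 0 < (ζ t - ζ (t + 1)) * (ξ (t + 1) - ξ t)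
  odd_right : ∀ t, T (2 * t + 1) = Turn.right → (ζ t - ζ (t + 1)) * (ξ (t + 1) - ξ t) < 0
  even_left : ∀ t, T (2 * t + 2) = Turn.left → 0 < (ξ (t + 1) - ξ t) * (ζ (t + 1 + 1) - ζ (t + 1))
  even_right : ∀ t, T (2 * t + 2) = Turn.right → (ξ (t + 1) - ξ t) * (ζ (t + 1 + 1) - ζ (t + 1)) < 0

theorem TurnWalk.frameTurns {n : ℕ} {T : ℕ → Turn} {ξ ζ : ℕ → ℤ}
    (h : TurnWalk n T (frameVertex ξ ζ)) : FrameTurns T ξ ζ := by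
  have h1 : ∀ t, cross (frameVertex ξ ζ (2 * t + 1) - frameVertex ξ ζ (2 * t))
      (frameVertex ξ ζ (2 * t + 2) - frameVertex ξ ζ (2 * t + 1))
      = (ζ t - ζ (t + 1)) * (ξ (t + 1) - ξ t) := by
    intro t
    simp only [frameVertex, cross, Prod.fst_sub, Prod.snd_sub]
    rw [show (2 * t + 1) / 2 = t by omega, show (2 * t + 1 + 1) / 2 = t + 1 by omega,
      show 2 * t / 2 = t by omega, show (2 * t + 2 + 1) / 2 = t + 1 by omega]
    ring
  have h2 : ∀ t, cross (frameVertex ξ ζ (2 * t + 2) - frameVertex ξ ζ (2 * t + 1))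
      (frameVertex ξ ζ (2 * t + 3) - frameVertex ξ ζ (2 * t + 2))
      = (ξ (t + 1) - ξ t) * (ζ (t + 1 + 1) - ζ (t + 1)) := by
    intro t
    simp only [frameVertex, cross, Prod.fst_sub, Prod.snd_sub]
    rw [show (2 * t + 1) / 2 = t by omega, show (2 * t + 1 + 1) / 2 = t + 1 by omega,
      show (2 * t + 2 + 1) / 2 = t + 1 by omega, show (2 * t + 3 + 1) / 2 = t + 1 + 1 by omega]
    ring
  refine ⟨fun t ht => ?_, fun t ht => ?_, fun t ht => ?_, fun t ht => ?_⟩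
  · rw [← h1]; exact h.left (2 * t) ht
  · rw [← h1]; exact h.right (2 * t) ht
  · rw [← h2]; exact h.left (2 * t + 1) ht
  · rw [← h2]; exact h.right (2 * t + 1) ht

/-- If the edges of a framed walk are disjoint and the left end is in the right order, then the
whole lower chain is below the upper chain. -/
theorem Frame.separated_of_edgesDisjoint {N p : ℕ} {ξ ζ : ℕ → ℤ} (F : Frame N p ξ ζ)
    (hd : EdgesDisjoint (2 * N) (frameVertex ξ ζ)) (h0 : ζ 1 < ζ N) : Separated N p ξ ζ := by
  have hp := F.p_lt
  -- Horizontal edge `2 * i + 1` against vertical edge `2 * t`, and vertical edge `2 * i` against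
  -- horizontal edge `2 * t + 1`. The conditions `i + 1 < t` and `0 < i` rule out adjacent edges,
  -- the latter the cyclic neighbours `0` and `2 * N - 1`.
  have cell : ∀ i t, i < t → t < N → ∀ x y,
      (x ∈ Set.uIcc (ξ i) (ξ (i + 1)) → y = ζ (i + 1) → x = ξ t → i + 1 < t →
        y ∉ Set.uIcc (ζ t) (ζ (t + 1))) ∧
      (x = ξ i → y ∈ Set.uIcc (ζ i) (ζ (i + 1)) → 0 < i →
        x ∈ Set.uIcc (ξ t) (ξ (t + 1)) → y ≠ ζ (t + 1)) := by
    intro i t hit ht x y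
    refine ⟨fun h1 h2 h3 h4 h5 => ?_, fun h1 h2 h3 h4 h5 => ?_⟩
    · refine hd (2 * i + 1) (2 * t) (x, y) (by omega) (by omega) (by omega) ?_ ?_
      · simp only [InGridBox, frameVertex]
        rw [show (2 * i + 1) / 2 = i by omega, show (2 * i + 1 + 1) / 2 = i + 1 by omega,
          show (2 * i + 1 + 1 + 1) / 2 = i + 1 by omega]
        exact ⟨h1, by simp [h2]⟩
      · simp only [InGridBox, frameVertex]
        rw [show (2 * t + 1) / 2 = t by omega, show (2 * t + 1 + 1) / 2 = t + 1 by omega,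
          show 2 * t / 2 = t by omega]
        exact ⟨by simp [h3], h5⟩
    · refine hd (2 * i) (2 * t + 1) (x, y) (by omega) (by omega) (by omega) ?_ ?_
      · simp only [InGridBox, frameVertex]
        rw [show (2 * i + 1) / 2 = i by omega, show (2 * i + 1 + 1) / 2 = i + 1 by omega,
          show 2 * i / 2 = i by omega]
        exact ⟨by simp [h1], h2⟩
      · simp only [InGridBox, frameVertex]
        rw [show (2 * t + 1) / 2 = t by omega, show (2 * t + 1 + 1) / 2 = t + 1 by omega,
          show (2 * t + 1 + 1 + 1) / 2 = t + 1 by omega]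
        exact ⟨h4, by simp [h5]⟩
  have key := lower_lt_upper_of_noCross (p := p) (q := N - p) (a := ξ) (b := fun j => ξ (N - j))
    (y := fun i => ζ (i + 1)) (z := fun j => ζ (N - j)) F.inc ?_ ?_ h0 ?_ ?_
  · intro i hi t ht ht' h1 h2
    have := key (i + (N - 1 - t)) i (N - 1 - t) rfl hi (by omega)
    rw [show N - (N - 1 - t) = t + 1 by omega, show N - (N - 1 - t + 1) = t by omega] at this
    exact this h1 h2
  · intro j hj
    have := F.dec (N - (j + 1)) (by omega) (by omega)
    rwa [show N - (j + 1) + 1 = N - j by omega] at this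
  · simp [F.ξ_per]
  · intro i j hi hj h1 h2 h3
    refine (cell (i + 1) (N - (j + 1)) (by omega) (by omega) (ξ (i + 1)) (ζ (N - j))).2 rfl h3
      (by omega) ?_ ?_
    · rw [show N - (j + 1) + 1 = N - j by omega, Set.mem_uIcc]
      exact Or.inr ⟨h1, h2⟩
    · rw [show N - (j + 1) + 1 = N - j by omega]
  · intro i j hi hj h1 h2 h3
    refine (cell i (N - (j + 1)) (by omega) (by omega) (ξ (N - (j + 1))) (ζ (i + 1))).1 ?_ rfl rfl
      (by omega) ?_
    · rw [Set.mem_uIcc]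
      exact Or.inl ⟨h1, h2⟩
    · rw [show N - (j + 1) + 1 = N - j by omega, Set.uIcc_comm]
      exact h3

/-- A framed walk whose turns form a pattern, and whose first edge goes down. -/
theorem FrameTurns.frame {N p : ℕ} {T : ℕ → Turn} {ξ ζ : ℕ → ℤ} (h : FrameTurns T ξ ζ)
    (hT : Pattern N p T) (h0 : ζ 1 < ζ 0) (hξ : ξ N = ξ 0) (hζ : ζ N = ζ 0)
    (hζ' : ζ (N + 1) = ζ 1) : Frame N p ξ ζ ∧ Steps N p T ζ := by
  have hp := hT.p_lt
  have pos1 : ∀ x y : ℤ, 0 < x * y → 0 < x → 0 < y := fun x y h h' =>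
    (mul_pos_iff_of_pos_left h').1 h
  have pos2 : ∀ x y : ℤ, 0 < x * y → x < 0 → y < 0 := by intro x y h h'; by_contra; nlinarith
  have neg1 : ∀ x y : ℤ, x * y < 0 → 0 < x → y < 0 := by intro x y h h'; by_contra; nlinarith
  have neg2 : ∀ x y : ℤ, x * y < 0 → x < 0 → 0 < y := by intro x y h h'; by_contra; nlinarith
  -- A turn and the direction of one edge determine the direction of the next. The descent of the
  -- first edge and the left turn after it start the chain to the right, and mixed pairs keep that
  -- direction.
  have inc : ∀ t < p, ξ t < ξ (t + 1) := by
    intro t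
    induction t with
    | zero =>
      intro _
      have := pos1 _ _ (h.odd_left 0 hT.one) (by rw [Nat.zero_add]; omega)
      omega
    | succ t ih =>
      intro ht
      have h1 := ih (by omega)
      have h2 := hT.mixed (t + 1) (by omega) (by omega) (by omega)
      rw [show 2 * (t + 1) = 2 * t + 2 by ring] at h2
      rcases (T (2 * t + 2)).eq_left_or_right with h3 | h3
      · have h4 : T (2 * (t + 1) + 1) = Turn.right := by
          rw [h3] at h2
          exact (Turn.eq_left_or_right _).resolve_left h2.symm
        have h5 := pos1 _ _ (h.even_left t h3) (by omega)
        have := neg2 _ _ (h.odd_right (t + 1) h4) (by omega)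
        omega
      · have h4 : T (2 * (t + 1) + 1) = Turn.left := by
          rw [h3] at h2
          exact (Turn.eq_left_or_right _).resolve_right h2.symm
        have h5 := neg1 _ _ (h.even_right t h3) (by omega)
        have := pos1 _ _ (h.odd_left (t + 1) h4) (by omega)
        omega
  -- The two left turns at vertical edge `p` reverse the direction; afterwards mixed pairs keep it
  -- again.
  have dec : ∀ m, p + m < N → ξ (p + m + 1) < ξ (p + m) := by
    intro m
    induction m with
    | zero =>
      intro _
      have h1 := inc (p - 1) (by have := hT.p_pos; omega)
      have h2 := h.even_left (p - 1)
      have hp' : p - 1 + 1 = p := Nat.sub_add_cancel hT.p_pos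
      rw [show 2 * (p - 1) + 2 = 2 * p by omega, hp'] at h2
      rw [hp'] at h1
      have h3 := pos1 _ _ (h2 hT.two_p) (by omega)
      have := pos2 _ _ (h.odd_left p hT.two_p_succ) (by omega)
      simp only [Nat.add_zero]
      omega
    | succ m ih =>
      intro hm
      have h1 := ih (by omega)
      have h2 := hT.mixed (p + m + 1) (by omega) (by omega) (by omega)
      rw [show 2 * (p + m + 1) = 2 * (p + m) + 2 by ring] at h2
      rw [← Nat.add_assoc]
      rcases (T (2 * (p + m) + 2)).eq_left_or_right with h3 | h3
      · have h4 : T (2 * (p + m + 1) + 1) = Turn.right := by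
          rw [h3] at h2
          exact (Turn.eq_left_or_right _).resolve_left h2.symm
        have h5 := pos2 _ _ (h.even_left _ h3) (by omega)
        have := neg1 _ _ (h.odd_right _ h4) (by omega)
        omega
      · have h4 : T (2 * (p + m + 1) + 1) = Turn.left := by
          rw [h3] at h2
          exact (Turn.eq_left_or_right _).resolve_right h2.symm
        have h5 := neg2 _ _ (h.even_right _ h3) (by omega)
        have := pos2 _ _ (h.odd_left _ h4) (by omega)
        omega
  have dec' : ∀ t, p ≤ t → t < N → ξ (t + 1) < ξ t := by
    intro t ht ht'
    obtain ⟨m, rfl⟩ := Nat.exists_eq_add_of_le ht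
    exact dec m ht'
  refine ⟨⟨hT.p_pos, hT.p_lt, inc, dec', hξ, hζ, hζ'⟩, ?_, ?_, ?_, ?_⟩
  · intro t ht ht' h1
    obtain ⟨t, rfl⟩ : ∃ s, t = s + 1 := ⟨t - 1, by omega⟩
    have := inc t (by omega)
    have := pos1 _ _ (h.even_left t h1) (by omega)
    omega
  · intro t ht ht' h1
    obtain ⟨t, rfl⟩ : ∃ s, t = s + 1 := ⟨t - 1, by omega⟩
    have := inc t (by omega)
    have := neg1 _ _ (h.even_right t h1) (by omega)
    omega
  · intro t ht ht' h1
    obtain ⟨t, rfl⟩ : ∃ s, t = s + 1 := ⟨t - 1, by omega⟩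
    have := dec' t (by omega) (by omega)
    have := pos2 _ _ (h.even_left t h1) (by omega)
    omega
  · intro t ht ht' h1
    obtain ⟨t, rfl⟩ : ∃ s, t = s + 1 := ⟨t - 1, by omega⟩
    have := dec' t (by omega) (by omega)
    have := neg2 _ _ (h.even_right t h1) (by omega)
    omega

/-- All points of a walk lie in an axis-parallel rectangle of width `w` and height `h`. -/
def InRectangle (V : ℕ → ℤ × ℤ) (w h : ℤ) : Prop :=
  ∃ x y, ∀ k, (x ≤ (V k).1 ∧ (V k).1 ≤ x + w) ∧ y ≤ (V k).2 ∧ (V k).2 ≤ y + h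

theorem InRectangle.rotate {V : ℕ → ℤ × ℤ} {w h : ℤ} (H : InRectangle V w h) :
    InRectangle (fun k => (-(V k).2, (V k).1)) h w := by
  obtain ⟨x, y, H⟩ := H
  refine ⟨-y - h, x, fun k => ?_⟩
  have := H k
  dsimp only
  omega

theorem GridPolygon.inRectangle {n : ℕ} (P : GridPolygon n) (hn : 0 < n) (r : ℕ) :
    InRectangle (P.walk hn r) P.width P.height := by
  refine ⟨⨅ i, (P i).1, ⨅ i, (P i).2, fun k => ⟨⟨ciInf_le (Set.finite_range _).bddBelow _, ?_⟩,
    ciInf_le (Set.finite_range _).bddBelow _, ?_⟩⟩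
  · rw [width, add_sub_cancel]
    exact le_ciSup (f := fun i => (P i).1) (Set.finite_range _).bddAbove _
  · rw [height, add_sub_cancel]
    exact le_ciSup (f := fun i => (P i).2) (Set.finite_range _).bddAbove _

/-- The descent of the first edge is used twice: it seeds the directions of all edges, and because
of `ζ N = ζ 0` it puts the two chains in the right order at the left end. -/
theorem TurnWalk.exists_frame_of_down {n N p : ℕ} {T : ℕ → Turn} {V : ℕ → ℤ × ℤ} {w h : ℤ}
    (H : TurnWalk n T V) (hN : n = 2 * N) (hT : Pattern N p T) (hV : InRectangle V w h)
    (h0 : (V 0).1 = (V 1).1) (h1 : (V 1).2 < (V 0).2) :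
    ∃ (ξ ζ : ℕ → ℤ), Frame N p ξ ζ ∧ Separated N p ξ ζ ∧ Steps N p T ζ ∧
      InRectangle (frameVertex ξ ζ) w h := by
  have hVf := funext (H.eq_frameVertex h0)
  set ξ := fun t => (V (2 * t)).1 with hξ
  set ζ := fun t => (V (2 * t)).2 with hζ
  have hζ01 : ζ 1 < ζ 0 := by
    have := (H.alternate h0 0).2.2.1
    simp only [hζ]
    norm_num at this ⊢
    omega
  have hper : ∀ t, V (2 * (t + N)) = V (2 * t) := fun t => by rw [Nat.mul_add, ← hN, H.per]
  have hN0 := hper 0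
  rw [Nat.zero_add] at hN0
  have hN1 := hper 1
  rw [Nat.add_comm] at hN1
  have hζN : ζ N = ζ 0 := by simp only [hζ]; rw [hN0]
  have hH := H
  rw [hVf] at hH
  obtain ⟨F, hS⟩ := hH.frameTurns.frame hT hζ01 (by simp only [hξ]; rw [hN0]) hζN
    (by simp only [hζ]; rw [hN1])
  exact ⟨ξ, ζ, F, F.separated_of_edgesDisjoint (hN ▸ hH.disj) (by omega), hS, hVf ▸ hV⟩

/-- Every polygon that realizes a pattern comes, up to a rotation by a multiple of `90°`, from a
separated frame with the same bounding box area. -/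
theorem GridPolygon.Realizes.exists_frame {n N p : ℕ} {Q : GridPolygon n} {S : AngleSequence n}
    (hQ : Q.Realizes S) (hn : 0 < n) (hN : n = 2 * N) (r : ℕ)
    (hT : Pattern N p (fun k => S (cycIdx hn r k))) :
    ∃ (ξ ζ : ℕ → ℤ) (w h : ℤ), Frame N p ξ ζ ∧ Separated N p ξ ζ ∧
      Steps N p (fun k => S (cycIdx hn r k)) ζ ∧ InRectangle (frameVertex ξ ζ) w h ∧
      Q.boundingBoxArea = w * h := by
  have H := hQ.turnWalk hn r
  have hR := Q.inRectangle hn r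
  have h2 := hQ.2.1.1 (cycIdx hn r 0)
  rw [finRotate_cycIdx] at h2
  change Q.walk hn r 0 ≠ Q.walk hn r 1 at h2
  have h1 := H.rect 0
  rw [Nat.zero_add, Prod.fst_sub, Prod.snd_sub] at h1
  have h3 : ¬ ((Q.walk hn r 0).1 = (Q.walk hn r 1).1 ∧ (Q.walk hn r 0).2 = (Q.walk hn r 1).2) :=
    fun h => h2 (Prod.ext h.1 h.2)
  -- Exactly one of the four rotations makes the first edge point down. Odd rotations exchange width
  -- and height, which leaves the area unchanged.
  by_cases hx : (Q.walk hn r 0).1 = (Q.walk hn r 1).1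
  · by_cases hy : (Q.walk hn r 1).2 < (Q.walk hn r 0).2
    · obtain ⟨ξ, ζ, h4, h5, h6, h7⟩ := H.exists_frame_of_down hN hT hR hx hy
      exact ⟨ξ, ζ, _, _, h4, h5, h6, h7, rfl⟩
    · obtain ⟨ξ, ζ, h4, h5, h6, h7⟩ := H.rotate.rotate.exists_frame_of_down hN hT hR.rotate.rotate
        (by dsimp only; omega) (by dsimp only; omega)
      exact ⟨ξ, ζ, _, _, h4, h5, h6, h7, rfl⟩
  · by_cases hy : (Q.walk hn r 1).1 < (Q.walk hn r 0).1
    · obtain ⟨ξ, ζ, h4, h5, h6, h7⟩ := H.rotate.exists_frame_of_down hN hT hR.rotate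
        (by dsimp only; omega) (by dsimp only; omega)
      exact ⟨ξ, ζ, _, _, h4, h5, h6, h7, mul_comm _ _⟩
    · obtain ⟨ξ, ζ, h4, h5, h6, h7⟩ := H.rotate.rotate.rotate.exists_frame_of_down hN hT
        hR.rotate.rotate.rotate (by dsimp only; omega) (by dsimp only; omega)
      exact ⟨ξ, ζ, _, _, h4, h5, h6, h7, mul_comm _ _⟩

/-! ### `x`-monotone sequences have a pattern -/

open GridPolygon (cross)

theorem finRotate_iterate {n : ℕ} (hn : 0 < n) (a : Fin n) (j : ℕ) :
    (finRotate n)^[j] a = cycIdx hn a j := by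
  induction j with
  | zero => ext; simp [cycIdx, Nat.mod_eq_of_lt a.2]
  | succ j ih => rw [Function.iterate_succ_apply', ih, finRotate_cycIdx]

/-- The turns of a separated frame form a pattern. -/
theorem FrameTurns.pattern {N p : ℕ} {T : ℕ → Turn} {ξ ζ : ℕ → ℤ} (h : FrameTurns T ξ ζ)
    (F : Frame N p ξ ζ) (hs : Separated N p ξ ζ) (hTN : T (2 * N) = T 0) : Pattern N p T := by
  have hp := F.p_lt
  have hp0 := F.p_pos
  have hζp : ζ p < ζ (p + 1) := by
    have h1 := hs (p - 1) (by omega) p le_rfl hp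
    have h2 := F.inc (p - 1) (by omega)
    have h3 := F.dec p le_rfl hp
    rw [Nat.sub_add_cancel hp0] at h1 h2
    exact h1 h2.le h3.le
  have hζN : ζ 1 < ζ N := by
    have h1 := hs 0 hp0 (N - 1) (by omega) (by omega)
    have h2 := F.inc 0 hp0
    have h3 := F.dec (N - 1) (by omega) (by omega)
    rw [Nat.sub_add_cancel (by omega), F.ξ_per] at h1 h3
    exact h1 h3.le h2.le
  refine ⟨hp0, hp, ?_, ?_, ?_, ?_, ?_⟩
  · refine (T 0).eq_left_or_right.resolve_right fun h' => ?_
    have h1 := h.even_right (N - 1)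
    have h2 := F.dec (N - 1) (by omega) (by omega)
    rw [show 2 * (N - 1) + 2 = 2 * N by omega, Nat.sub_add_cancel (by omega), F.ζ_per'] at h1
    rw [Nat.sub_add_cancel (by omega)] at h2
    have := h1 (hTN.trans h')
    nlinarith
  · refine (T 1).eq_left_or_right.resolve_right fun h' => ?_
    have h1 := h.odd_right 0 h'
    have h2 := F.inc 0 hp0
    rw [← F.ζ_per, Nat.zero_add] at h1
    rw [Nat.zero_add] at h2
    nlinarith
  · refine (T (2 * p)).eq_left_or_right.resolve_right fun h' => ?_
    have h1 := h.even_right (p - 1)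
    have h2 := F.inc (p - 1) (by omega)
    rw [show 2 * (p - 1) + 2 = 2 * p by omega, Nat.sub_add_cancel (by omega)] at h1
    rw [Nat.sub_add_cancel (by omega)] at h2
    have := h1 h'
    nlinarith
  · refine (T (2 * p + 1)).eq_left_or_right.resolve_right fun h' => ?_
    have h1 := h.odd_right p h'
    have h2 := F.dec p le_rfl hp
    nlinarith
  · intro t h0 ht htp
    obtain ⟨s, rfl⟩ : ∃ s, t = s + 1 := ⟨t - 1, by omega⟩
    rw [show 2 * (s + 1) = 2 * s + 2 by ring]
    have e1 := h.even_left s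
    have e2 := h.even_right s
    have o1 := h.odd_left (s + 1)
    have o2 := h.odd_right (s + 1)
    rw [show 2 * (s + 1) = 2 * s + 2 by ring] at o1 o2
    have hsame : 0 < (ξ (s + 1) - ξ s) * (ξ (s + 1 + 1) - ξ (s + 1)) := by
      by_cases hsp : s + 1 < p
      · have := F.inc s (by omega)
        have := F.inc (s + 1) hsp
        nlinarith
      · have := F.dec s (by omega) (by omega)
        have := F.dec (s + 1) (by omega) ht
        nlinarith
    -- Equal turns would make the product of the two turn determinants positive. It is, however, the
    -- negative of the square of the vertical step times the positive product in `hsame`.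
    intro heq
    rcases (T (2 * s + 2)).eq_left_or_right with h' | h'
    · have e := e1 h'
      have o := o1 (heq ▸ h')
      nlinarith [mul_pos e o, mul_nonneg hsame.le (sq_nonneg (ζ (s + 1 + 1) - ζ (s + 1)))]
    · have e := e2 h'
      have o := o2 (heq ▸ h')
      nlinarith [mul_pos_of_neg_of_neg e o,
        mul_nonneg hsame.le (sq_nonneg (ζ (s + 1 + 1) - ζ (s + 1)))]

theorem frameVertex_neg (ξ ζ : ℕ → ℤ) (k : ℕ) :
    frameVertex ξ (fun t => -ζ t) k = ((frameVertex ξ ζ k).1, -(frameVertex ξ ζ k).2) := rfl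

/-- A framed walk with disjoint edges and positive area is separated. -/
theorem Frame.separated_of_area_pos {N p : ℕ} {ξ ζ : ℕ → ℤ} (F : Frame N p ξ ζ)
    (hd : EdgesDisjoint (2 * N) (frameVertex ξ ζ)) (h0 : ζ 0 ≠ ζ 1)
    (harea : 0 < ∑ k ∈ Finset.range (2 * N),
      cross (frameVertex ξ ζ k) (frameVertex ξ ζ (k + 1))) : Separated N p ξ ζ := by
  have hζN := F.ζ_per
  by_cases h : ζ 1 < ζ N
  · exact F.separated_of_edgesDisjoint hd h
  · exfalso
    -- Otherwise the chains are upside down at the left end. The reflection in the horizontal axis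
    -- is then separated and has positive area, but reflecting negates the area.
    have F' : Frame N p ξ (fun t => -ζ t) :=
      ⟨F.p_pos, F.p_lt, F.inc, F.dec, F.ξ_per, by simp [F.ζ_per], by simp [F.ζ_per']⟩
    have hd' : EdgesDisjoint (2 * N) (frameVertex ξ (fun t => -ζ t)) := by
      intro k l z h1 h2 h3 hz hz'
      refine hd k l (z.1, -z.2) h1 h2 h3 ?_ ?_
      · simp only [InGridBox, Set.mem_uIcc, frameVertex_neg] at hz ⊢
        omega
      · simp only [InGridBox, Set.mem_uIcc, frameVertex_neg] at hz' ⊢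
        omega
    have := F'.sum_cross_pos (F'.separated_of_edgesDisjoint hd' (by omega))
    simp only [frameVertex_neg, cross] at this harea
    rw [← neg_neg_iff_pos, ← Finset.sum_neg_distrib] at harea
    refine harea.not_gt (this.trans_eq (Finset.sum_congr rfl fun k _ => ?_))
    ring

/-- Let `j1` be the first edge that goes right, and start at the vertical edge before it. Horizontal
edge `t` of the new walk is the old edge `j1 + 2 * t`; it goes right as long as this index is below
`m`, whence the size `(m - j1 + 1) / 2`. Indices that wrap around fall before `j1`, where no edge
goes right by minimality. -/
theorem AngleSequence.IsXMonotone.exists_pattern {n : ℕ} {S : AngleSequence n}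
    (hS : S.IsXMonotone) : ∃ hn : 0 < n, ∃ N p r, n = 2 * N ∧ r < n ∧
      Pattern N p (fun k => S (cycIdx hn r k)) := by
  obtain ⟨P, hP, a, m, hm, hmono⟩ := hS
  have hn : 0 < n := a.pos
  refine ⟨hn, ?_⟩
  simp only [finRotate_iterate hn, P.edgeVec_cycIdx, Prod.fst_sub] at hmono
  have H0 := hP.turnWalk hn a
  set W := P.walk hn a with hW
  set D : ℕ → ℤ := fun j => (W (j + 1)).1 - (W j).1 with hD
  have hDper : ∀ j, D (j + n) = D j := by
    intro j
    simp only [hD]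
    rw [show j + n + 1 = j + 1 + n by ring, H0.per, H0.per]
  have hsum : ∑ j ∈ Finset.range n, D j = 0 := by
    simp only [hD]
    rw [Finset.sum_range_sub (fun j => (W j).1)]
    have := H0.per 0
    rw [Nat.zero_add] at this
    rw [this, sub_self]
  have hcross : ∀ k, D k = 0 → D (k + 1) ≠ 0 := by
    intro k h1 h2
    have := H0.cross_ne_zero k
    simp only [cross, Prod.fst_sub, Prod.snd_sub] at this
    simp only [hD] at h1 h2
    rw [h1, h2] at this
    simp at this
  have hpos : ∃ j, j < n ∧ 0 < D j := by
    have : ∃ j ∈ Finset.range n, 0 < D j := by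
      refine Finset.exists_pos_of_sum_zero_of_exists_nonzero D hsum ?_
      by_cases h1 : D 0 = 0
      · have h2 := hcross 0 h1
        refine ⟨1, ?_, h2⟩
        rw [Finset.mem_range]
        by_contra h3
        obtain rfl : n = 1 := by omega
        exact h2 (by rw [hDper 0, h1])
      · exact ⟨0, by simpa using hn, h1⟩
    simpa using this
  classical
  obtain ⟨hj1, hj2⟩ := Nat.find_spec hpos
  have hj3 : ∀ j < Nat.find hpos, j < n → D j ≤ 0 := by
    intro j hj hjn
    have := Nat.find_min hpos hj
    by_contra hc
    exact this ⟨hjn, by omega⟩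
  set j1 := Nat.find hpos
  have hjm : j1 < m := by
    by_contra hc
    have := (hmono j1 hj1).2 (by omega)
    simp only [hD] at hj2
    omega
  -- The summand `n` protects the subtraction of `1` from truncation when `a + j1 = 0`.
  have hwalk : ∀ k, P.walk hn ((a + j1 + n - 1) % n) (k + 1) = W (j1 + k) := by
    intro k
    simp only [hW, GridPolygon.walk]
    congr 1
    ext
    simp only [cycIdx, Nat.mod_add_mod]
    rw [show a + j1 + n - 1 + (k + 1) = a + (j1 + k) + n by omega, Nat.add_mod_right]
  have H := hP.turnWalk hn ((a + j1 + n - 1) % n)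
  set r := (a + j1 + n - 1) % n with hr
  have hrn : r < n := Nat.mod_lt _ hn
  have harea := hP.2.2.1
  rw [GridPolygon.IsCounterclockwise, P.doubleSignedArea_eq_sum_walk hn r] at harea
  set V := P.walk hn r with hV
  have hVD : ∀ k, (V (k + 1 + 1)).1 - (V (k + 1)).1 = D (j1 + k) := by
    intro k
    rw [hwalk, hwalk]
    rfl
  have hV0 : (V 0).1 = (V 1).1 := by
    have h1 := H.cross_ne_zero 0
    have h2 := H.rect 0
    have h3 := H.rect 1
    have h4 := hVD 0
    simp only [cross, Prod.fst_sub, Prod.snd_sub, Nat.zero_add, Nat.add_zero] at h1 h2 h3 h4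
    have h5 : (V (1 + 1)).2 - (V 1).2 = 0 := h3.resolve_left (by omega)
    rw [show (V 2).2 - (V 1).2 = 0 from h5, mul_zero, zero_sub, neg_ne_zero, mul_ne_zero_iff] at h1
    omega
  have halt := H.alternate hV0
  have hper := H.per
  obtain ⟨N, hN⟩ : ∃ N, n = 2 * N := by
    rcases Nat.even_or_odd' n with ⟨N, h | h⟩
    · exact ⟨N, h⟩
    · exfalso
      have h1 := (halt N).2.2.2
      have h2 := hper 0
      have h3 := hper 1
      rw [show 0 + n = 2 * N + 1 by omega] at h2
      rw [show 1 + n = 2 * N + 2 by omega] at h3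
      rw [h2, h3] at h1
      exact h1 hV0
  have hVf := funext (H.eq_frameVertex hV0)
  set ξ := fun t => (V (2 * t)).1 with hξ
  set ζ := fun t => (V (2 * t)).2 with hζ
  have hξD : ∀ t, ξ (t + 1) - ξ t = D (j1 + 2 * t) := by
    intro t
    rw [← hVD]
    simp only [hξ]
    rw [(halt t).1]
    rfl
  have hξne : ∀ t, ξ (t + 1) ≠ ξ t := by
    intro t
    simp only [hξ]
    rw [(halt t).1]
    exact (halt t).2.2.2.symm
  have hper' : ∀ t, V (2 * (t + N)) = V (2 * t) := fun t => by
    rw [Nat.mul_add, ← hN, hper]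
  have hN0 := hper' 0
  rw [Nat.zero_add] at hN0
  have hN1 := hper' 1
  rw [Nat.add_comm] at hN1
  have hξN : ξ N = ξ 0 := by simp only [hξ]; rw [hN0]
  have hinc : ∀ t, t < (m - j1 + 1) / 2 → t < N → ξ t < ξ (t + 1) := by
    intro t ht htN
    have h1 := hξD t
    have h2 := hξne t
    have h3 := (hmono (j1 + 2 * t) (by omega)).1 (by omega)
    simp only [hD] at h1
    omega
  have hdec : ∀ t, (m - j1 + 1) / 2 ≤ t → t < N → ξ (t + 1) < ξ t := by
    intro t ht htN
    have h1 := hξD t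
    have h2 := hξne t
    have h3 : D (j1 + 2 * t) ≤ 0 := by
      by_cases h4 : j1 + 2 * t < n
      · have h3 := (hmono (j1 + 2 * t) (by omega)).2 (by omega)
        exact h3
      · obtain ⟨l, hl⟩ := Nat.exists_eq_add_of_le' (Nat.le_of_not_lt h4)
        rw [hl, hDper]
        exact hj3 l (by omega) (by omega)
    omega
  have hpN : (m - j1 + 1) / 2 < N := by
    by_contra hc
    have : ∀ t ≤ N, ξ 0 + t ≤ ξ t := by
      intro t
      induction t with
      | zero => simp
      | succ t ih =>
        intro ht
        have := ih (by omega)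
        have := hinc t (by omega) (by omega)
        push_cast
        omega
    have := this N le_rfl
    omega
  have F : Frame N ((m - j1 + 1) / 2) ξ ζ :=
    ⟨by omega, hpN, fun t ht => hinc t ht (by omega), hdec, hξN, by simp only [hζ]; rw [hN0],
      by simp only [hζ]; rw [hN1]⟩
  have h01 : ζ 0 ≠ ζ 1 := by
    have := (halt 0).2.1
    rw [(halt 0).2.2.1] at this
    exact this
  have hd := H.disj
  rw [hVf, hN] at hd
  rw [hVf, hN] at harea
  refine ⟨N, _, r, hN, hrn, FrameTurns.pattern (TurnWalk.frameTurns (hVf ▸ H)) F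
    (F.separated_of_area_pos hd h01 harea) ?_⟩
  rw [← hN, ← cycIdx_add_self hn r 0, Nat.zero_add]

/-! ### Heights -/

/-- A labelling of the horizontal edges that increases at left turns and decreases at right turns
within both chains. -/
structure Labelling (N p : ℕ) (T : ℕ → Turn) (G : ℕ → ℤ) : Prop where
  left : ∀ t, 0 < t → t < N → t ≠ p → T (2 * t) = Turn.left → G t < G (t + 1)
  right : ∀ t, 0 < t → t < N → t ≠ p → T (2 * t) = Turn.right → G (t + 1) < G t

/-- The least nonnegative labelling. -/
structure LeastLabelling (N p : ℕ) (T : ℕ → Turn) (H : ℕ → ℕ) : Prop where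
  labelling : Labelling N p T (fun t => H t)
  le : ∀ G, Labelling N p T G → (∀ t, 0 < t → t ≤ N → 0 ≤ G t) →
    ∀ t, 0 < t → t ≤ N → (H t : ℤ) ≤ G t
  bound : ∀ t, 0 < t → t ≤ N → H t ≤ 2 * N

/-- With labels measured from below for the lower chain and from above for the upper chain of a
drawing of height `h`, the `i`-th lower edge is below the `j`-th upper edge from the left. -/
def Below (N : ℕ) (H : ℕ → ℕ) (h i j : ℕ) : Prop := H (i + 1) + H (N - j) < h

theorem Frame.frameVertex_mem {N p : ℕ} {ξ ζ : ℕ → ℤ} (F : Frame N p ξ ζ) (t : ℕ) (ht : t ≤ N) :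
    ξ 0 ≤ ξ t ∧ ξ t ≤ ξ p := by
  have h0 := F.p_pos
  have hp := F.p_lt
  have h1 := F.lt_of_lt_of_le h0 le_rfl
  rcases Nat.lt_trichotomy t p with h | rfl | h
  · have := F.lt_of_lt_of_le h le_rfl
    rcases Nat.eq_zero_or_pos t with rfl | h'
    · omega
    · have := F.lt_of_lt_of_le h' h.le
      omega
  · omega
  · have := F.lt_of_le_of_lt h le_rfl ht
    rcases ht.lt_or_eq with h' | rfl
    · have := F.lt_of_le_of_lt h' h.le le_rfl
      have := F.ξ_per
      omega
    · have := F.ξ_per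
      omega

/-- The area of every separated frame is at least the area that some cheapest sequence of columns
achieves. -/
theorem Frame.exists_colDist_le {N p : ℕ} {T : ℕ → Turn} {H : ℕ → ℕ} {ξ ζ : ℕ → ℤ} {w h : ℤ}
    (F : Frame N p ξ ζ) (hs : Separated N p ξ ζ) (hS : Steps N p T ζ)
    (hR : InRectangle (frameVertex ξ ζ) w h) (hH : LeastLabelling N p T H) (K : ℕ) :
    ∃ h', 0 < h' ∧ h' ≤ 6 * N ∧ colDist (Below N H h') K (p - 1) (N - p - 1) + 2 ≤ N ∧
      (h' : ℤ) * (colDist (Below N H h') K (p - 1) (N - p - 1) + 1) ≤ w * h := by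
  have hp := F.p_lt
  have hp0 := F.p_pos
  obtain ⟨x0, y0, hR⟩ := hR
  have hRζ : ∀ t, y0 ≤ ζ t ∧ ζ t ≤ y0 + h := by
    intro t
    have := (hR (2 * t)).2
    simp only [frameVertex] at this
    rwa [show (2 * t + 1) / 2 = t by omega] at this
  have hRξ : ∀ t, x0 ≤ ξ t ∧ ξ t ≤ x0 + w := by
    intro t
    have := (hR (2 * t)).1
    simp only [frameVertex] at this
    rwa [show (2 * t) / 2 = t by omega] at this
  -- Measuring the lower chain from the bottom and the upper chain from the top subjects both to the
  -- same rule: left turns increase the label, right turns decrease it.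
  have hG : Labelling N p T (fun t => if t ≤ p then ζ t - y0 else y0 + h - ζ t) := by
    refine ⟨fun t h1 h2 h3 h4 => ?_, fun t h1 h2 h3 h4 => ?_⟩
    · rcases Nat.lt_or_gt_of_ne h3 with h5 | h5
      · have := hS.lower_left t h1 h5 h4
        rw [if_pos h5.le, if_pos (by omega)]; omega
      · have := hS.upper_left t h5 h2 h4
        rw [if_neg (by omega), if_neg (by omega)]; omega
    · rcases Nat.lt_or_gt_of_ne h3 with h5 | h5
      · have := hS.lower_right t h1 h5 h4
        rw [if_pos h5.le, if_pos (by omega)]; omega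
      · have := hS.upper_right t h5 h2 h4
        rw [if_neg (by omega), if_neg (by omega)]; omega
  have hHG := hH.le _ hG (fun t _ _ => by have := hRζ t; split_ifs <;> omega)
  have hlt : ζ 1 < ζ N := by
    have h1 := hs 0 hp0 (N - 1) (by omega) (by omega)
    have h2 := F.inc 0 hp0
    have h3 := F.dec (N - 1) (by omega) (by omega)
    rw [Nat.sub_add_cancel (by omega), F.ξ_per] at h1 h3
    exact h1 h3.le h2.le
  have hh : 0 < h := by
    have := hRζ 1
    have := hRζ N
    omega
  -- Two labels add up to at most `4 * N`, so capping the height at `6 * N` does not change which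
  -- pairs satisfy `Below`, and bounds the heights that have to be tried.
  have key := colDist_lt_of_drawing (c := Below N H (min h.toNat (6 * N))) K (p := p) (q := N - p)
    (a := ξ) (b := fun j => ξ (N - j)) hp0 (by omega) F.inc ?_ ?_ ?_ ?_
  · refine ⟨min h.toNat (6 * N), by omega, by omega, by omega, ?_⟩
    have h1 := hRξ 0
    have h2 := hRξ p
    have h3 : ((min h.toNat (6 * N) : ℕ) : ℤ) ≤ h := by omega
    rw [mul_comm w]
    exact mul_le_mul h3 (by omega) (by omega) hh.le
  · intro j hj
    have := F.dec (N - (j + 1)) (by omega) (by omega)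
    rwa [show N - (j + 1) + 1 = N - j by omega] at this
  · simp [F.ξ_per]
  · simp [Nat.sub_sub_self hp.le]
  · intro i hi j hj h1 h2
    have h3 := hs i hi (N - (j + 1)) (by omega) (by omega) h1
    rw [show N - (j + 1) + 1 = N - j by omega] at h3
    replace h3 := h3 h2
    have h4 := hHG (i + 1) (by omega) (by omega)
    have h5 := hHG (N - j) (by omega) (by omega)
    have h6 := hH.bound (i + 1) (by omega) (by omega)
    have h7 := hH.bound (N - j) (by omega) (by omega)
    rw [if_pos (by omega)] at h4
    rw [if_neg (by omega)] at h5
    rw [Below]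
    omega

/-! ### From drawings back to polygons -/

/-- The horizontal positions of the vertical edges of a drawing. -/
def drawX (N p X : ℕ) (a b : ℕ → ℕ) (t : ℕ) : ℕ :=
  if t < p then a t else if t = p then X + 1 else b (N - t)

/-- The heights of the horizontal edges of a drawing of height `h`. -/
def drawY (N p h : ℕ) (H : ℕ → ℕ) (t : ℕ) : ℕ :=
  if t = 0 then h - H N else if t ≤ p then H t else if t ≤ N then h - H t else H 1

/-- With least labels measured from the bottom and from the top, separation of a touching pair is
literally `Below`, and the steps are those of the labelling. -/
theorem Draw.exists_frame {N p h X : ℕ} {T : ℕ → Turn} {H a b : ℕ → ℕ}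
    (hT : Pattern N p T) (hH : LeastLabelling N p T H)
    (hD : Draw (Below N H h) (p - 1) (N - p - 1) X a b) :
    Frame N p (fun t => drawX N p X a b t) (fun t => drawY N p h H t) ∧
    Separated N p (fun t => drawX N p X a b t) (fun t => drawY N p h H t) ∧
    Steps N p T (fun t => drawY N p h H t) ∧
    (∀ t ≤ N, drawX N p X a b t ≤ X + 1) ∧ (∀ t, drawY N p h H t ≤ h) := by
  have hp := hT.p_lt
  have hp0 := hT.p_pos
  have F : Frame N p (fun t => drawX N p X a b t) (fun t => drawY N p h H t) := by
    refine ⟨hp0, hp, fun t ht => ?_, fun t ht ht' => ?_, ?_, ?_, ?_⟩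
    · simp only [drawX]
      rw [if_pos ht]
      by_cases h1 : t + 1 < p
      · rw [if_pos h1]
        exact_mod_cast hD.a_lt t (by omega)
      · rw [if_neg h1, if_pos (by omega)]
        have := hD.a_le' t (by omega)
        push_cast
        omega
    · simp only [drawX]
      rw [if_neg (by omega), if_neg (by omega), if_neg (by omega)]
      by_cases h1 : t = p
      · rw [if_pos h1]
        have := hD.b_le' (N - (t + 1)) (by omega)
        push_cast
        omega
      · rw [if_neg h1]
        have := hD.b_lt (N - (t + 1)) (by omega)
        rw [show N - (t + 1) + 1 = N - t by omega] at this
        exact_mod_cast this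
    · simp only [drawX]
      rw [if_neg (by omega), if_neg (by omega), if_pos hp0, Nat.sub_self, hD.a_zero, hD.b_zero]
    · simp only [drawY]
      rw [if_neg (by omega), if_neg (by omega), if_pos le_rfl]; simp
    · simp only [drawY]
      rw [if_neg (by omega), if_neg (by omega), if_neg (by omega), if_neg (by omega),
        if_pos (by omega)]
  have hbelow : ∀ i < p, ∀ t, p ≤ t → t < N → drawX N p X a b i ≤ drawX N p X a b t →
      drawX N p X a b (t + 1) ≤ drawX N p X a b (i + 1) → H (i + 1) + H (t + 1) < h := by
    intro i hi t ht ht' h1 h2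
    have := hD.rel i (by omega) (N - (t + 1)) (by omega) (fun h3 => ?_) (fun h3 => ?_)
    · rwa [Below, show N - (N - (t + 1)) = t + 1 by omega] at this
    · simp only [drawX] at h2
      rwa [if_neg (by omega), if_neg (by omega), if_pos (by omega)] at h2
    · simp only [drawX] at h1
      rw [if_pos hi, if_neg (by omega), if_neg (by omega)] at h1
      rwa [show N - (t + 1) + 1 = N - t by omega]
  -- `drawY` subtracts in `ℕ`, so labels must not exceed `h`. Each edge faces some edge of the other
  -- chain, and `Below` for that pair bounds both labels.
  have hlow : ∀ i < p, H (i + 1) < h := by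
    intro i hi
    obtain ⟨j, hj, h1, h2⟩ := exists_mem_interval (q := N - p)
      (b := fun j => (drawX N p X a b (N - j) : ℤ)) (x := drawX N p X a b i) (by omega)
      (by have := (F.frameVertex_mem i (by omega)).1; rw [← F.ξ_per] at this; exact this)
      (by rw [show N - (N - p) = p by omega]; exact (F.frameVertex_mem i (by omega)).2)
    have h3 := F.inc i hi
    have := hbelow i hi (N - (j + 1)) (by omega) (by omega) (by exact_mod_cast h2)
      (by rw [show N - (j + 1) + 1 = N - j by omega]; exact_mod_cast h1.trans h3.le)
    omega
  have hupp : ∀ t, p ≤ t → t < N → H (t + 1) < h := by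
    intro t ht ht'
    obtain ⟨i, hi, h1, h2⟩ := exists_mem_interval (q := p)
      (b := fun t => (drawX N p X a b t : ℤ)) (x := drawX N p X a b (t + 1)) (by omega)
      (F.frameVertex_mem (t + 1) (by omega)).1 (F.frameVertex_mem (t + 1) (by omega)).2
    have h3 := F.dec t ht ht'
    have := hbelow i hi t ht ht' (by exact_mod_cast h1.trans h3.le) (by exact_mod_cast h2)
    omega
  have hY1 : ∀ t, 0 < t → t ≤ p → drawY N p h H t = H t := by
    intro t h1 h2
    rw [drawY, if_neg (by omega), if_pos h2]
  have hY2 : ∀ t, p < t → t ≤ N → (drawY N p h H t : ℤ) = h - H t := by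
    intro t h1 h2
    have := hupp (t - 1) (by omega) (by omega)
    rw [Nat.sub_add_cancel (by omega)] at this
    rw [drawY, if_neg (by omega), if_neg (by omega), if_pos h2]
    omega
  refine ⟨F, ?_, ?_, ?_, ?_⟩
  · intro i hi t ht ht' h1 h2
    dsimp only at h1 h2
    have := hbelow i hi t ht ht' (by exact_mod_cast h1) (by exact_mod_cast h2)
    dsimp only
    rw [hY1 (i + 1) (by omega) (by omega), hY2 (t + 1) (by omega) (by omega)]
    omega
  · refine ⟨fun t h1 h2 h3 => ?_, fun t h1 h2 h3 => ?_, fun t h1 h2 h3 => ?_,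
      fun t h1 h2 h3 => ?_⟩
    · rw [hY1 t h1 h2.le, hY1 (t + 1) (by omega) h2]
      exact hH.labelling.left t h1 (by omega) h2.ne h3
    · rw [hY1 t h1 h2.le, hY1 (t + 1) (by omega) h2]
      exact hH.labelling.right t h1 (by omega) h2.ne h3
    · rw [hY2 t h1 h2.le, hY2 (t + 1) (by omega) h2]
      have := hH.labelling.left t (by omega) h2 h1.ne' h3
      omega
    · rw [hY2 t h1 h2.le, hY2 (t + 1) (by omega) h2]
      have := hH.labelling.right t (by omega) h2 h1.ne' h3
      omega
  · intro t ht
    have := (F.frameVertex_mem t ht).2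
    have h1 : drawX N p X a b p = X + 1 := by simp [drawX]
    rw [h1] at this
    exact_mod_cast this
  · intro t
    simp only [drawY]
    split_ifs with h1 h2 h3
    · omega
    · have := hlow (t - 1) (by omega)
      rw [Nat.sub_add_cancel (by omega)] at this
      omega
    · omega
    · have := hlow 0 hp0
      rw [Nat.zero_add] at this
      omega

theorem GridPolygon.boundingBoxArea_le {n w h : ℕ} (P : GridPolygon n) (hn : 0 < n)
    (H : ∀ i, (0 ≤ (P i).1 ∧ (P i).1 ≤ w) ∧ 0 ≤ (P i).2 ∧ (P i).2 ≤ h) :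
    P.boundingBoxArea ≤ w * h := by
  have : Nonempty (Fin n) := ⟨⟨0, hn⟩⟩
  have h1 : (⨆ i, (P i).1) ≤ (w : ℤ) := ciSup_le fun i => (H i).1.2
  have h2 : 0 ≤ ⨅ i, (P i).1 := le_ciInf fun i => (H i).1.1
  have h3 : (⨆ i, (P i).2) ≤ (h : ℤ) := ciSup_le fun i => (H i).2.2
  have h4 : 0 ≤ ⨅ i, (P i).2 := le_ciInf fun i => (H i).2.1
  have h5 : 0 ≤ P.height := by
    rw [height, sub_nonneg]
    exact (ciInf_le (Set.finite_range fun i => (P i).2).bddBelow ⟨0, hn⟩).trans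
      (le_ciSup (Set.finite_range fun i => (P i).2).bddAbove ⟨0, hn⟩)
  exact mul_le_mul (by rw [width]; omega) (by rw [height]; omega) h5 (by omega)

/-- A polygon drawn along a cheapest sequence of columns, for the height for which the area becomes
least, has minimum bounding box area. -/
theorem GridPolygon.realizesWithMinBoundingBox_of_draw {n N p r h X : ℕ} {S : AngleSequence n}
    {H a b : ℕ → ℕ} (P : GridPolygon n) (hn : 0 < n) (hN : n = 2 * N)
    (hT : Pattern N p (fun k => S (cycIdx hn r k)))
    (hH : LeastLabelling N p (fun k => S (cycIdx hn r k)) H)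
    (hD : Draw (Below N H h) (p - 1) (N - p - 1) X a b)
    (hmin : ∀ h', 0 < h' → h' ≤ 6 * N → colDist (Below N H h') n (p - 1) (N - p - 1) < n →
      h * (X + 1) ≤ h' * (colDist (Below N H h') n (p - 1) (N - p - 1) + 1))
    (hP : ∀ k < n, P.walk hn r k =
      ((drawX N p X a b (k / 2) : ℤ), (drawY N p h H ((k + 1) / 2) : ℤ))) :
    P.RealizesWithMinBoundingBox S := by
  obtain ⟨F, hs, hS, hX, hY⟩ := hD.exists_frame hT hH
  refine ⟨P.realizes_of_frame S hn hN r F hs hT hS hP, fun Q hQ => ?_⟩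
  obtain ⟨ξ, ζ, w, h0, F', hs', hS', hR, hA⟩ := hQ.exists_frame hn hN r hT
  obtain ⟨h', h1, h2, h3, h4⟩ := F'.exists_colDist_le hs' hS' hR hH n
  -- The distance is at most `N - 2`, hence below the cutoff `n` that stands for infinity.
  have h5 := hmin h' h1 h2 (by omega)
  have h6 : P.boundingBoxArea ≤ (X + 1 : ℕ) * h := by
    refine P.boundingBoxArea_le hn fun i => ?_
    obtain ⟨k, hk, rfl⟩ := exists_cycIdx hn r i
    have hk' : P (cycIdx hn r k) = _ := hP k hk
    rw [hk']
    have := hX (k / 2) (by omega)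
    have := hY ((k + 1) / 2)
    dsimp only
    omega
  rw [hA]
  refine h6.trans (le_trans ?_ h4)
  rw [mul_comm]
  exact_mod_cast h5

/-! ### Reasoning about programs -/

namespace RAM

variable {B : ℕ}

@[simp] theorem State.setReg_reg (s : State) (r v r' : ℕ) :
    (s.setReg r v).reg r' = if r' = r then v else s.reg r' := by
  simp [State.setReg, Function.update_apply]

@[simp] theorem State.setReg_arr (s : State) (r v : ℕ) : (s.setReg r v).arr = s.arr := rfl

@[simp] theorem State.setArr_reg (s : State) (a k v : ℕ) : (s.setArr a k v).reg = s.reg := rfl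

@[simp] theorem State.setArr_arr (s : State) (a k v a' k' : ℕ) :
    (s.setArr a k v).arr a' k' = if a' = a ∧ k' = k then v else s.arr a' k' := by
  by_cases h : a' = a
  · subst h; simp [State.setArr, Function.update_apply]
  · simp [State.setArr, h]

@[simp] theorem State.setArr_arr_of_ne (s : State) {a k v a' : ℕ} (h : a' ≠ a) :
    (s.setArr a k v).arr a' = s.arr a' := by
  simp [State.setArr, h]

/-- From the state `s`, the program `p` halts within time `T` in a state that satisfies `Q`. -/
def Runs (B : ℕ) (p : Program) (s : State) (T : ℕ) (Q : State → Prop) : Prop :=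
  ∃ s' t, Exec B p s s' t ∧ t ≤ T ∧ Q s'

/-- The result of a straight-line program. -/
def Program.run : Program → State → State
  | skip, s => s
  | setReg r e, s => s.setReg r (e.eval s)
  | setArr a k e, s => s.setArr a (k.eval s) (e.eval s)
  | seq p q, s => q.run (p.run s)
  | ite _ _ _, s => s
  | loop _ _, s => s

/-- All values that occur during the run of a straight-line program are at most `B`. -/
def Program.Fits (B : ℕ) : Program → State → Prop
  | skip, _ => True
  | setReg _ e, s => e.Fits B s
  | setArr _ k e, s => k.Fits B s ∧ e.Fits B s
  | seq p q, s => p.Fits B s ∧ q.Fits B (p.run s)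
  | ite _ _ _, _ => False
  | loop _ _, _ => False

/-- A time bound for a straight-line program. -/
def Program.cost : Program → ℕ
  | skip => 1
  | setReg _ e => e.cost + 1
  | setArr _ k e => k.cost + e.cost + 1
  | seq p q => p.cost + q.cost
  | ite _ _ _ => 0
  | loop _ _ => 0

theorem Program.Fits.exec {p : Program} {s : State} (h : p.Fits B s) :
    ∃ t ≤ p.cost, Exec B p s (p.run s) t := by
  induction p generalizing s with
  | skip => exact ⟨1, le_rfl, Exec.skip s⟩
  | setReg r e => exact ⟨_, le_rfl, Exec.setReg s r e h⟩
  | setArr a k e => exact ⟨_, le_rfl, Exec.setArr s a k e h.1 h.2⟩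
  | seq p q ihp ihq =>
    obtain ⟨t, ht, hp⟩ := ihp h.1
    obtain ⟨u, hu, hq⟩ := ihq h.2
    exact ⟨t + u, by simp only [cost]; omega, Exec.seq hp hq⟩
  | ite b p q _ _ => exact h.elim
  | loop b p _ => exact h.elim

namespace Runs

variable {p q : Program} {b : Test} {s : State} {T T' : ℕ} {Q Q' : State → Prop}

/-- Straight-line code is treated by symbolic evaluation, which avoids building execution
derivations by hand. -/
theorem straight (h : p.Fits B s) (hT : p.cost ≤ T) (hQ : Q (p.run s)) : Runs B p s T Q := by
  obtain ⟨t, ht, hp⟩ := h.exec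
  exact ⟨_, t, hp, ht.trans hT, hQ⟩

theorem mono (h : Runs B p s T Q) (hT : T ≤ T') (hQ : ∀ s', Q s' → Q' s') :
    Runs B p s T' Q' := by
  obtain ⟨s', t, h1, h2, h3⟩ := h
  exact ⟨s', t, h1, h2.trans hT, hQ s' h3⟩

theorem seq (h : Runs B p s T (fun s' => Runs B q s' T' Q)) :
    Runs B (Program.seq p q) s (T + T') Q := by
  obtain ⟨s', t, h1, h2, s'', u, h3, h4, h5⟩ := h
  exact ⟨s'', t + u, h1.seq h3, by omega, h5⟩

theorem ite (hf : b.Fits B s) (hT : b.cost + 1 + T ≤ T') (hp : b.Holds s → Runs B p s T Q)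
    (hq : ¬ b.Holds s → Runs B q s T Q) : Runs B (Program.ite b p q) s T' Q := by
  by_cases hb : b.Holds s
  · obtain ⟨s', t, h1, h2, h3⟩ := hp hb
    exact ⟨s', _, Exec.iteTrue hf hb h1, by omega, h3⟩
  · obtain ⟨s', t, h1, h2, h3⟩ := hq hb
    exact ⟨s', _, Exec.iteFalse hf hb h1, by omega, h3⟩

theorem skip (hT : 1 ≤ T) (hQ : Q s) : Runs B Program.skip s T Q := ⟨s, 1, Exec.skip s, hT, hQ⟩

theorem loop_stop (hf : b.Fits B s) (hb : ¬ b.Holds s) (hT : b.cost + 1 ≤ T) (hQ : Q s) :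
    Runs B (Program.loop b p) s T Q :=
  ⟨s, _, Exec.loopFalse hf hb, hT, hQ⟩

theorem loop_step (hf : b.Fits B s) (hb : b.Holds s)
    (h : Runs B p s T (fun s' => Runs B (Program.loop b p) s' T' Q)) :
    Runs B (Program.loop b p) s (b.cost + 1 + T + T') Q := by
  obtain ⟨s', t, h1, h2, s'', u, h3, h4, h5⟩ := h
  exact ⟨s'', _, Exec.loopTrue hf hb h1 h3, by omega, h5⟩

end Runs

/-- The loop `for i = 0, …, e - 1 do p`. -/
def forLoop (i : ℕ) (e : Expr) (p : Program) : Program :=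
  Program.seq (Program.setReg i (Expr.const 0))
    (Program.loop (Test.not (Test.le e (Expr.reg i)))
      (Program.seq p (Program.setReg i (Expr.add (Expr.reg i) (Expr.const 1)))))

/-- A Hoare rule with time. The invariant is indexed by the counter and has to hold again once the
counter is incremented; the summand `e.cost + 10` pays for the test and the increment. The counter
reaches `m` itself, which must still fit into a word. -/
theorem Runs.forLoop {i : ℕ} {e : Expr} {p : Program} {s : State} {m T : ℕ}
    (I : ℕ → State → Prop) (hm : m < B)
    (hreg : ∀ k s, I k s → s.reg i = k ∧ e.eval s = m ∧ e.Fits B s)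
    (hbody : ∀ k s, k < m → I k s →
      Runs B p s T (fun s' => s'.reg i = k ∧ I (k + 1) (s'.setReg i (k + 1))))
    (hs : I 0 (s.setReg i 0)) :
    Runs B (forLoop i e p) s (m * (T + (e.cost + 10)) + (e.cost + 10)) (I m) := by
  have key : ∀ d k s, k + d = m → I k s → Runs B (Program.loop (Test.not (Test.le e (Expr.reg i)))
      (Program.seq p (Program.setReg i (Expr.add (Expr.reg i) (Expr.const 1))))) s
      (d * (T + (e.cost + 10)) + (e.cost + 4)) (I m) := by
    intro d
    induction d with
    | zero =>
      intro k s hk hI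
      obtain rfl : k = m := hk
      obtain ⟨h1, h2, h3⟩ := hreg k s hI
      refine Runs.loop_stop ⟨h3, ?_⟩ ?_ ?_ hI
      · simp only [Expr.Fits]; omega
      · simp [Test.Holds, Expr.eval, h1, h2]
      · simp only [Test.cost, Expr.cost]; omega
    | succ d ih =>
      intro k s hk hI
      obtain ⟨h1, h2, h3⟩ := hreg k s hI
      have := Runs.loop_step (b := Test.not (Test.le e (Expr.reg i)))
        (p := Program.seq p (Program.setReg i (Expr.add (Expr.reg i) (Expr.const 1)))) (B := B)
        (s := s) (T := T + 4) (T' := d * (T + (e.cost + 10)) + (e.cost + 4)) (Q := I m)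
        ⟨h3, ?_⟩ ?_ ?_
      · refine this.mono ?_ (fun _ h => h)
        simp only [Test.cost, Expr.cost, Nat.add_mul, Nat.one_mul]
        omega
      · simp only [Expr.Fits]; omega
      · simp only [Test.Holds, Expr.eval, h1, h2]; omega
      · refine Runs.seq ((hbody k s (by omega) hI).mono le_rfl ?_)
        rintro s' ⟨h4, h5⟩
        refine Runs.straight ?_ (by simp [Program.cost, Expr.cost]) ?_
        · simp only [Program.Fits, Expr.Fits, Expr.eval]; omega
        · simp only [Program.run, Expr.eval, h4]
          exact ih (k + 1) _ (by omega) h5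
  refine Runs.mono (Runs.seq (T := 2) (Runs.straight ?_ (by simp [Program.cost, Expr.cost])
    (key m 0 _ (by omega) hs))) (by omega) (fun _ h => h)
  simp [Program.Fits, Expr.Fits]

end RAM

/-! ### Reading the input -/

namespace RAM

open RAM.Expr (const reg arr)
open RAM.Program (setReg setArr)

/-- Store half of the length in register `1`. -/
def halfLength : Program :=
  forLoop 4 (reg 0) (Program.ite
    (Test.le (Expr.add (Expr.mul (const 2) (reg 4)) (const 2)) (reg 0))
    (setReg 1 (Expr.add (reg 4) (const 1))) Program.skip)

/-- Write two copies of the turns into array `3`. -/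
def copyTurns : Program :=
  forLoop 4 (reg 0) (Program.seq
    (setArr 3 (reg 4) (arr 0 (reg 4)))
    (setArr 3 (Expr.add (reg 0) (reg 4)) (arr 0 (reg 4))))

variable {n N p r B : ℕ} {S : AngleSequence n} {s : State}

theorem encodeTurn_le_one (t : Turn) : encodeTurn t ≤ 1 := by cases t <;> simp [encodeTurn]

theorem encodeTurn_inj {t u : Turn} : encodeTurn t = encodeTurn u ↔ t = u := by
  cases t <;> cases u <;> simp [encodeTurn]

theorem encodeTurn_eq_zero {t : Turn} : encodeTurn t = 0 ↔ t = Turn.left := by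
  cases t <;> simp [encodeTurn]

theorem encodeTurn_eq_one {t : Turn} : encodeTurn t = 1 ↔ t = Turn.right := by
  cases t <;> simp [encodeTurn]

/-- Registers `0` and `1` hold the length and its half, and array `3` holds two copies of the
turns. -/
structure HasTurns (S : AngleSequence n) (hn : 0 < n) (N : ℕ) (s : State) : Prop where
  len : s.reg 0 = n
  half : s.reg 1 = N
  turns : ∀ l < 2 * n, s.arr 3 l = encodeTurn (S (cycIdx hn 0 l))

theorem HasTurns.of_eq {hn : 0 < n} (h : HasTurns S hn N s) {s' : State}
    (h0 : s'.reg 0 = s.reg 0) (h1 : s'.reg 1 = s.reg 1) (h3 : s'.arr 3 = s.arr 3) :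
    HasTurns S hn N s' :=
  ⟨h0.trans h.len, h1.trans h.half, h3 ▸ h.turns⟩

/-- The second copy of the turns replaces the reduction of `r + k` modulo `n`, which is not a
machine operation. -/
theorem HasTurns.turn {hn : 0 < n} (h : HasTurns S hn N s) {r k : ℕ} (hr : r < n) (hk : k < n) :
    s.arr 3 (r + k) = encodeTurn (S (cycIdx hn r k)) := by
  rw [h.turns (r + k) (by omega)]
  congr 2
  ext
  simp [cycIdx]

/-- Without division, the half is found as one more than the last `k` with `2 * k + 2 ≤ n`. -/
theorem runs_halfLength (hN : n = 2 * N) (hB : 1000 * (n * n) ≤ B) (hn : 0 < n)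
    (h0 : s.reg 0 = n) (h1 : s.reg 1 = 0) :
    Runs B halfLength s (n * 50 + 50)
      (fun s' => s'.reg 0 = n ∧ s'.reg 1 = N ∧ s'.arr = s.arr) := by
  have hnn : n ≤ n * n := Nat.le_mul_self n
  refine (Runs.forLoop (m := n) (T := 30) (fun k s' => s'.reg 4 = k ∧ s'.reg 0 = n ∧
    s'.reg 1 = min k N ∧ s'.arr = s.arr) (by omega) ?_ ?_ ?_).mono ?_ ?_
  · rintro k s' ⟨h1, h2, h3, h4⟩
    exact ⟨h1, h2, by simp only [Expr.Fits]; omega⟩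
  · rintro k s' hk ⟨h1, h2, h3, h4⟩
    refine Runs.ite (T := 10) ?_ (by decide) (fun h => ?_) (fun h => ?_)
    · simp only [Test.Fits, Expr.Fits, Expr.eval, h1, h2]
      omega
    · simp only [Test.Holds, Expr.eval, h1, h2] at h
      refine Runs.straight ?_ (by decide) ?_
      · simp only [Program.Fits, Expr.Fits, Expr.eval, h1]
        omega
      · simp [Program.run, Expr.eval, h1, h2, h4]
        omega
    · simp only [Test.Holds, Expr.eval, h1, h2] at h
      refine Runs.skip (by omega) ?_
      simp [h1, h2, h3, h4]
      omega
  · simp [h0, h1]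
  · simp only [Expr.cost]; omega
  · rintro s' ⟨h1, h2, h3, h4⟩
    exact ⟨h2, by omega, h4⟩

theorem runs_copyTurns (hB : 1000 * (n * n) ≤ B) (hn : 0 < n)
    (h0 : s.reg 0 = n) (h1 : s.reg 1 = N) (ha : s.arr = (input S).arr) :
    Runs B copyTurns s (n * 50 + 50) (HasTurns S hn N) := by
  have hnn : n ≤ n * n := Nat.le_mul_self n
  refine (Runs.forLoop (m := n) (T := 30) (fun k s' => s'.reg 4 = k ∧ s'.reg 0 = n ∧
    s'.reg 1 = N ∧ (∀ l, s'.arr 0 l = (input S).arr 0 l) ∧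
    ∀ l < k, s'.arr 3 l = (input S).arr 0 l ∧ s'.arr 3 (n + l) = (input S).arr 0 l)
    (by omega) ?_ ?_ ?_).mono ?_ ?_
  · rintro k s' ⟨h1, h2, h3, h4⟩
    exact ⟨h1, h2, by simp only [Expr.Fits]; omega⟩
  · rintro k s' hk ⟨h1, h2, h3, h4, h5⟩
    have h6 : s'.arr 0 k ≤ 1 := by
      rw [h4]
      simp [input, hk, encodeTurn_le_one]
    refine Runs.straight ?_ (by decide) ?_
    · simp only [Program.Fits, Expr.Fits, Expr.eval, Program.run, State.setArr_reg,
        State.setArr_arr, h1, h2]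
      simp
      omega
    · simp only [Program.run, Expr.eval, h1, h2, State.setReg_reg, State.setArr_reg,
        State.setReg_arr, State.setArr_arr]
      refine ⟨trivial, by simp, by simp, by simp [h3], by simp [h4], fun l hl => ?_⟩
      by_cases hlk : l = k
      · subst hlk
        simp [h4]
      · have := h5 l (by omega)
        simp [hlk, this, show l ≠ n + k by omega, show n + l ≠ k by omega]
  · simp [h0, h1, ha]
  · simp only [Expr.cost]; omega
  · rintro s' ⟨h1, h2, h3, h4, h5⟩
    refine ⟨h2, h3, fun l hl => ?_⟩
    have : ∀ l (hl : l < n), (input S).arr 0 l = encodeTurn (S ⟨l, hl⟩) := by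
      intro l hl
      simp [input, hl]
    by_cases hln : l < n
    · rw [(h5 l hln).1, this l hln]
      congr 2
      ext
      simp [cycIdx, Nat.mod_eq_of_lt hln]
    · obtain ⟨l, rfl⟩ := Nat.exists_eq_add_of_le (Nat.le_of_not_lt hln)
      rw [(h5 l (by omega)).2, this l (by omega)]
      congr 2
      ext
      simp [cycIdx, Nat.mod_eq_of_lt (show l < n by omega)]

/-! ### Finding the pattern -/

/-- Set register `5` to `0` if and only if the turns from register `2` on form a pattern with the
part of length given by register `3`. -/
def checkPattern : Program :=
  Program.seq
    (setReg 5 (Expr.add (Expr.add (arr 3 (reg 2)) (arr 3 (Expr.add (reg 2) (const 1))))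
      (Expr.add (arr 3 (Expr.add (reg 2) (Expr.mul (const 2) (reg 3))))
        (arr 3 (Expr.add (reg 2) (Expr.add (Expr.mul (const 2) (reg 3)) (const 1)))))))
    (Program.seq
      (Program.ite (Test.eq (reg 3) (const 0)) (setReg 5 (const 1)) Program.skip)
      (forLoop 4 (reg 1) (Program.ite
        (Test.and (Test.not (Test.eq (reg 4) (const 0)))
          (Test.and (Test.not (Test.eq (reg 4) (reg 3)))
            (Test.eq (arr 3 (Expr.add (reg 2) (Expr.mul (const 2) (reg 4))))
              (arr 3 (Expr.add (reg 2) (Expr.add (Expr.mul (const 2) (reg 4)) (const 1)))))))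
        (setReg 5 (const 1)) Program.skip)))

/-- Store the position and the size of a pattern in registers `6` and `7`. -/
def findPattern : Program :=
  forLoop 2 (reg 0) (forLoop 3 (reg 1) (Program.seq checkPattern
    (Program.ite (Test.eq (reg 5) (const 0))
      (Program.seq (setReg 6 (reg 2)) (setReg 7 (reg 3))) Program.skip)))

/-- A left turn has code `0`, so the sum of the four codes in register `5` vanishes iff all four
turns are left. Every other violation overwrites the register with `1`. -/
theorem runs_checkPattern {hn : 0 < n} (hN : n = 2 * N) (hB : 1000 * (n * n) ≤ B) (hr : r < n)
    (hp : p < N) (h : HasTurns S hn N s) (h2 : s.reg 2 = r) (h3 : s.reg 3 = p) :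
    Runs B checkPattern s (N * 50 + 100) (fun s' => HasTurns S hn N s' ∧ s'.reg 2 = r ∧
      s'.reg 3 = p ∧ s'.reg 6 = s.reg 6 ∧ s'.reg 7 = s.reg 7 ∧ s'.reg 5 ≤ 4 ∧
      (s'.reg 5 = 0 ↔ Pattern N p (fun k => S (cycIdx hn r k)))) := by
  have hnn : n ≤ n * n := Nat.le_mul_self n
  have ht0 := h.turn hr hn
  rw [Nat.add_zero] at ht0
  have ht1 := h.turn hr (show 1 < n by omega)
  have ht2 := h.turn hr (show 2 * p < n by omega)
  have ht3 := h.turn hr (show 2 * p + 1 < n by omega)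
  have hle := fun k => encodeTurn_le_one (S (cycIdx hn r k))
  have hle0 := hle 0
  have hle1 := hle 1
  have hle2 := hle (2 * p)
  have hle3 := hle (2 * p + 1)
  have main : ∀ s1 : State, HasTurns S hn N s1 → s1.reg 2 = r → s1.reg 3 = p → s1.reg 5 ≤ 4 →
      s1.reg 6 = s.reg 6 → s1.reg 7 = s.reg 7 → (s1.reg 5 = 0 ↔ (0 < p ∧
        S (cycIdx hn r 0) = Turn.left ∧ S (cycIdx hn r 1) = Turn.left ∧
        S (cycIdx hn r (2 * p)) = Turn.left ∧ S (cycIdx hn r (2 * p + 1)) = Turn.left)) →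
      Runs B (forLoop 4 (reg 1) (Program.ite
        (Test.and (Test.not (Test.eq (reg 4) (const 0)))
          (Test.and (Test.not (Test.eq (reg 4) (reg 3)))
            (Test.eq (arr 3 (Expr.add (reg 2) (Expr.mul (const 2) (reg 4))))
              (arr 3 (Expr.add (reg 2) (Expr.add (Expr.mul (const 2) (reg 4)) (const 1)))))))
        (setReg 5 (const 1)) Program.skip)) s1 (N * 50 + 40) (fun s' => HasTurns S hn N s' ∧
          s'.reg 2 = r ∧ s'.reg 3 = p ∧ s'.reg 6 = s.reg 6 ∧ s'.reg 7 = s.reg 7 ∧ s'.reg 5 ≤ 4 ∧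
          (s'.reg 5 = 0 ↔ Pattern N p (fun k => S (cycIdx hn r k)))) := by
    intro s1 g1 g2 g3 g4 g5 g6 g7
    refine (Runs.forLoop (m := N) (T := 34) (fun k s' => s'.reg 4 = k ∧ HasTurns S hn N s' ∧
      s'.reg 2 = r ∧ s'.reg 3 = p ∧ s'.reg 6 = s.reg 6 ∧ s'.reg 7 = s.reg 7 ∧ s'.reg 5 ≤ 4 ∧
      (s'.reg 5 = 0 ↔ ((0 < p ∧ S (cycIdx hn r 0) = Turn.left ∧ S (cycIdx hn r 1) = Turn.left ∧
        S (cycIdx hn r (2 * p)) = Turn.left ∧ S (cycIdx hn r (2 * p + 1)) = Turn.left) ∧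
        ∀ t < k, t ≠ 0 → t ≠ p →
          S (cycIdx hn r (2 * t)) ≠ S (cycIdx hn r (2 * t + 1)))))
      (by omega) ?_ ?_ ?_).mono ?_ ?_
    · rintro k s' ⟨h1, h2, h3, h4⟩
      exact ⟨h1, h2.half, by simp only [Expr.Fits]; rw [h2.half]; omega⟩
    · rintro k s' hk ⟨h1, h2, h3, h4, h5, h6, h8, h7⟩
      have ht2 := h2.turn hr (show 2 * k < n by omega)
      have ht3 := h2.turn hr (show 2 * k + 1 < n by omega)
      have hle2 := hle (2 * k)
      have hle3 := hle (2 * k + 1)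
      refine Runs.ite (T := 2) ?_ (by decide) (fun hc => ?_) (fun hc => ?_)
      · simp only [Test.Fits, Expr.Fits, Expr.eval, h1, h3, h4, ht2, ht3]
        omega
      · simp only [Test.Holds, Expr.eval, h1, h3, h4, ht2, ht3, encodeTurn_inj] at hc
        refine Runs.straight ?_ (by decide) ?_
        · simp only [Program.Fits, Expr.Fits]; omega
        refine ⟨by simp [Program.run, h1], by simp, h2.of_eq (by simp [Program.run])
          (by simp [Program.run]) (by simp [Program.run]), by simp [Program.run, h3],
          by simp [Program.run, h4], by simp [Program.run, h5], by simp [Program.run, h6],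
          by simp [Program.run, Expr.eval], ?_⟩
        simp only [State.setReg_reg, Program.run, Expr.eval]
        norm_num only
        simp only [if_true, one_ne_zero, if_false, false_iff, not_and, not_forall]
        intro _
        exact ⟨k, by omega, hc.1, hc.2.1, fun h => h hc.2.2⟩
      · simp only [Test.Holds, Expr.eval, h1, h3, h4, ht2, ht3, encodeTurn_inj] at hc
        refine Runs.skip (by omega) ⟨h1, by simp, h2.of_eq (by simp) (by simp) (by simp),
          by simp [h3], by simp [h4], by simp [h5], by simp [h6], by simp [h8], ?_⟩
        simp only [State.setReg_reg]
        norm_num only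
        simp only [if_false]
        rw [h7]
        refine and_congr_right fun _ => ⟨fun h8 t ht h9 h10 => ?_, fun h8 t ht => h8 t (by omega)⟩
        rcases Nat.lt_add_one_iff_lt_or_eq.1 ht with ht | rfl
        · exact h8 t ht h9 h10
        · intro h11
          exact hc ⟨h9, h10, h11⟩
    · refine ⟨by simp, g1.of_eq (by simp) (by simp) (by simp), by simp [g2], by simp [g3],
        by simp [g5], by simp [g6], by simp [g4], ?_⟩
      simpa using g7
    · simp only [Expr.cost]; omega
    · rintro s' ⟨h1, h2, h3, h4, h5, h6, h8, h7⟩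
      refine ⟨h2, h3, h4, h5, h6, h8, h7.trans ⟨?_, ?_⟩⟩
      · rintro ⟨⟨a1, a2, a3, a4, a5⟩, a6⟩
        exact ⟨a1, hp, a2, a3, a4, a5, fun t b1 b2 b3 => a6 t b2 (by omega) b3⟩
      · rintro ⟨a1, _, a2, a3, a4, a5, a6⟩
        exact ⟨⟨a1, a2, a3, a4, a5⟩, fun t b1 b2 b3 => a6 t (by omega) b1 b3⟩
  refine (Runs.seq (T := 30) (Runs.straight ?_ (by decide) (Runs.seq (T := 30)
    (Runs.ite (T := 2) ?_ (by decide) (fun hc =>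
      Runs.straight ?_ (by decide) (main _ ?_ ?_ ?_ ?_ ?_ ?_ ?_))
      (fun hc => Runs.skip (by omega) (main _ ?_ ?_ ?_ ?_ ?_ ?_ ?_)))))).mono
    (?_ : 30 + (30 + (N * 50 + 40)) ≤ _) (fun _ h => h)
  · simp only [Program.Fits, Expr.Fits, Expr.eval, h2, h3, ht0, ht1, ht2, ht3]
    omega
  · simp only [Program.run, Test.Fits, Expr.Fits, State.setReg_reg, h3]
    norm_num
    omega
  · simp only [Program.Fits, Expr.Fits]
    omega
  · exact h.of_eq (by simp [Program.run]) (by simp [Program.run]) (by simp [Program.run])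
  · simp [Program.run, h2]
  · simp [Program.run, h3]
  · simp [Program.run, Expr.eval]
  · simp [Program.run]
  · simp [Program.run]
  · simp [Test.Holds, Expr.eval, Program.run, h3] at hc
    simp [Program.run, Expr.eval, hc]
  · exact h.of_eq (by simp [Program.run]) (by simp [Program.run]) (by simp [Program.run])
  · simp [Program.run, h2]
  · simp [Program.run, h3]
  · simp only [Program.run, Expr.eval, State.setReg_reg, h2, h3, ht0, ht1, ht2, ht3, if_true]
    omega
  · simp [Program.run]
  · simp [Program.run]
  · simp [Test.Holds, Expr.eval, Program.run, h3] at hc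
    simp only [Program.run, Expr.eval, State.setReg_reg, h2, h3, ht0, ht1, ht2, ht3, if_true,
      Nat.add_eq_zero_iff, encodeTurn_eq_zero]
    have : 0 < p := by omega
    tauto
  · omega

/-- Exhaustive search: `n * N` candidates with a linear check each fit the cubic budget. Any pattern
will do, since the optimality argument works for each of them. -/
theorem runs_findPattern {hn : 0 < n} (hN : n = 2 * N) (hB : 1000 * (n * n) ≤ B)
    (h : HasTurns S hn N s)
    (hS : ∃ r < n, ∃ p < N, Pattern N p (fun k => S (cycIdx hn r k))) :
    Runs B findPattern s (n * (N * (N * 50 + 150) + 50) + 50) (fun s' => HasTurns S hn N s' ∧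
      s'.reg 6 < n ∧ Pattern N (s'.reg 7) (fun k => S (cycIdx hn (s'.reg 6) k))) := by
  have hnn : n ≤ n * n := Nat.le_mul_self n
  refine (Runs.forLoop (m := n) (T := N * (N * 50 + 150) + 30) (fun k s' => s'.reg 2 = k ∧
    HasTurns S hn N s' ∧ ((∃ r < k, ∃ p < N, Pattern N p (fun k => S (cycIdx hn r k))) →
      s'.reg 6 < n ∧ Pattern N (s'.reg 7) (fun k => S (cycIdx hn (s'.reg 6) k))))
    (by omega) ?_ ?_ ?_).mono ?_ ?_
  · rintro k s' ⟨h1, h2, h3⟩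
    exact ⟨h1, h2.len, by simp only [Expr.Fits]; rw [h2.len]; omega⟩
  · rintro r s' hr ⟨h1, h2, h3⟩
    refine (Runs.forLoop (m := N) (T := N * 50 + 120) (fun k s' => s'.reg 3 = k ∧ s'.reg 2 = r ∧
      HasTurns S hn N s' ∧ (((∃ r' < r, ∃ p < N, Pattern N p (fun k => S (cycIdx hn r' k))) ∨
        ∃ p < k, Pattern N p (fun k => S (cycIdx hn r k))) →
        s'.reg 6 < n ∧ Pattern N (s'.reg 7) (fun k => S (cycIdx hn (s'.reg 6) k))))
      (by omega) ?_ ?_ ?_).mono ?_ ?_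
    · rintro k s' ⟨h1, h2, h3, h4⟩
      exact ⟨h1, h3.half, by simp only [Expr.Fits]; rw [h3.half]; omega⟩
    · rintro p s1 hp ⟨h4, h5, h6, h7⟩
      refine (Runs.seq (T' := 20) ((runs_checkPattern hN hB hr hp h6 h5 h4).mono le_rfl ?_)).mono
        (by omega) (fun _ h => h)
      rintro s2 ⟨g1, g2, g3, g4, g5, g7, g6⟩
      refine Runs.ite (T := 10) ?_ (by decide) (fun hc => ?_) (fun hc => ?_)
      · simp only [Test.Fits, Expr.Fits]
        omega
      · simp only [Test.Holds, Expr.eval, g6] at hc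
        refine Runs.straight ?_ (by decide) ?_
        · simp only [Program.Fits, Expr.Fits, Program.run, Expr.eval, State.setReg_reg, g2]
          norm_num
          omega
        · refine ⟨by simp [Program.run, g3], by simp, by simp [Program.run, g2],
            g1.of_eq (by simp [Program.run]) (by simp [Program.run]) (by simp [Program.run]),
            fun _ => ?_⟩
          simp [Program.run, Expr.eval, g2, g3, hr, hc]
      · simp only [Test.Holds, Expr.eval, g6] at hc
        refine Runs.skip (by omega) ⟨g3, by simp, by simp [g2],
          g1.of_eq (by simp) (by simp) (by simp), fun h8 => ?_⟩
        have := h7 (h8.imp_right ?_)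
        · simpa [g4, g5] using this
        · rintro ⟨p', h9, h10⟩
          refine ⟨p', (Nat.lt_add_one_iff_lt_or_eq.1 h9).resolve_right ?_, h10⟩
          rintro rfl
          exact hc h10
    · refine ⟨by simp, by simp [h1], h2.of_eq (by simp) (by simp) (by simp), ?_⟩
      simpa using h3
    · simp only [Expr.cost]
      have : N * (N * 50 + 120 + (1 + 10)) ≤ N * (N * 50 + 150) :=
        Nat.mul_le_mul_left N (by omega)
      omega
    · rintro s1 ⟨h4, h5, h6, h7⟩
      refine ⟨h5, by simp, h6.of_eq (by simp) (by simp) (by simp), ?_⟩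
      rintro ⟨r', h8, h9⟩
      have := h7 (by
        rcases Nat.lt_add_one_iff_lt_or_eq.1 h8 with h8 | rfl
        · exact Or.inl ⟨r', h8, h9⟩
        · obtain ⟨p, _, h9⟩ := h9
          exact Or.inr ⟨p, ‹_›, h9⟩)
      simpa using this
  · refine ⟨by simp, h.of_eq (by simp) (by simp) (by simp), ?_⟩
    simp
  · simp only [Expr.cost]
    generalize N * (N * 50 + 150) = A
    have : n * (A + 30 + (1 + 10)) ≤ n * (A + 50) := Nat.mul_le_mul_left n (by omega)
    omega
  · rintro s' ⟨h1, h2, h3⟩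
    exact ⟨h2, h3 hS⟩

end RAM

/-! ### Computing the heights -/

open Classical in
/-- The number of steps that go up to the `t`-th edge immediately before it. -/
noncomputable def climb (p : ℕ) (T : ℕ → Turn) : ℕ → ℕ
  | 0 => 0
  | t + 1 => if t ≠ 0 ∧ t ≠ p ∧ T (2 * t) = Turn.left then climb p T t + 1 else 0

open Classical in
/-- The least label of the edge `N - m`. -/
noncomputable def reverseLabel (N p : ℕ) (T : ℕ → Turn) : ℕ → ℕ
  | 0 => climb p T N
  | m + 1 =>
    if T (2 * (N - 1 - m)) = Turn.right then
      max (climb p T (N - 1 - m)) (reverseLabel N p T m + 1)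
    else climb p T (N - 1 - m)

/-- The least label of the edge `t`. -/
noncomputable def leastLabel (N p : ℕ) (T : ℕ → Turn) (t : ℕ) : ℕ := reverseLabel N p T (N - t)

theorem climb_le_reverseLabel (N p : ℕ) (T : ℕ → Turn) (m : ℕ) :
    climb p T (N - m) ≤ reverseLabel N p T m := by
  rcases m with _ | m
  · simp [reverseLabel]
  · rw [reverseLabel, show N - (m + 1) = N - 1 - m by omega]
    split_ifs
    · exact le_max_left _ _
    · exact le_rfl

theorem climb_le (p : ℕ) (T : ℕ → Turn) (t : ℕ) : climb p T t ≤ t := by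
  induction t with
  | zero => simp [climb]
  | succ t ih => rw [climb]; split_ifs <;> omega

theorem reverseLabel_le (N p : ℕ) (T : ℕ → Turn) (m : ℕ) : reverseLabel N p T m ≤ N + m := by
  induction m with
  | zero => simpa [reverseLabel] using climb_le p T N
  | succ m ih =>
    have := climb_le p T (N - 1 - m)
    rw [reverseLabel]
    split_ifs <;> omega

/-- An edge is forced up by the run of ascending steps that ends at it and by the run of descending
steps that starts at it; the longer run is its least label. Two passes compute the two runs, and
chaining strict inequalities along a run gives minimality. -/
theorem leastLabelling_leastLabel {N p : ℕ} {T : ℕ → Turn} (hT : Pattern N p T) :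
    LeastLabelling N p T (leastLabel N p T) := by
  refine ⟨⟨fun t h0 hN hp h => ?_, fun t h0 hN hp h => ?_⟩, fun G hG h0 => ?_, fun t h0 hN => ?_⟩
  · have h1 := climb_le_reverseLabel N p T (N - (t + 1))
    rw [show N - (N - (t + 1)) = t + 1 by omega, climb, if_pos ⟨h0.ne', hp, h⟩] at h1
    have h2 : leastLabel N p T t = climb p T t := by
      rw [leastLabel, show N - t = N - (t + 1) + 1 by omega, reverseLabel,
        show N - 1 - (N - (t + 1)) = t by omega, if_neg (by rw [h]; simp)]
    rw [h2, leastLabel]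
    omega
  · have h2 : leastLabel N p T (t + 1) + 1 ≤ leastLabel N p T t := by
      rw [leastLabel, leastLabel, show N - t = N - (t + 1) + 1 by omega, reverseLabel,
        show N - 1 - (N - (t + 1)) = t by omega, if_pos h]
      exact le_max_right _ _
    omega
  · have hc : ∀ t, 0 < t → t ≤ N → (climb p T t : ℤ) ≤ G t := by
      intro t
      induction t with
      | zero => omega
      | succ t ih =>
        intro _ ht
        rw [climb]
        split_ifs with hif
        · have h1 := ih (by omega) (by omega)
          have h2 := hG.left t (by omega) (by omega) hif.2.1 hif.2.2
          push_cast
          omega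
        · exact h0 _ (by omega) ht
    have hr : ∀ m < N, (reverseLabel N p T m : ℤ) ≤ G (N - m) := by
      intro m
      induction m with
      | zero => intro hN; exact hc N hN le_rfl
      | succ m ih =>
        intro hm
        have h1 := ih (by omega)
        have h2 := hc (N - 1 - m) (by omega) (by omega)
        rw [reverseLabel, show N - (m + 1) = N - 1 - m by omega]
        split_ifs with hif
        -- Unlike `climb`, the backward recursion needs no reset at `p`: turn `2 * p` is left, so
        -- nothing propagates across it.
        · have hp : N - 1 - m ≠ p := by
            intro hp
            rw [hp, hT.two_p] at hif
            cases hif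
          have h3 := hG.right (N - 1 - m) (by omega) (by omega) hp hif
          rw [show N - 1 - m + 1 = N - m by omega] at h3
          push_cast
          omega
        · exact h2
    intro t ht htN
    have := hr (N - t) (by omega)
    rwa [show N - (N - t) = t by omega] at this
  · have := reverseLabel_le N p T (N - t)
    rw [leastLabel]
    omega

namespace RAM

open RAM.Expr (const reg arr)
open RAM.Program (setReg setArr)

variable {n N p r B : ℕ} {S : AngleSequence n} {s : State}

/-- Besides the turns, registers `6` and `7` hold the position and the size of a pattern. -/
structure HasPattern (S : AngleSequence n) (hn : 0 < n) (N r p : ℕ) (s : State) : Prop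
    extends HasTurns S hn N s where
  pos : s.reg 6 = r
  size : s.reg 7 = p

theorem HasPattern.of_eq {hn : 0 < n} (h : HasPattern S hn N r p s) {s' : State}
    (h0 : s'.reg 0 = s.reg 0) (h1 : s'.reg 1 = s.reg 1) (h6 : s'.reg 6 = s.reg 6)
    (h7 : s'.reg 7 = s.reg 7) (h3 : s'.arr 3 = s.arr 3) : HasPattern S hn N r p s' :=
  ⟨h.toHasTurns.of_eq h0 h1 h3, h6.trans h.pos, h7.trans h.size⟩

/-- Write the numbers `climb` into array `4`. -/
def forwardHeights : Program :=
  forLoop 4 (reg 1) (Program.ite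
    (Test.and (Test.not (Test.eq (reg 4) (const 0)))
      (Test.and (Test.not (Test.eq (reg 4) (reg 7)))
        (Test.eq (arr 3 (Expr.add (reg 6) (Expr.mul (const 2) (reg 4)))) (const 0))))
    (setArr 4 (Expr.add (reg 4) (const 1)) (Expr.add (arr 4 (reg 4)) (const 1)))
    (setArr 4 (Expr.add (reg 4) (const 1)) (const 0)))

/-- The index of the edge that a downward loop has reached. -/
def revIndex : Expr := Expr.sub (Expr.sub (reg 1) (const 1)) (reg 4)

/-- Replace the numbers `climb` in array `4` by the least labels. -/
def backwardHeights : Program :=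
  forLoop 4 (Expr.sub (reg 1) (const 1)) (Program.ite
    (Test.eq (arr 3 (Expr.add (reg 6) (Expr.mul (const 2) revIndex))) (const 1))
    (setArr 4 revIndex (Expr.add (arr 4 revIndex)
      (Expr.sub (Expr.add (arr 4 (Expr.add revIndex (const 1))) (const 1)) (arr 4 revIndex))))
    Program.skip)

theorem runs_forwardHeights {hn : 0 < n} (hN : n = 2 * N) (hB : 1000 * (n * n) ≤ B) (hr : r < n)
    (hp : p < N) (h : HasPattern S hn N r p s) :
    Runs B forwardHeights s (n * 50 + 50) (fun s' => HasPattern S hn N r p s' ∧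
      ∀ t, 0 < t → t ≤ N → s'.arr 4 t = climb p (fun k => S (cycIdx hn r k)) t) := by
  have hnn : n ≤ n * n := Nat.le_mul_self n
  refine (Runs.forLoop (m := N) (T := 30) (fun k s' => s'.reg 4 = k ∧ HasPattern S hn N r p s' ∧
    ∀ t, 0 < t → t ≤ k → s'.arr 4 t = climb p (fun k => S (cycIdx hn r k)) t)
    (by omega) ?_ ?_ ?_).mono ?_ ?_
  · rintro k s' ⟨h1, h2, h3⟩
    exact ⟨h1, h2.half, by simp only [Expr.Fits]; rw [h2.half]; omega⟩
  · rintro k s' hk ⟨h1, h2, h3⟩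
    have ht := h2.turn hr (show 2 * k < n by omega)
    have hle := encodeTurn_le_one (S (cycIdx hn r (2 * k)))
    have hpos := h2.pos
    have hsize := h2.size
    refine Runs.ite (T := 10) ?_ (by decide) (fun hc => ?_) (fun hc => ?_)
    · simp only [Test.Fits, Expr.Fits, Expr.eval, h1, hpos, hsize, ht]
      omega
    · simp only [Test.Holds, Expr.eval, h1, hpos, hsize, ht, encodeTurn_eq_zero] at hc
      have h4 := h3 k (by omega) le_rfl
      have h5 := climb_le p (fun k => S (cycIdx hn r k)) k
      refine Runs.straight ?_ (by decide) ?_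
      · simp only [Program.Fits, Expr.Fits, Expr.eval, h1, h4]
        omega
      · refine ⟨by simp [Program.run, h1], by simp, h2.of_eq (by simp [Program.run])
          (by simp [Program.run]) (by simp [Program.run]) (by simp [Program.run])
          (by simp [Program.run]), fun t h6 h7 => ?_⟩
        simp only [Program.run, State.setReg_arr, State.setArr_arr, Expr.eval, h1, true_and]
        split_ifs with h8
        · rw [h8, h4, climb, if_pos ⟨hc.1, hc.2.1, hc.2.2⟩]
        · exact h3 t h6 (by omega)
    · simp only [Test.Holds, Expr.eval, h1, hpos, hsize, ht, encodeTurn_eq_zero] at hc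
      refine Runs.straight ?_ (by decide) ?_
      · simp only [Program.Fits, Expr.Fits, Expr.eval, h1]
        omega
      · refine ⟨by simp [Program.run, h1], by simp, h2.of_eq (by simp [Program.run])
          (by simp [Program.run]) (by simp [Program.run]) (by simp [Program.run])
          (by simp [Program.run]), fun t h6 h7 => ?_⟩
        simp only [Program.run, State.setReg_arr, State.setArr_arr, Expr.eval, h1, true_and]
        split_ifs with h8
        · rw [h8, climb, if_neg (fun hc' => hc hc')]
        · exact h3 t h6 (by omega)
  · exact ⟨by simp, h.of_eq (by simp) (by simp) (by simp) (by simp) (by simp), by omega⟩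
  · simp only [Expr.cost]; omega
  · rintro s' ⟨h1, h2, h3⟩
    exact ⟨h2, h3⟩

/-- The pass works in place: cells from `N - k` on are final, the others still hold `climb`. The
maximum of `x` and `y` is evaluated as `x + (y - x)` with truncated subtraction. -/
theorem runs_backwardHeights {hn : 0 < n} (hN : n = 2 * N) (hB : 1000 * (n * n) ≤ B) (hr : r < n)
    (hp : p < N) (h : HasPattern S hn N r p s)
    (hs : ∀ t, 0 < t → t ≤ N → s.arr 4 t = climb p (fun k => S (cycIdx hn r k)) t) :
    Runs B backwardHeights s (n * 100 + 50) (fun s' => HasPattern S hn N r p s' ∧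
      ∀ t, 0 < t → t ≤ N → s'.arr 4 t = leastLabel N p (fun k => S (cycIdx hn r k)) t) := by
  have hnn : n ≤ n * n := Nat.le_mul_self n
  set T : ℕ → Turn := fun k => S (cycIdx hn r k) with hT
  refine (Runs.forLoop (m := N - 1) (T := 80) (fun k s' => s'.reg 4 = k ∧
    HasPattern S hn N r p s' ∧ ∀ t, 0 < t → t ≤ N → s'.arr 4 t =
      if N - k ≤ t then leastLabel N p T t else climb p T t)
    (by omega) ?_ ?_ ?_).mono ?_ ?_
  · rintro k s' ⟨h1, h2, h3⟩
    have := h2.half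
    exact ⟨h1, by simp [Expr.eval, this], by simp only [Expr.Fits]; omega⟩
  · rintro k s' hk ⟨h1, h2, h3⟩
    have ht := h2.turn hr (show 2 * (N - 1 - k) < n by omega)
    have hle := encodeTurn_le_one (S (cycIdx hn r (2 * (N - 1 - k))))
    have hpos := h2.pos
    have hhalf := h2.half
    have hlabel : leastLabel N p T (N - 1 - k) = reverseLabel N p T (k + 1) := by
      rw [leastLabel, show N - (N - 1 - k) = k + 1 by omega]
    refine Runs.ite (T := 60) ?_ (by decide) (fun hc => ?_) (fun hc => ?_)
    · simp only [Test.Fits, Expr.Fits, Expr.eval, revIndex, h1, hpos, hhalf, ht]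
      omega
    · simp only [Test.Holds, Expr.eval, revIndex, h1, hpos, hhalf, ht, encodeTurn_eq_one] at hc
      have h4 := h3 (N - 1 - k) (by omega) (by omega)
      rw [if_neg (by omega)] at h4
      have h5 := h3 (N - 1 - k + 1) (by omega) (by omega)
      rw [if_pos (by omega), leastLabel, show N - (N - 1 - k + 1) = k by omega] at h5
      have h6 := climb_le p T (N - 1 - k)
      have h7 := reverseLabel_le N p T k
      refine Runs.straight ?_ (by decide) ?_
      · simp only [Program.Fits, Expr.Fits, Expr.eval, revIndex, h1, hhalf, h4, h5]
        omega
      · refine ⟨by simp [Program.run, h1], by simp, h2.of_eq (by simp [Program.run])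
          (by simp [Program.run]) (by simp [Program.run]) (by simp [Program.run])
          (by simp [Program.run]), fun t h8 h9 => ?_⟩
        simp only [Program.run, State.setReg_arr, State.setArr_arr, Expr.eval, revIndex, h1, hhalf,
          true_and]
        by_cases h10 : t = N - 1 - k
        · rw [if_pos h10, if_pos (by omega), h10, h4, h5, hlabel, reverseLabel, if_pos hc]
          omega
        · rw [if_neg h10, h3 t h8 h9]
          by_cases h11 : N - k ≤ t
          · rw [if_pos h11, if_pos (by omega)]
          · rw [if_neg h11, if_neg (by omega)]
    · simp only [Test.Holds, Expr.eval, revIndex, h1, hpos, hhalf, ht, encodeTurn_eq_one] at hc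
      refine Runs.skip (by omega) ⟨h1, by simp, h2.of_eq (by simp) (by simp) (by simp) (by simp)
        (by simp), fun t h8 h9 => ?_⟩
      rw [State.setReg_arr, h3 t h8 h9]
      by_cases h10 : t = N - 1 - k
      · rw [if_neg (by omega), if_pos (by omega), h10, hlabel, reverseLabel, if_neg hc]
      · by_cases h11 : N - k ≤ t
        · rw [if_pos h11, if_pos (by omega)]
        · rw [if_neg h11, if_neg (by omega)]
  · refine ⟨by simp, h.of_eq (by simp) (by simp) (by simp) (by simp) (by simp), fun t h1 h2 => ?_⟩
    rw [State.setReg_arr, hs t h1 h2]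
    split_ifs with h3
    · obtain rfl : t = N := by omega
      rw [leastLabel, Nat.sub_self, reverseLabel]
    · rfl
  · simp only [Expr.cost]; omega
  · rintro s' ⟨h1, h2, h3⟩
    refine ⟨h2, fun t h4 h5 => ?_⟩
    rw [h3 t h4 h5, if_pos (by omega)]

end RAM

/-! ### Computing the table of column distances -/

/-- Below `K` the cutoff is inactive, so some predecessor attains the minimum. This inverts the
recursion and drives the traceback. -/
theorem colDist_cases {c : ℕ → ℕ → Prop} {K i j : ℕ} (h : colDist c K i j < K) :
    c i j ∧ ((i = 0 ∧ j = 0 ∧ colDist c K i j = 0) ∨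
      (∃ i', i = i' + 1 ∧ colDist c K i' j + 1 = colDist c K i j) ∨
      (∃ j', j = j' + 1 ∧ colDist c K i j' + 1 = colDist c K i j) ∨
      ∃ i' j', i = i' + 1 ∧ j = j' + 1 ∧ c i' j ∧ c i j' ∧
        colDist c K i' j' + 1 = colDist c K i j) := by
  rcases i with _ | i <;> rcases j with _ | j
  · rw [colDist] at h ⊢
    split_ifs at h ⊢ with h1
    · exact ⟨h1, Or.inl ⟨rfl, rfl, rfl⟩⟩
    · omega
  · have he : colDist c K 0 (j + 1) = _ := colDist.eq_3 c K j
    split_ifs at he with h1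
    · exact ⟨h1, Or.inr (Or.inr (Or.inl ⟨j, rfl, by omega⟩))⟩
    · omega
  · have he : colDist c K (i + 1) 0 = _ := colDist.eq_2 c K i
    split_ifs at he with h1
    · exact ⟨h1, Or.inr (Or.inl ⟨i, rfl, by omega⟩)⟩
    · omega
  · have he : colDist c K (i + 1) (j + 1) = _ := colDist.eq_4 c K i j
    split_ifs at he with h1 h2
    · refine ⟨h1, Or.inr ?_⟩
      by_cases h3 : colDist c K i (j + 1) + 1 = colDist c K (i + 1) (j + 1)
      · exact Or.inl ⟨i, rfl, h3⟩
      by_cases h4 : colDist c K (i + 1) j + 1 = colDist c K (i + 1) (j + 1)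
      · exact Or.inr (Or.inl ⟨j, rfl, h4⟩)
      exact Or.inr (Or.inr ⟨i, j, rfl, rfl, h2.1, h2.2, by omega⟩)
    · refine ⟨h1, Or.inr ?_⟩
      by_cases h3 : colDist c K i (j + 1) + 1 = colDist c K (i + 1) (j + 1)
      · exact Or.inl ⟨i, rfl, h3⟩
      exact Or.inr (Or.inl ⟨j, rfl, by omega⟩)
    · omega

namespace RAM

open RAM.Expr (const reg arr)
open RAM.Program (setReg setArr)

variable {n N p r B k b : ℕ} {S : AngleSequence n} {H : ℕ → ℕ} {s : State}

/-- Besides the pattern, array `4` holds the labels `H`, register `8` holds one less than the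
current height, and register `11` holds the least area found so far. -/
structure Stage (S : AngleSequence n) (hn : 0 < n) (N r p : ℕ) (H : ℕ → ℕ) (k b : ℕ) (s : State) :
    Prop extends HasPattern S hn N r p s where
  labels : ∀ t, 0 < t → t ≤ N → s.arr 4 t = H t
  height : s.reg 8 = k
  best : s.reg 11 = b

theorem Stage.of_eq {hn : 0 < n} (h : Stage S hn N r p H k b s) {s' : State}
    (h0 : s'.reg 0 = s.reg 0) (h1 : s'.reg 1 = s.reg 1) (h6 : s'.reg 6 = s.reg 6)
    (h7 : s'.reg 7 = s.reg 7) (h8 : s'.reg 8 = s.reg 8) (h11 : s'.reg 11 = s.reg 11)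
    (h3 : s'.arr 3 = s.arr 3) (h4 : s'.arr 4 = s.arr 4) : Stage S hn N r p H k b s' :=
  ⟨h.toHasPattern.of_eq h0 h1 h6 h7 h3, h4 ▸ h.labels, h8.trans h.height, h11.trans h.best⟩

/-- The test whether a lower edge is below an upper edge. -/
def belowTest (i j : Expr) : Test :=
  Test.le (Expr.add (arr 4 (Expr.add i (const 1))) (arr 4 (Expr.sub (reg 1) j))) (reg 8)

/-- The table entry of a pair of edges. -/
def entry (i j : Expr) : Expr := arr 5 (Expr.add (Expr.mul i (reg 1)) j)

/-- The minimum of two numbers. -/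
def minExpr (e f : Expr) : Expr := Expr.sub e (Expr.sub e f)

theorem eval_minExpr (e f : Expr) (s : State) :
    (minExpr e f).eval s = min (e.eval s) (f.eval s) := by
  simp only [minExpr, Expr.eval]
  omega

/-- Set the current table entry. -/
def setEntry (e : Expr) : Program := setArr 5 (Expr.add (Expr.mul (reg 9) (reg 1)) (reg 10)) e

/-- The predecessor of the number in a register. -/
def predReg (i : ℕ) : Expr := Expr.sub (reg i) (const 1)

/-- Compute the current table entry. -/
def computeEntry : Program :=
  Program.ite (belowTest (reg 9) (reg 10))
    (Program.ite (Test.eq (reg 9) (const 0))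
      (Program.ite (Test.eq (reg 10) (const 0))
        (setEntry (const 0))
        (setEntry (minExpr (reg 0) (Expr.add (entry (reg 9) (predReg 10)) (const 1)))))
      (Program.ite (Test.eq (reg 10) (const 0))
        (setEntry (minExpr (reg 0) (Expr.add (entry (predReg 9) (reg 10)) (const 1))))
        (Program.ite (Test.and (belowTest (predReg 9) (reg 10)) (belowTest (reg 9) (predReg 10)))
          (setEntry (minExpr (reg 0) (Expr.add (minExpr (entry (predReg 9) (predReg 10))
            (minExpr (entry (reg 9) (predReg 10)) (entry (predReg 9) (reg 10)))) (const 1))))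
          (setEntry (minExpr (reg 0) (Expr.add
            (minExpr (entry (reg 9) (predReg 10)) (entry (predReg 9) (reg 10))) (const 1)))))))
    (setEntry (reg 0))

/-- Compute the table of column distances. -/
def computeTable : Program :=
  forLoop 9 (reg 7) (forLoop 10 (Expr.sub (reg 1) (reg 7)) computeEntry)

/-- Register `8` holds the height minus one, which turns the strict inequality of `Below` into `≤`.
-/
theorem Stage.belowTest {hn : 0 < n} (h : Stage S hn N r p H k b s) (hN : n = 2 * N)
    (hB : 1000 * (n * n) ≤ B) (hH : ∀ t, 0 < t → t ≤ N → H t ≤ n) (hk : k < 3 * n)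
    (ei ej : Expr) (hi : ei.Fits B s) (hj : ej.Fits B s) (hi' : ei.eval s < N)
    (hj' : ej.eval s < N) :
    (belowTest ei ej).Fits B s ∧
      ((belowTest ei ej).Holds s ↔ Below N H (k + 1) (ei.eval s) (ej.eval s)) := by
  have hnn : n ≤ n * n := Nat.le_mul_self n
  have h1 := h.half
  have h2 := h.height
  have h3 := h.labels (ei.eval s + 1) (by omega) (by omega)
  have h4 := h.labels (N - ej.eval s) (by omega) (by omega)
  have h5 := hH (ei.eval s + 1) (by omega) (by omega)
  have h6 := hH (N - ej.eval s) (by omega) (by omega)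
  refine ⟨?_, ?_⟩
  · simp only [RAM.belowTest, Test.Fits, Expr.Fits, Expr.eval, h1, h2, h3, h4]
    exact ⟨⟨⟨⟨hi, by omega, by omega⟩, by omega⟩, ⟨⟨by omega, hj⟩, by omega⟩, by omega⟩, by omega⟩
  · simp only [RAM.belowTest, Test.Holds, Expr.eval, h1, h2, h3, h4, Below]
    omega

/-- The recursion looks only at the previous row and at the previous entry of the same row, so
filling row by row suffices. A row occupies `N` cells. -/
theorem runs_computeEntry {hn : 0 < n} (hN : n = 2 * N) (hB : 1000 * (n * n) ≤ B) (hp : p < N)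
    (hH : ∀ t, 0 < t → t ≤ N → H t ≤ n) (hk : k < 3 * n) (h : Stage S hn N r p H k b s)
    {i j : ℕ} (hi : i < p) (hj : j < N - p) (h9 : s.reg 9 = i) (h10 : s.reg 10 = j)
    (hrows : ∀ i' < i, ∀ j' < N - p,
      s.arr 5 (i' * N + j') = colDist (Below N H (k + 1)) n i' j')
    (hrow : ∀ j' < j, s.arr 5 (i * N + j') = colDist (Below N H (k + 1)) n i j') :
    Runs B computeEntry s 150
      (fun s' => s' = s.setArr 5 (i * N + j) (colDist (Below N H (k + 1)) n i j)) := by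
  have hnn : n ≤ n * n := Nat.le_mul_self n
  have h0 := h.len
  have h1 := h.half
  have hle := colDist_le_bound (Below N H (k + 1)) n
  have hmul : ∀ i' < N, i' * N ≤ n * n := fun i' h' => Nat.mul_le_mul (by omega) (by omega)
  have hiN := hmul i (by omega)
  have hbelow := h.belowTest hN hB hH hk
  obtain ⟨f1, e1⟩ := hbelow (reg 9) (reg 10) (by simp only [Expr.Fits]; omega)
    (by simp only [Expr.Fits]; omega) (by simp only [Expr.eval]; omega)
    (by simp only [Expr.eval]; omega)
  simp only [Expr.eval, h9, h10] at e1
  refine Runs.ite (T := 130) f1 (by decide) (fun c1 => ?_) (fun c1 => ?_) <;> rw [e1] at c1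
  · refine Runs.ite (T := 120) ?_ (by decide) (fun c2 => ?_) (fun c2 => ?_)
    · simp only [Test.Fits, Expr.Fits]; omega
    all_goals simp only [Test.Holds, Expr.eval, h9] at c2
    · refine Runs.ite (T := 110) ?_ (by decide) (fun c3 => ?_) (fun c3 => ?_)
      · simp only [Test.Fits, Expr.Fits]; omega
      all_goals simp only [Test.Holds, Expr.eval, h10] at c3
      · subst c2 c3
        refine Runs.straight ?_ (by decide) ?_
        · simp only [setEntry, Program.Fits, Expr.Fits, Expr.eval, h9, h10, h1]
          omega
        · simp only [setEntry, Program.run, Expr.eval, h9, h10, h1]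
          rw [colDist, if_pos c1]
      · obtain ⟨j, rfl⟩ : ∃ l, j = l + 1 := ⟨j - 1, by omega⟩
        subst c2
        have d1 := hrow j (by omega)
        have l1 := hle 0 j
        refine Runs.straight ?_ (by decide) ?_
        · simp only [setEntry, predReg, entry, minExpr, Program.Fits, Expr.Fits, Expr.eval, h9, h10,
            h1, h0, Nat.add_sub_cancel, d1]
          omega
        · simp only [setEntry, Program.run, eval_minExpr]
          simp only [predReg, entry, Expr.eval, h9, h10, h1, h0, Nat.add_sub_cancel, d1]
          rw [colDist.eq_3, if_pos c1]
    · obtain ⟨i, rfl⟩ : ∃ l, i = l + 1 := ⟨i - 1, by omega⟩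
      have hiN' := hmul i (by omega)
      refine Runs.ite (T := 110) ?_ (by decide) (fun c3 => ?_) (fun c3 => ?_)
      · simp only [Test.Fits, Expr.Fits]; omega
      all_goals simp only [Test.Holds, Expr.eval, h10] at c3
      · subst c3
        have d1 := hrows i (by omega) 0 (by omega)
        have l1 := hle i 0
        refine Runs.straight ?_ (by decide) ?_
        · simp only [setEntry, predReg, entry, minExpr, Program.Fits, Expr.Fits, Expr.eval, h9, h10,
            h1, h0, Nat.add_sub_cancel, d1]
          omega
        · simp only [setEntry, Program.run, eval_minExpr]
          simp only [predReg, entry, Expr.eval, h9, h10, h1, h0, Nat.add_sub_cancel, d1]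
          rw [colDist.eq_2, if_pos c1]
      · obtain ⟨j, rfl⟩ : ∃ l, j = l + 1 := ⟨j - 1, by omega⟩
        have d1 := hrow j (by omega)
        have d2 := hrows i (by omega) (j + 1) hj
        have d3 := hrows i (by omega) j (by omega)
        have l1 := hle (i + 1) j
        have l2 := hle i (j + 1)
        have l3 := hle i j
        obtain ⟨f2, e2⟩ := hbelow (predReg 9) (reg 10) (by simp only [predReg, Expr.Fits]; omega)
          (by simp only [Expr.Fits]; omega) (by simp only [predReg, Expr.eval]; omega)
          (by simp only [Expr.eval]; omega)
        obtain ⟨f3, e3⟩ := hbelow (reg 9) (predReg 10) (by simp only [Expr.Fits]; omega)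
          (by simp only [predReg, Expr.Fits]; omega) (by simp only [Expr.eval]; omega)
          (by simp only [predReg, Expr.eval]; omega)
        simp only [predReg, Expr.eval, h9, h10, Nat.add_sub_cancel] at e2 e3
        have e23 := and_congr e2 e3
        refine Runs.ite (T := 80) ⟨f2, f3⟩ (by decide) (fun c4 => ?_) (fun c4 => ?_)
        · replace c4 := e23.1 c4
          refine Runs.straight ?_ (by decide) ?_
          · simp only [setEntry, predReg, entry, minExpr, Program.Fits, Expr.Fits, Expr.eval, h9,
              h10, h1, h0, Nat.add_sub_cancel, d1, d2, d3]
            omega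
          · simp only [setEntry, Program.run, eval_minExpr, Expr.eval]
            simp only [predReg, entry, Expr.eval, h9, h10, h1, h0, Nat.add_sub_cancel, d1, d2, d3]
            rw [colDist.eq_4, if_pos c1, if_pos c4, min_comm (colDist _ _ i j)]
        · replace c4 := fun h => c4 (e23.2 h)
          refine Runs.straight ?_ (by decide) ?_
          · simp only [setEntry, predReg, entry, minExpr, Program.Fits, Expr.Fits, Expr.eval, h9,
              h10, h1, h0, Nat.add_sub_cancel, d1, d2]
            omega
          · simp only [setEntry, Program.run, eval_minExpr, Expr.eval]
            simp only [predReg, entry, Expr.eval, h9, h10, h1, h0, Nat.add_sub_cancel, d1, d2]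
            rw [colDist.eq_4, if_pos c1, if_neg c4]
  · refine Runs.straight ?_ (by decide) ?_
    · simp only [setEntry, Program.Fits, Expr.Fits, Expr.eval, h9, h10, h1, h0]
      omega
    · simp only [setEntry, Program.run, Expr.eval, h9, h10, h1, h0]
      congr 1
      rcases i with _ | i <;> rcases j with _ | j <;> rw [colDist, if_neg c1]

theorem entry_index_ne {N i j i' j' : ℕ} (hj' : j' < N) (h : i' < i) :
    i' * N + j' ≠ i * N + j := by
  have : (i' + 1) * N ≤ i * N := Nat.mul_le_mul_right N h
  rw [Nat.add_mul, Nat.one_mul] at this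
  omega

theorem runs_computeTable {hn : 0 < n} (hN : n = 2 * N) (hB : 1000 * (n * n) ≤ B) (hp : p < N)
    (hH : ∀ t, 0 < t → t ≤ N → H t ≤ n) (hk : k < 3 * n) (h : Stage S hn N r p H k b s) :
    Runs B computeTable s (n * (n * 200 + 200) + 50) (fun s' => Stage S hn N r p H k b s' ∧
      s'.arr 1 = s.arr 1 ∧ s'.arr 2 = s.arr 2 ∧ ∀ i < p, ∀ j < N - p,
        s'.arr 5 (i * N + j) = colDist (Below N H (k + 1)) n i j) := by
  have hnn : n ≤ n * n := Nat.le_mul_self n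
  refine (Runs.forLoop (m := p) (T := n * 200 + 50) (fun i s' => s'.reg 9 = i ∧
    Stage S hn N r p H k b s' ∧ s'.arr 1 = s.arr 1 ∧ s'.arr 2 = s.arr 2 ∧
    ∀ i' < i, ∀ j < N - p, s'.arr 5 (i' * N + j) = colDist (Below N H (k + 1)) n i' j)
    (by omega) ?_ ?_ ?_).mono ?_ ?_
  · rintro i s' ⟨h1, h2, h3⟩
    have := h2.size
    exact ⟨h1, this, by simp only [Expr.Fits]; omega⟩
  · rintro i s1 hi ⟨h1, h2, h3, h4, h5⟩
    refine (Runs.forLoop (m := N - p) (T := 150) (fun j s' => s'.reg 10 = j ∧ s'.reg 9 = i ∧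
      Stage S hn N r p H k b s' ∧ s'.arr 1 = s.arr 1 ∧ s'.arr 2 = s.arr 2 ∧
      (∀ i' < i, ∀ j < N - p, s'.arr 5 (i' * N + j) = colDist (Below N H (k + 1)) n i' j) ∧
      ∀ j' < j, s'.arr 5 (i * N + j') = colDist (Below N H (k + 1)) n i j')
      (by omega) ?_ ?_ ?_).mono ?_ ?_
    · rintro j s' ⟨h1, h2, h3, h4⟩
      have := h3.size
      have := h3.half
      exact ⟨h1, by simp only [Expr.eval]; omega, by simp only [Expr.Fits]; omega⟩
    · rintro j s' hj ⟨h6, h7, h8, h9, h10, h11, h12⟩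
      refine (runs_computeEntry hN hB hp hH hk h8 hi hj h7 h6 h11 h12).mono le_rfl ?_
      rintro s2 rfl
      refine ⟨by simp [h6], by simp, by simp [h7], h8.of_eq (by simp) (by simp) (by simp)
        (by simp) (by simp) (by simp) (by simp) (by simp), by simp [h9], by simp [h10], ?_, ?_⟩
      · intro i' hi' j' hj'
        have := entry_index_ne (j := j) (show j' < N by omega) hi'
        rw [State.setReg_arr, State.setArr_arr, if_neg (fun h => this h.2)]
        exact h11 i' hi' j' hj'
      · intro j' hj'
        rw [State.setReg_arr, State.setArr_arr]
        by_cases h13 : j' = j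
        · rw [h13, if_pos ⟨rfl, rfl⟩]
        · rw [if_neg (by omega)]
          exact h12 j' (by omega)
    · exact ⟨by simp, by simp [h1], h2.of_eq (by simp) (by simp) (by simp) (by simp) (by simp)
        (by simp) (by simp) (by simp), by simp [h3], by simp [h4], by simpa using h5, by simp⟩
    · simp only [Expr.cost]
      omega
    · rintro s' ⟨h6, h7, h8, h9, h10, h11, h12⟩
      refine ⟨h7, by simp, h8.of_eq (by simp) (by simp) (by simp) (by simp) (by simp)
        (by simp) (by simp) (by simp), by simp [h9], by simp [h10], fun i' hi' j hj => ?_⟩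
      rw [State.setReg_arr]
      rcases Nat.lt_add_one_iff_lt_or_eq.1 hi' with hi' | rfl
      · exact h11 i' hi' j hj
      · exact h12 j hj
  · exact ⟨by simp, h.of_eq (by simp) (by simp) (by simp) (by simp) (by simp)
        (by simp) (by simp) (by simp), by simp, by simp, by simp⟩
  · simp only [Expr.cost]
    have h1 : p ≤ n := by omega
    have h2 : n * 200 + 50 + (1 + 10) ≤ n * 200 + 200 := by omega
    generalize n * 200 + 50 + (1 + 10) = a at h2 ⊢
    generalize n * 200 + 200 = b at h2 ⊢
    have := Nat.mul_le_mul h1 h2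
    omega
  · rintro s' ⟨h1, h2⟩
    exact h2

end RAM

/-! ### Tracing back an optimal drawing -/

namespace RAM

open RAM.Expr (const reg arr)
open RAM.Program (setReg setArr)

variable {n N p r B k b : ℕ} {S : AngleSequence n} {H : ℕ → ℕ} {s : State}

/-- Let the current lower edge start in the current column, and go to its predecessor. -/
def stepLower : Program := Program.seq (setArr 6 (reg 13) (reg 12)) (setReg 13 (predReg 13))

/-- Let the current upper edge start in the current column, and go to its predecessor. -/
def stepUpper : Program :=
  Program.seq (setArr 6 (Expr.sub (reg 1) (reg 14)) (reg 12)) (setReg 14 (predReg 14))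

/-- Go to the previous column. -/
def prevColumn : Program := setReg 12 (predReg 12)

/-- Process one column. -/
def traceColumn : Program :=
  Program.ite (Test.and (Test.not (Test.eq (reg 13) (const 0)))
      (Test.eq (Expr.add (entry (predReg 13) (reg 14)) (const 1)) (reg 12)))
    (Program.seq stepLower prevColumn)
    (Program.ite (Test.and (Test.not (Test.eq (reg 14) (const 0)))
        (Test.eq (Expr.add (entry (reg 13) (predReg 14)) (const 1)) (reg 12)))
      (Program.seq stepUpper prevColumn)
      (Program.seq stepLower (Program.seq stepUpper prevColumn)))

/-- Starting with the last lower edge in register `13`, the last upper edge in register `14` and the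
last column in register `12`, write the positions of the vertical edges to array `6`. -/
def traceBack : Program :=
  Program.loop (Test.not (Test.and (Test.eq (reg 13) (const 0)) (Test.eq (reg 14) (const 0))))
    traceColumn

/-- The starts of the upper edges, which array `6` lists from right to left. -/
def upperStart (N : ℕ) (x : ℕ → ℕ) (l : ℕ) : ℕ := if l = 0 then 0 else x (N - l)

/-- The walk back from the pair `(i, j)` leaves the cells strictly between `i` and `N - j` alone. A
cell just written falls into that gap as soon as its chain steps back, so its value survives. -/
theorem runs_traceBack {hn : 0 < n} (hN : n = 2 * N) (hB : 1000 * (n * n) ≤ B) (hp : p < N)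
    (m : ℕ) : ∀ (i j : ℕ) (s : State), Stage S hn N r p H k b s → i + j ≤ m → i < p → j < N - p →
      s.reg 13 = i → s.reg 14 = j → s.reg 12 = colDist (Below N H (k + 1)) n i j →
      colDist (Below N H (k + 1)) n i j < n → s.arr 6 0 = 0 →
      (∀ i < p, ∀ j < N - p, s.arr 5 (i * N + j) = colDist (Below N H (k + 1)) n i j) →
      Runs B traceBack s (m * 100 + 20) (fun s' => Stage S hn N r p H k b s' ∧
        Draw (Below N H (k + 1)) i j (colDist (Below N H (k + 1)) n i j) (s'.arr 6)
          (upperStart N (s'.arr 6)) ∧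
        s'.arr 6 0 = 0 ∧ ∀ t, i < t → t < N - j → s'.arr 6 t = s.arr 6 t) := by
  have hnn : n ≤ n * n := Nat.le_mul_self n
  have hmul : ∀ i' < N, i' * N ≤ n * n := fun i' h' => Nat.mul_le_mul (by omega) (by omega)
  induction m with
  | zero =>
    intro i j s h hm hi hj h13 h14 h12 hlt h6 htab
    obtain rfl : i = 0 := by omega
    obtain rfl : j = 0 := by omega
    refine Runs.loop_stop ?_ ?_ (by decide) ⟨h, ?_, h6, fun t _ _ => rfl⟩
    · simp only [Test.Fits, Expr.Fits]; omega
    · simp [Test.Holds, Expr.eval, h13, h14]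
    · obtain ⟨h1, h2⟩ := colDist_cases hlt
      have h3 : colDist (Below N H (k + 1)) n 0 0 = 0 := by
        rcases h2 with h2 | ⟨i', h2, -⟩ | ⟨i', h2, -⟩ | ⟨i', j', h2, -⟩
        · exact h2.2.2
        all_goals omega
      rw [h3]
      exact Draw.zero h1 h6 rfl
  | succ m ih =>
    intro i j s h hm hi hj h13 h14 h12 hlt h6 htab
    by_cases hij : i = 0 ∧ j = 0
    · exact (ih i j s h (by omega) hi hj h13 h14 h12 hlt h6 htab).mono (by omega) (fun _ h => h)
    have h1 := h.half
    have hiN := hmul i (by omega)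
    have hiN' := hmul (i - 1) (by omega)
    have hc := (colDist_cases hlt).1
    generalize hX : colDist (Below N H (k + 1)) n i j = X at *
    have hle := colDist_le_bound (Below N H (k + 1)) n
    have l1 := hle (i - 1) j
    have l2 := hle i (j - 1)
    have t1 := htab (i - 1) (by omega) j hj
    have t2 := htab i hi (j - 1) (by omega)
    have key : Runs B traceColumn s 78 (fun s' => Runs B traceBack s' (m * 100 + 20)
      (fun s' => Stage S hn N r p H k b s' ∧
        Draw (Below N H (k + 1)) i j X (s'.arr 6) (upperStart N (s'.arr 6)) ∧
        s'.arr 6 0 = 0 ∧ ∀ t, i < t → t < N - j → s'.arr 6 t = s.arr 6 t)) := by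
      refine Runs.ite (T := 50) ?_ (by decide) (fun c1 => ?_) (fun c1 => ?_)
      · simp only [Test.Fits, entry, predReg, Expr.Fits, Expr.eval, h13, h14, h12, h1, t1]
        omega
      all_goals simp only [Test.Holds, entry, predReg, Expr.eval, h13, h14, h12, h1, t1] at c1
      · obtain ⟨i, rfl⟩ : ∃ l, i = l + 1 := ⟨i - 1, by omega⟩
        rw [Nat.add_sub_cancel] at c1
        refine Runs.straight ?_ (by decide) ?_
        · simp only [stepLower, prevColumn, predReg, Program.Fits, Program.run, Expr.Fits,
            Expr.eval, State.setArr_reg, State.setReg_reg, h13, h12]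
          simp
          omega
        refine (ih i j _ (h.of_eq ?_ ?_ ?_ ?_ ?_ ?_ ?_ ?_) (by omega) (by omega) hj ?_ ?_ ?_
          (by omega) ?_ ?_).mono le_rfl ?main
        case main =>
          rintro s' ⟨h2, h3, h60, h4⟩
          simp [stepLower, prevColumn, predReg, Program.run, Expr.eval, h13, h12] at h4
          refine ⟨h2, ?_, h60, ?_⟩
          · rw [← c1.2]
            refine h3.succ_left ?_ hc
            rw [h4 (i + 1) (by omega) (by omega), if_pos rfl, c1.2]
          · intro t ht ht'
            rw [h4 t (by omega) (by omega), if_neg (by omega)]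
        all_goals simp [stepLower, prevColumn, predReg, Program.run, Expr.eval, h13, h14, h12, h6]
        · omega
        · exact htab
      · refine Runs.ite (T := 30) ?_ (by decide) (fun c2 => ?_) (fun c2 => ?_)
        · simp only [Test.Fits, entry, predReg, Expr.Fits, Expr.eval, h13, h14, h12, h1, t2]
          omega
        all_goals simp only [Test.Holds, entry, predReg, Expr.eval, h13, h14, h12, h1, t2] at c2
        · obtain ⟨j, rfl⟩ : ∃ l, j = l + 1 := ⟨j - 1, by omega⟩
          rw [Nat.add_sub_cancel] at c2
          refine Runs.straight ?_ (by decide) ?_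
          · simp only [stepUpper, prevColumn, predReg, Program.Fits, Program.run, Expr.Fits,
              Expr.eval, State.setArr_reg, State.setReg_reg, h14, h12, h1]
            simp
            omega
          refine (ih i j _ (h.of_eq ?_ ?_ ?_ ?_ ?_ ?_ ?_ ?_) (by omega) hi (by omega) ?_ ?_ ?_
            (by omega) ?_ ?_).mono le_rfl ?main
          case main =>
            rintro s' ⟨h2, h3, h60, h4⟩
            simp [stepUpper, prevColumn, predReg, Program.run, Expr.eval, h14, h12, h1] at h4
            refine ⟨h2, ?_, h60, ?_⟩
            · rw [← c2.2]
              refine h3.succ_right ?_ hc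
              rw [upperStart, if_neg (by omega), h4 (N - (j + 1)) (by omega) (by omega),
                if_pos rfl, c2.2]
            · intro t ht ht'
              rw [h4 t (by omega) (by omega), if_neg (by omega)]
          all_goals simp [stepUpper, prevColumn, predReg, Program.run, Expr.eval, h13, h14, h12, h6,
            h1]
          · omega
          · omega
          · exact htab
        -- The program does not test the diagonal move: once the other two moves fail and the pair
        -- is not `(0, 0)`, `colDist_cases` leaves nothing else.
        · obtain ⟨i', j', rfl, rfl, hc1, hc2, hX'⟩ : ∃ i' j', i = i' + 1 ∧ j = j' + 1 ∧
              Below N H (k + 1) i' j ∧ Below N H (k + 1) i j' ∧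
              colDist (Below N H (k + 1)) n i' j' + 1 = X := by
            have hcases := (colDist_cases (hX.trans_lt hlt)).2
            rw [hX] at hcases
            rcases hcases with h2 | ⟨i', rfl, h2⟩ | ⟨j', rfl, h2⟩ | h2
            · exact absurd ⟨h2.1, h2.2.1⟩ hij
            · exact absurd ⟨by omega, h2⟩ c1
            · exact absurd ⟨by omega, h2⟩ c2
            · exact h2
          refine Runs.straight ?_ (by decide) ?_
          · simp only [stepLower, stepUpper, prevColumn, predReg, Program.Fits, Program.run,
              Expr.Fits, Expr.eval, State.setArr_reg, State.setReg_reg, h13, h14, h12, h1]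
            simp
            omega
          refine (ih i' j' _ (h.of_eq ?_ ?_ ?_ ?_ ?_ ?_ ?_ ?_) (by omega) (by omega) (by omega)
            ?_ ?_ ?_ (by omega) ?_ ?_).mono le_rfl ?main
          case main =>
            rintro s' ⟨h2, h3, h60, h4⟩
            simp [stepLower, stepUpper, prevColumn, predReg, Program.run, Expr.eval, h13, h14, h12,
              h1] at h4
            refine ⟨h2, ?_, h60, ?_⟩
            · rw [← hX']
              refine h3.succ_both ?_ ?_ hc hc2 hc1
              · rw [h4 (i' + 1) (by omega) (by omega)]
                split_ifs <;> omega
              · rw [upperStart, if_neg (by omega), h4 (N - (j' + 1)) (by omega) (by omega),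
                  if_pos rfl, hX']
            · intro t ht ht'
              rw [h4 t (by omega) (by omega), if_neg (by omega), if_neg (by omega)]
          all_goals simp [stepLower, stepUpper, prevColumn, predReg, Program.run, Expr.eval, h13,
            h14, h12, h6, h1]
          · omega
          · omega
          · exact htab
    refine (Runs.loop_step ?_ ?_ key).mono ?_ (fun _ h => h)
    · simp only [Test.Fits, Expr.Fits]; omega
    · simpa [Test.Holds, Expr.eval, h13, h14] using hij
    · simp only [Test.cost, Expr.cost]; omega

end RAM

/-! ### Writing the vertices of a drawing -/

namespace RAM

open RAM.Expr (const reg arr)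
open RAM.Program (setReg setArr)

variable {n N p r B k b : ℕ} {S : AngleSequence n} {H : ℕ → ℕ} {s : State}

/-- Write a vertex, and go to the next one. -/
def emit : Program :=
  Program.seq (Program.seq (setArr 1 (reg 15) (arr 6 (reg 4)))
      (Program.seq (setArr 2 (reg 15) (reg 16)) (setReg 15 (Expr.add (reg 15) (const 1)))))
    (Program.ite (Test.le (reg 0) (reg 15)) (setReg 15 (const 0)) Program.skip)

/-- Load the height of the next horizontal edge. -/
def nextHeight : Program :=
  Program.ite (Test.le (Expr.add (reg 4) (const 1)) (reg 7))
    (setReg 16 (arr 4 (Expr.add (reg 4) (const 1))))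
    (setReg 16 (Expr.sub (Expr.add (reg 8) (const 1)) (arr 4 (Expr.add (reg 4) (const 1)))))

/-- Write all vertices. -/
def emitAll : Program :=
  Program.seq (Program.seq (setReg 15 (reg 6))
      (setReg 16 (Expr.sub (Expr.add (reg 8) (const 1)) (arr 4 (reg 1)))))
    (forLoop 4 (reg 1) (Program.seq emit (Program.seq nextHeight emit)))

/-- The first `m` vertices from position `r` on have been written. -/
structure Emitted (n r m : ℕ) (x y : ℕ → ℕ) (s : State) : Prop where
  pos : s.reg 15 = (r + m) % n
  fst : ∀ l < m, s.arr 1 ((r + l) % n) = x l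
  snd : ∀ l < m, s.arr 2 ((r + l) % n) = y l

theorem Emitted.of_eq {m : ℕ} {x y : ℕ → ℕ} (h : Emitted n r m x y s) {s' : State}
    (h15 : s'.reg 15 = s.reg 15) (h1 : s'.arr 1 = s.arr 1) (h2 : s'.arr 2 = s.arr 2) :
    Emitted n r m x y s' :=
  ⟨h15.trans h.pos, h1 ▸ h.fst, h2 ▸ h.snd⟩

theorem succ_mod_eq (hn : 0 < n) (a : ℕ) :
    (a + 1) % n = if n ≤ a % n + 1 then 0 else a % n + 1 := by
  have h1 := Nat.mod_lt a hn
  rw [← Nat.mod_add_mod]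
  split_ifs with h
  · rw [show a % n + 1 = n by omega, Nat.mod_self]
  · rw [Nat.mod_eq_of_lt (by omega)]

/-- The positions `(r + l) % n` with `l < n` are distinct, so a new vertex overwrites none of the
earlier ones. -/
theorem runs_emit (hn : 0 < n) (hB : 1000 * (n * n) ≤ B) {m : ℕ} (hm : m < n) {x y : ℕ → ℕ}
    (h : Emitted n r m x y s) (h0 : s.reg 0 = n) (hx : s.arr 6 (s.reg 4) = x m)
    (hy : s.reg 16 = y m) (hxB : x m ≤ B) (hyB : y m ≤ B) (h4 : s.reg 4 ≤ B) :
    Runs B emit s 30 (fun s' => Emitted n r (m + 1) x y s' ∧ (∀ i, i ≠ 15 → s'.reg i = s.reg i) ∧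
      ∀ a, a ≠ 1 → a ≠ 2 → s'.arr a = s.arr a) := by
  have hnn : n ≤ n * n := Nat.le_mul_self n
  have hpos := h.pos
  have hlt := Nat.mod_lt (r + m) hn
  have hne : ∀ l < m, (r + l) % n ≠ (r + m) % n := fun l hl h =>
    hl.ne (cycIdx_inj hn r (hl.trans hm) hm (Fin.ext h))
  have hsucc := succ_mod_eq hn (r + m)
  have fst : ∀ l < m + 1, (if (r + l) % n = (r + m) % n then x m else s.arr 1 ((r + l) % n)) =
      x l := by
    intro l hl
    rcases Nat.lt_add_one_iff_lt_or_eq.1 hl with hl | rfl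
    · rw [if_neg (hne l hl), h.fst l hl]
    · rw [if_pos rfl]
  have snd : ∀ l < m + 1, (if (r + l) % n = (r + m) % n then y m else s.arr 2 ((r + l) % n)) =
      y l := by
    intro l hl
    rcases Nat.lt_add_one_iff_lt_or_eq.1 hl with hl | rfl
    · rw [if_neg (hne l hl), h.snd l hl]
    · rw [if_pos rfl]
  refine (Runs.seq (T := 15) (T' := 10) (Runs.straight ?_ (by decide) ?_)).mono (by omega)
    (fun _ h => h)
  · simp only [Program.Fits, Program.run, Expr.Fits, Expr.eval, State.setArr_reg, hx, hy, hpos]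
    omega
  · refine Runs.ite (T := 5) ?_ (by decide) (fun c1 => ?_) (fun c1 => ?_)
    · simp [Program.run, Test.Fits, Expr.Fits, Expr.eval, h0, hpos]
      omega
    all_goals simp [Program.run, Test.Holds, Expr.eval, h0, hpos] at c1
    · rw [if_pos c1] at hsucc
      refine Runs.straight (by simp [Program.Fits, Expr.Fits]) (by decide) ⟨⟨?_, ?_, ?_⟩, ?_, ?_⟩
      · simp [Program.run, Expr.eval, ← hsucc, Nat.add_assoc]
      · simpa [Program.run, Expr.eval, hpos, hx] using fst
      · simpa [Program.run, Expr.eval, hpos, hy] using snd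
      · intro i hi
        simp [Program.run, Expr.eval, hi]
      · intro a h1 h2
        simp [Program.run, Expr.eval, h1, h2]
    · rw [if_neg (by omega)] at hsucc
      refine Runs.skip (by omega) ⟨⟨?_, ?_, ?_⟩, ?_, ?_⟩
      · simp [Program.run, Expr.eval, hpos, ← hsucc, Nat.add_assoc]
      · simpa [Program.run, Expr.eval, hpos, hx] using fst
      · simpa [Program.run, Expr.eval, hpos, hy] using snd
      · intro i hi
        simp [Program.run, Expr.eval, hi]
      · intro a h1 h2
        simp [Program.run, Expr.eval, h1, h2]

/-- Round `t` writes vertices `2 * t` and `2 * t + 1`, the ends of one vertical edge: the abscissa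
stays and the height is updated in between. -/
theorem runs_emitAll {hn : 0 < n} (hN : n = 2 * N) (hB : 1000 * (n * n) ≤ B) (hr : r < n)
    (hp : p < N) (hH : ∀ t, 0 < t → t ≤ N → H t ≤ n) (hk : k < 3 * n)
    (h : Stage S hn N r p H k b s) (hx : ∀ t < N, s.arr 6 t ≤ n) :
    Runs B emitAll s (n * 150 + 50) (fun s' => Stage S hn N r p H k b s' ∧ ∀ m < n,
      s'.arr 1 ((r + m) % n) = s.arr 6 (m / 2) ∧
      s'.arr 2 ((r + m) % n) = drawY N p (k + 1) H ((m + 1) / 2)) := by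
  have hnn : n ≤ n * n := Nat.le_mul_self n
  have hHN := hH N (by omega) le_rfl
  have hlab := h.labels N (by omega) le_rfl
  have g1 := h.half
  have g6 := h.pos
  have g8 := h.height
  have hY : ∀ t < N, drawY N p (k + 1) H (t + 1) =
      if t + 1 ≤ p then H (t + 1) else k + 1 - H (t + 1) := by
    intro t ht
    simp only [drawY]
    rw [if_neg (by omega), if_pos (show t + 1 ≤ N by omega)]
  have hYB : ∀ t ≤ N, drawY N p (k + 1) H t ≤ B := by
    rintro (_ | t) ht
    · rw [drawY, if_pos rfl]; omega
    · rw [hY t (by omega)]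
      have := hH (t + 1) (by omega) ht
      split_ifs <;> omega
  refine (Runs.seq (T := 20) (Runs.straight ?_ (by decide) ((Runs.forLoop (m := N) (T := 120)
    (fun t s' => s'.reg 4 = t ∧ Stage S hn N r p H k b s' ∧ s'.arr 6 = s.arr 6 ∧
      s'.reg 16 = drawY N p (k + 1) H t ∧
      Emitted n r (2 * t) (fun m => s.arr 6 (m / 2))
        (fun m => drawY N p (k + 1) H ((m + 1) / 2)) s')
    (by omega) ?_ ?_ ?_).mono le_rfl ?_))).mono ?_ (fun _ h => h)
  · simp [Program.Fits, Program.run, Expr.Fits, Expr.eval, g1, g6, g8, hlab]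
    omega
  · rintro t s' ⟨h1, h2, h3⟩
    have := h2.half
    exact ⟨h1, this, by simp only [Expr.Fits]; omega⟩
  · rintro t s1 ht ⟨h1, h2, h3, h4, h5⟩
    have i1 : 2 * t / 2 = t := by omega
    have i2 : (2 * t + 1) / 2 = t := by omega
    have i3 : (2 * t + 1 + 1) / 2 = t + 1 := by omega
    have x1 := hx t ht
    have y1 := hYB t ht.le
    have y2 := hYB (t + 1) ht
    refine (Runs.seq (T := 30) (T' := 80) ((runs_emit hn hB (by omega) h5 h2.len ?_ ?_ ?_ ?_
      ?_).mono le_rfl ?_)).mono (by omega) (fun _ h => h)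
    · simp only [h1, h3, i1]
    · simp only [h4, i2]
    · simp only [i1]; omega
    · simp only [i2]; omega
    · omega
    rintro s2 ⟨h6, h7, h8⟩
    have k1 : Stage S hn N r p H k b s2 := h2.of_eq (h7 _ (by omega)) (h7 _ (by omega))
      (h7 _ (by omega)) (h7 _ (by omega)) (h7 _ (by omega)) (h7 _ (by omega))
      (h8 _ (by omega) (by omega)) (h8 _ (by omega) (by omega))
    have k2 := (h7 4 (by omega)).trans h1
    have k3 := (h8 6 (by omega) (by omega)).trans h3
    have k4 := k1.size
    have k5 := k1.height
    have k6 := k1.labels (t + 1) (by omega) (by omega)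
    have k7 := hH (t + 1) (by omega) (by omega)
    have hnext : Runs B nextHeight s2 40 (fun s' =>
        s' = s2.setReg 16 (drawY N p (k + 1) H (t + 1))) := by
      refine Runs.ite (T := 30) ?_ (by decide) (fun c1 => ?_) (fun c1 => ?_)
      · simp only [Test.Fits, Expr.Fits, Expr.eval]; omega
      all_goals simp only [Test.Holds, Expr.eval, k2, k4] at c1
      · refine Runs.straight ?_ (by decide) ?_
        · simp only [Program.Fits, Expr.Fits, Expr.eval, k2, k6]; omega
        · simp only [Program.run, Expr.eval, k2, k6, hY t ht, if_pos c1]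
      · refine Runs.straight ?_ (by decide) ?_
        · simp only [Program.Fits, Expr.Fits, Expr.eval, k2, k6, k5]; omega
        · simp only [Program.run, Expr.eval, k2, k5, k6, hY t ht, if_neg c1]
    refine (Runs.seq (T' := 30) (hnext.mono le_rfl ?_)).mono (by omega) (fun _ h => h)
    rintro s3 rfl
    have k8 : Emitted n r (2 * t + 1) (fun m => s.arr 6 (m / 2))
        (fun m => drawY N p (k + 1) H ((m + 1) / 2))
        (s2.setReg 16 (drawY N p (k + 1) H (t + 1))) := h6.of_eq (by simp) (by simp) (by simp)
    refine (runs_emit hn hB (by omega) k8 (by simp [k1.len]) ?_ ?_ ?_ ?_ ?_).mono le_rfl ?_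
    · simp [k2, k3, i2]
    · simp [i3]
    · simp only [i2]; omega
    · simp only [i3]; omega
    · simp; omega
    rintro s3 ⟨h9, h10, h11⟩
    have e16 := h10 16 (by omega)
    have e4 := h10 4 (by omega)
    simp at e16 e4
    refine ⟨e4.trans k2, by simp, k1.of_eq ?_ ?_ ?_ ?_ ?_ ?_ ?_ ?_, ?_, ?_, ?_⟩
    any_goals simp [h10, h11]
    · exact k3
    · exact h9.of_eq (by simp) (by simp) (by simp)
  · refine ⟨by simp, h.of_eq ?_ ?_ ?_ ?_ ?_ ?_ ?_ ?_, ?_, ?_, ⟨?_, ?_, ?_⟩⟩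
    any_goals simp [Program.run, Expr.eval, g1, g6, g8, hlab, drawY]
    rw [Nat.mod_eq_of_lt hr]
  · rintro s' ⟨h1, h2, h3, h4, h5⟩
    exact ⟨h2, fun m hm => ⟨h5.fst m (by omega), h5.snd m (by omega)⟩⟩
  · simp only [Expr.cost]; omega

end RAM

/-! ### Trying all heights -/

namespace RAM

open RAM.Expr (const reg arr)
open RAM.Program (setReg setArr)

variable {n N p r B k b : ℕ} {S : AngleSequence n} {H : ℕ → ℕ} {s : State}

/-- The last entry of the table. -/
def lastEntry : Expr := entry (predReg 7) (Expr.sub (Expr.sub (reg 1) (reg 7)) (const 1))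

/-- The area of the best drawing of the current height and a given width. -/
def areaExpr (e : Expr) : Expr :=
  Expr.mul (Expr.add (reg 8) (const 1)) (Expr.add e (const 1))

/-- Prepare the construction of the best drawing of the current height. -/
def prepareTrace : Program :=
  Program.seq (setReg 12 lastEntry) <|
  Program.seq (setReg 11 (areaExpr (reg 12))) <|
  Program.seq (setReg 13 (predReg 7)) <|
  Program.seq (setReg 14 (Expr.sub (Expr.sub (reg 1) (reg 7)) (const 1))) <|
  Program.seq (setArr 6 (const 0) (const 0)) (setArr 6 (reg 7) (Expr.add (reg 12) (const 1)))

/-- Find the best drawing of the current height, and write it if it improves the area. -/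
def tryHeight : Program :=
  Program.seq computeTable
    (Program.ite (Test.and (Test.le (Expr.add lastEntry (const 1)) (reg 0))
        (Test.le (Expr.add (areaExpr lastEntry) (const 1)) (reg 11)))
      (Program.seq prepareTrace (Program.seq traceBack emitAll)) Program.skip)

/-- Find a drawing of least area, and write it. -/
def tryHeights : Program :=
  Program.seq (setReg 11 (Expr.mul (const 4) (Expr.mul (reg 0) (reg 0))))
    (forLoop 8 (Expr.mul (const 3) (reg 0)) tryHeight)

/-- Arrays `1` and `2` hold the vertices of a drawing of height `h` with `X + 1` columns. -/
def HoldsDrawing (n N r p : ℕ) (H : ℕ → ℕ) (h X : ℕ) (s : State) : Prop :=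
  ∃ a b, Draw (Below N H h) (p - 1) (N - p - 1) X a b ∧ ∀ m < n,
    s.arr 1 ((r + m) % n) = drawX N p X a b (m / 2) ∧
    s.arr 2 ((r + m) % n) = drawY N p h H ((m + 1) / 2)

/-- Either no drawing has been found and `b = 4 * n ^ 2`, or the drawing found has area `b`; and no
drawing of height at most `k` has smaller area. -/
structure Best (n N r p : ℕ) (H : ℕ → ℕ) (k b : ℕ) (s : State) : Prop where
  found : b = 4 * (n * n) ∨ ∃ h X, b = h * (X + 1) ∧ HoldsDrawing n N r p H h X s
  le : ∀ h, 0 < h → h ≤ k → colDist (Below N H h) n (p - 1) (N - p - 1) < n →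
    b ≤ h * (colDist (Below N H h) n (p - 1) (N - p - 1) + 1)

theorem Best.of_eq (h : Best n N r p H k b s) {s' : State} (h1 : s'.arr 1 = s.arr 1)
    (h2 : s'.arr 2 = s.arr 2) : Best n N r p H k b s' := by
  refine ⟨h.found.imp_right ?_, h.le⟩
  rintro ⟨h, X, h3, a, b, h4⟩
  exact ⟨h, X, h3, a, b, by rwa [h1, h2]⟩

theorem Best.succ {b' : ℕ} (h : Best n N r p H k b s) {s' : State} (hb : b' ≤ b)
    (hf : b' = 4 * (n * n) ∨ ∃ h X, b' = h * (X + 1) ∧ HoldsDrawing n N r p H h X s')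
    (hk : colDist (Below N H (k + 1)) n (p - 1) (N - p - 1) < n →
      b' ≤ (k + 1) * (colDist (Below N H (k + 1)) n (p - 1) (N - p - 1) + 1)) :
    Best n N r p H (k + 1) b' s' := by
  refine ⟨hf, fun h' h1 h2 h3 => ?_⟩
  rcases Nat.le_add_one_iff.1 h2 with h2 | rfl
  · exact hb.trans (h.le h' h1 h2 h3)
  · exact hk h3

theorem runs_tryHeight {hn : 0 < n} (hN : n = 2 * N) (hB : 1000 * (n * n) ≤ B) (hr : r < n)
    (hp0 : 0 < p) (hp : p < N) (hH : ∀ t, 0 < t → t ≤ N → H t ≤ n) (hk : k < 3 * n)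
    (h : Stage S hn N r p H k b s) (hb : Best n N r p H k b s) (hbB : b ≤ B) :
    Runs B tryHeight s (n * (n * 200 + 400) + 300) (fun s' => ∃ b' ≤ b,
      Stage S hn N r p H k b' s' ∧ Best n N r p H (k + 1) b' s') := by
  have hnn : n ≤ n * n := Nat.le_mul_self n
  refine (Runs.seq (T' := n * 200 + 250) ((runs_computeTable hN hB hp hH hk h).mono le_rfl
    ?_)).mono ?_ (fun _ h => h)
  swap
  · simp only [Nat.mul_add]; omega
  rintro s1 ⟨h1, h2, h3, htab⟩
  replace hb := hb.of_eq h2 h3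
  have g0 := h1.len
  have g1 := h1.half
  have g7 := h1.size
  have g8 := h1.height
  have g11 := h1.best
  have tlast := htab (p - 1) (by omega) (N - p - 1) (by omega)
  have hle := colDist_le_bound (Below N H (k + 1)) n (p - 1) (N - p - 1)
  have hmul : (p - 1) * N ≤ n * n := Nat.mul_le_mul (by omega) (by omega)
  generalize hX : colDist (Below N H (k + 1)) n (p - 1) (N - p - 1) = X at *
  -- The area has to fit into a word even if the distance is the cutoff `n`, hence the factor `2 *
  -- n` for `n + 1`.
  have harea : (k + 1) * (X + 1) ≤ (3 * n) * (2 * n) := Nat.mul_le_mul (by omega) (by omega)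
  rw [show 3 * n * (2 * n) = 6 * (n * n) by ring] at harea
  refine Runs.ite (T := n * 200 + 200) ?_ ?_ (fun c => ?_) (fun c => ?_)
  · simp only [Test.Fits, lastEntry, areaExpr, entry, predReg, Expr.Fits, Expr.eval, g0, g1, g7, g8,
      g11, tlast]
    omega
  · simp only [Test.cost, lastEntry, areaExpr, entry, predReg, Expr.cost]
    omega
  all_goals simp only [Test.Holds, lastEntry, areaExpr, entry, predReg, Expr.eval, g0, g1, g7, g8,
      g11, tlast] at c
  · have hprep : ∃ s2, prepareTrace.run s1 = s2 ∧ Stage S hn N r p H k ((k + 1) * (X + 1)) s2 ∧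
        s2.reg 12 = X ∧ s2.reg 13 = p - 1 ∧ s2.reg 14 = N - p - 1 ∧ s2.arr 5 = s1.arr 5 ∧
        s2.arr 6 0 = 0 ∧ s2.arr 6 p = X + 1 := by
      refine ⟨_, rfl, ⟨h1.toHasPattern.of_eq ?_ ?_ ?_ ?_ ?_, ?_, ?_, ?_⟩, ?_, ?_, ?_, ?_, ?_, ?_⟩
      any_goals simp [prepareTrace, Program.run, lastEntry, areaExpr, entry, predReg, Expr.eval, g1,
        g7, g8, tlast]
      · exact h1.labels
      · omega
    obtain ⟨s2, hs2, k1, k12, k13, k14, k5, k6, k6'⟩ := hprep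
    refine (Runs.seq (T := 60) (Runs.straight ?_ (by decide) ?_)).mono (T := 60 + (n * 200 + 140))
      (by omega) (fun _ h => h)
    · simp [prepareTrace, Program.Fits, Program.run, lastEntry, areaExpr, entry, predReg, Expr.Fits,
        Expr.eval, g1, g7, g8, tlast]
      omega
    rw [hs2]
    refine (Runs.seq ((runs_traceBack hN hB hp (N - 2) (p - 1) (N - p - 1) s2 k1 (by omega)
      (by omega) (by omega) k13 k14 (k12.trans hX.symm) (by omega) k6
      (by rwa [k5])).mono le_rfl ?_)).mono (T := (N - 2) * 100 + 20 + (n * 150 + 50)) (by omega)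
      (fun _ h => h)
    rintro s3 ⟨m1, m2, m3, m4⟩
    rw [hX] at m2
    have m5 : s3.arr 6 p = X + 1 := (m4 p (by omega) (by omega)).trans k6'
    have hb' : ∀ t, p < t → t < N → upperStart N (s3.arr 6) (N - t) = s3.arr 6 t := by
      intro t ht ht'
      rw [upperStart, if_neg (by omega), Nat.sub_sub_self ht'.le]
    refine (runs_emitAll hN hB hr hp hH hk m1 ?_).mono le_rfl ?_
    · intro t ht
      rcases lt_trichotomy t p with h4 | rfl | h4
      · have := m2.a_le' t (by omega); omega
      · omega
      · have := m2.b_le' (N - t) (by omega); rw [hb' t h4 ht] at this; omega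
    · rintro s4 ⟨q1, q2⟩
      refine ⟨_, by omega, q1, hb.succ (by omega) (Or.inr ⟨k + 1, X, rfl, _, _, m2, ?_⟩) ?_⟩
      · intro m hm
        refine ⟨(q2 m hm).1.trans ?_, (q2 m hm).2⟩
        rw [drawX]
        split_ifs with h4 h5
        · rfl
        · rw [h5, m5]
        · rw [hb' _ (by omega) (by omega)]
      · rw [hX]
        exact fun _ => le_rfl
  · refine Runs.skip (by omega) ⟨b, le_rfl, h1, hb.succ le_rfl hb.found ?_⟩
    rw [hX]
    intro h4
    by_contra h5
    exact c ⟨h4, by omega⟩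

theorem runs_tryHeights {hn : 0 < n} (hN : n = 2 * N) (hB : 1000 * (n * n) ≤ B) (hr : r < n)
    (hp0 : 0 < p) (hp : p < N) (hH : ∀ t, 0 < t → t ≤ N → H t ≤ n)
    (h : HasPattern S hn N r p s) (hl : ∀ t, 0 < t → t ≤ N → s.arr 4 t = H t) :
    Runs B tryHeights s (3 * n * (n * (n * 200 + 400) + 320) + 50) (fun s' => ∃ b,
      Best n N r p H (3 * n) b s') := by
  have hnn : n ≤ n * n := Nat.le_mul_self n
  have g0 := h.len
  refine (Runs.seq (T := 10) (Runs.straight ?_ (by decide) ((Runs.forLoop (m := 3 * n)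
    (T := n * (n * 200 + 400) + 300) (fun k s' => ∃ b ≤ 4 * (n * n),
      Stage S hn N r p H k b s' ∧ Best n N r p H k b s') (by omega) ?_ ?_ ?_).mono le_rfl
      ?_))).mono ?_ (fun _ h => h)
  · simp only [Program.Fits, Expr.Fits, Expr.eval, g0]; omega
  · rintro k s' ⟨b, hb, h1, -⟩
    have h0 := h1.len
    have h8 := h1.height
    exact ⟨h8, by simp only [Expr.eval, h0], by simp only [Expr.Fits, Expr.eval, h0]; omega⟩
  · rintro k s' hk ⟨b, hb, h1, h2⟩
    refine (runs_tryHeight hN hB hr hp0 hp hH hk h1 h2 (by omega)).mono le_rfl ?_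
    rintro s2 ⟨b', hb', h3, h4⟩
    refine ⟨h3.height, b', by omega, ⟨h3.toHasPattern.of_eq ?_ ?_ ?_ ?_ ?_, ?_, ?_, ?_⟩,
      h4.of_eq rfl rfl⟩
    any_goals simp [h3.best]
    exact h3.labels
  · refine ⟨_, le_rfl, ⟨h.of_eq ?_ ?_ ?_ ?_ ?_, ?_, ?_, ?_⟩, Or.inl rfl, fun h h1 h2 => by omega⟩
    any_goals simp [Program.run, Expr.eval, g0]
    exact hl
  · rintro s' ⟨b, -, -, h1⟩
    exact ⟨b, h1⟩
  · simp only [Expr.cost]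
    have key : ∀ a c d : ℕ, c ≤ d → 10 + (a * c + (1 + 1 + 1 + 10)) ≤ a * d + 50 := by
      intro a c d h
      have := Nat.mul_le_mul_left a h
      omega
    exact key _ _ _ (by omega)

end RAM

/-! ### The algorithm -/

namespace RAM

variable {n N r p B : ℕ} {S : AngleSequence n}

/-- The algorithm. -/
def minimize : Program :=
  Program.seq halfLength <| Program.seq copyTurns <| Program.seq findPattern <|
  Program.seq forwardHeights <| Program.seq backwardHeights tryHeights

/-- The initial value `4 * (n * n)` cannot survive: some polygon realizes the sequence, so some
height at most `3 * n` has a distance below `n`, and the area there is at most `3 * n * n`. -/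
theorem Best.realizesWithMinBoundingBox_output {hn : 0 < n} (hN : n = 2 * N)
    (hS : S.IsXMonotone) (hT : Pattern N p (fun k => S (cycIdx hn r k))) {H : ℕ → ℕ}
    (hH : LeastLabelling N p (fun k => S (cycIdx hn r k)) H) {b : ℕ} {s : State}
    (h : Best n N r p H (3 * n) b s) : (output n s).RealizesWithMinBoundingBox S := by
  rcases h.found with hb | ⟨h', X, hb, a, c, hD, hout⟩
  · obtain ⟨Q, hQ, -⟩ := hS
    obtain ⟨ξ, ζ, w, h0, F, hs, hs', hR, -⟩ := hQ.exists_frame hn hN r hT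
    obtain ⟨h', h1, h2, h3, -⟩ := F.exists_colDist_le hs hs' hR hH n
    have h4 := h.le h' h1 (by omega) (by omega)
    have h5 : h' * (colDist (Below N H h') n (p - 1) (N - p - 1) + 1) ≤ 3 * n * n :=
      Nat.mul_le_mul (by omega) (by omega)
    have h6 : 0 < n * n := Nat.mul_pos hn hn
    rw [Nat.mul_assoc] at h5
    omega
  · refine (output n s).realizesWithMinBoundingBox_of_draw hn hN hT hH hD
      (fun h1 h2 h3 h4 => ?_) (fun k hk => ?_)
    · rw [← hb]
      exact h.le h1 h2 (by omega) h4
    · obtain ⟨h1, h2⟩ := hout k hk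
      rw [← h1, ← h2]
      rfl

/-- The pattern search and the loop over the heights are cubic, everything else is linear. -/
theorem runs_minimize (hS : S.IsXMonotone) (hB : 1000 * (n * n) ≤ B) :
    Runs B minimize (input S) (10000 * n ^ 3)
      (fun s => (output n s).RealizesWithMinBoundingBox S) := by
  obtain ⟨hn, N, p, r, hN, hr, hT⟩ := hS.exists_pattern
  have hS' : ∃ r < n, ∃ p < N, Pattern N p (fun k => S (cycIdx hn r k)) :=
    ⟨r, hr, p, hT.p_lt, hT⟩
  clear hT hr
  refine (Runs.seq ((runs_halfLength hN hB hn rfl rfl).mono le_rfl ?_)).mono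
    (T := n * 50 + 50 + (n * 50 + 50 + (n * (N * (N * 50 + 150) + 50) + 50 + (n * 50 + 50 +
      (n * 100 + 50 + (3 * n * (n * (n * 200 + 400) + 320) + 50)))))) ?_ (fun _ h => h)
  · rintro s1 ⟨h0, h1, h2⟩
    refine Runs.seq ((runs_copyTurns hB hn h0 h1 h2).mono le_rfl fun s2 k2 => ?_)
    refine Runs.seq ((runs_findPattern hN hB k2 hS').mono le_rfl ?_)
    rintro s3 ⟨k3, hr, hT⟩
    have hH := leastLabelling_leastLabel hT
    have hp := hT.p_lt
    refine Runs.seq ((runs_forwardHeights hN hB hr hp ⟨k3, rfl, rfl⟩).mono le_rfl ?_)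
    rintro s4 ⟨k4, hs4⟩
    refine Runs.seq ((runs_backwardHeights hN hB hr hp k4 hs4).mono le_rfl ?_)
    rintro s5 ⟨k5, hs5⟩
    refine (runs_tryHeights hN hB hr hT.p_pos hp
      (fun t h1 h2 => (hH.bound t h1 h2).trans hN.ge) k5 hs5).mono le_rfl ?_
    rintro s6 ⟨b, hb⟩
    exact hb.realizesWithMinBoundingBox_output hN hS hT hH
  · subst hN
    have h1 : N ≤ N ^ 3 := Nat.le_self_pow (by omega) N
    have h2 : N ^ 2 ≤ N ^ 3 := Nat.pow_le_pow_right (by omega) (by omega)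
    have h3 : 1 ≤ N ^ 3 := by omega
    ring_nf
    omega

end RAM

/-- There is a word RAM program that, given any `x`-monotone angle sequence `S` of any length `n`,
computes in `O(n ^ 3)` time, with words of `O(log n)` bits, a polygon that realizes `S` and
minimizes the area of the bounding box among all polygons that realize `S`. -/
theorem mainTheorem5 :
    ∃ (prog : RAM.Program) (c C : ℕ), ∀ (n : ℕ) (S : AngleSequence n), S.IsXMonotone →
      ∃ (s : RAM.State) (t : ℕ),
        RAM.Exec (n ^ c) prog (RAM.input S) s t ∧ t ≤ C * n ^ 3 ∧
        (RAM.output n s).RealizesWithMinBoundingBox S := by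
  refine ⟨RAM.minimize, 8, 10000, fun n S hS => ?_⟩
  refine RAM.runs_minimize hS ?_
  obtain ⟨hn, N, p, r, hN, -, hT⟩ := hS.exists_pattern
  -- From `0 < p < N`. Thus `n ^ 6` is at least `4 ^ 6 = 4096` and absorbs the factor `1000`, so the
  -- exponent `8` needs no exception for small `n`.
  have hn : 4 ≤ n := by have := hT.p_pos; have := hT.p_lt; omega
  calc 1000 * (n * n) ≤ 4 ^ 6 * (n * n) := Nat.mul_le_mul_right _ (by norm_num)
    _ ≤ n ^ 6 * (n * n) := Nat.mul_le_mul_right _ (Nat.pow_le_pow_left hn 6)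
    _ = n ^ 8 := by ring
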